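/- **Model.** A major agent $0$ and minor agents $i\in N=\{1,\dots,n\}$ evolve over times $1,\dots,T$ ($T\ge 1$), with states $x_i(t)$ and controls $u_i(t)$ in Euclidean spaces: $$x_0(t+1)=A_{00}x_0(t)+B_{00}u_0(t)+w_0(t),$$ $$x_i(t+1)=A_{ii}x_i(t)+A_{i0}x_0(t)+B_{ii}u_i(t)+B_{i0}u_0(t)+w_i(t),\qquad y_i(t)=C_{ii}x_i(t)+v_i(t),\qquad i\in N.$$ The primitive random variables $x_0(1),x_i(1)$ and $w_0(t),w_i(t),v_i(t)$ ($i\in N$, $1\le t\le T$) are independent, have zero mean and finite variance, and need not be Gaussian; for $i\in N$, $\Sigma^x_i,\Sigma^w_i,\Sigma^v_i$ are the covariance matrices of $x_i(1),w_i(t),v_i(t)$ (the latter two not depending on $t$). Write $x(t),u(t)$ for the stacked state and control, and $x(t+1)=Ax(t)+Bu(t)+w(t)$ for the stacked dynamics. The agents know $$I_0(t)=\{x_0(1{:}t),u_0(1{:}t-1)\},\qquad I_i(t)=\{x_0(1{:}t),y_i(1{:}t),u_0(1{:}t-1),u_i(1{:}t-1)\},$$ and an affine strategy $g$ consists of affine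 maps $g_{i,t}$ with $u_i(t)=g_{i,t}(I_i(t))$, $i\in\{0,\dots,n\}$. Its cost is $$J(g)=\mathbb E\Big[\sum_{t=1}^{T-1}\big(x(t)^\top Qx(t)+u(t)^\top Ru(t)\big)+x(T)^\top Q_Tx(T)\Big],$$ with $Q,Q_T$ symmetric positive semidefinite and $R$ symmetric positive definite. **Notation.** Put $$\mathcal R(P,A,B,Q,R)=Q+A^\top PA-A^\top PB(R+B^\top PB)^{-1}B^\top PA,\qquad \mathcal G(P,A,B,R)=(R+B^\top PB)^{-1}B^\top PA,$$ $$\mathcal M(P,A,C,\Sigma,\Sigma')=CAPA^\top C^\top+C\Sigma C^\top+\Sigma',\qquad \mathcal K(P,A,C,\Sigma,\Sigma')=(APA^\top C^\top+\Sigma C^\top)\,\mathcal M(P,A,C,\Sigma,\Sigma')^{-1},$$ $$\mathcal F(P,A,C,\Sigma,\Sigma')=APA^\top+\Sigma-\mathcal K\mathcal M\mathcal K^\top .$$ Let $S^c(T)=Q_T$, $S^\ell_i(T)=[Q_T]_{ii}$, and for $t<T$ let $S^c(t)=\mathcal R(S^c(t+1),A,B,Q,R)$, $S^\ell_i(t)=\mathcal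 R(S^\ell_i(t+1),A_{ii},B_{ii},Q_{ii},R_{ii})$, $L^c(t)=\mathcal G(S^c(t+1),A,B,R)$, $L^\ell_i(t)=\mathcal G(S^\ell_i(t+1),A_{ii},B_{ii},R_{ii})$; $L^c_i(t)$ is the $i$-th block row of $L^c(t)$. The LLMS estimate of a random vector given data is the estimate of least mean square error among the affine functions of the data (among the linear ones, when everything is centred). Given a strategy, let $\hat x(t|c)$ and $\hat x(t|i)$ be the LLMS estimates of $x(t)$ given $I_0(t)$ and given $I_i(t)$, with $i$-th components $\hat x_i(t|c)$ and $\hat x_i(t|i)$, and let $u^c(t)=\mathbb E[u(t)\mid I_0(t)]$. **Theorem.** 1. An affine strategy minimizing $J$ among all affine strategies exists, and it is unique in the sense that any two minimizers produce almost surely the same controls at the times $1,\dots,T-1$. An affine strategy is a minimizer if and only if, almost surely, for all $1\le t\le T-1$ and $i\in N$, $$u_0(t)=-L^c_0(t)\,\hat x(t|c),\qquad u_i(t)=-L^c_i(t)\,\hat x(t|c)-L^\ell_i(t)\big(\hat x_i(t|i)-\hat x_i(t|c)\big).$$ Under a minimizer the LLMS estimates are given by linear functions of the data (no constant terms). 2.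 Under every affine strategy the LLMS estimates exist, the major agent's LLMS estimate coincides almost surely with its MMSE estimate, $\hat x(t|c)=\mathbb E[x(t)\mid I_0(t)]$ for $1\le t\le T$, and $\hat x(1|c)=\mathrm{vec}(x_0(1),0,\dots,0)$, $$\hat x(t+1|c)=A\,\mathrm{vec}\big(x_0(t),\hat x_1(t|c),\dots,\hat x_n(t|c)\big)+B\,\mathrm{vec}\big(u_0(t),u^c_1(t),\dots,u^c_n(t)\big)+\mathrm{vec}\big(w_0(t),0,\dots,0\big),\qquad t<T,$$ where $w_0(t)=x_0(t+1)-A_{00}x_0(t)-B_{00}u_0(t)$. 3. Define, independently of the strategy, $K_i(1)=\mathcal K(0,A_{ii},C_{ii},\Sigma^x_i,\Sigma^v_i)$, $P_i(1)=\mathcal F(0,A_{ii},C_{ii},\Sigma^x_i,\Sigma^v_i)$ and, for $t>1$, $$K_i(t)=\mathcal K(P_i(t-1),A_{ii},C_{ii},\Sigma^w_i,\Sigma^v_i),\qquad P_i(t)=\mathcal F(P_i(t-1),A_{ii},C_{ii},\Sigma^w_i,\Sigma^v_i).$$ Under every affine strategy, for $i\in N$ and $t\le T$ such that the matrices inverted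 in $K_i(1),\dots,K_i(t)$ are invertible, $P_i(t)=\mathrm{var}(x_i(t)-\hat x_i(t|i))$ and, almost surely, $\hat x_i(1|i)=K_i(1)y_i(1)$ and, if $t>1$, $\hat x_i(t|i)=m_i(t)+K_i(t)\big(y_i(t)-C_{ii}m_i(t)\big)$, where $$m_i(t)=A_{ii}\hat x_i(t-1|i)+A_{i0}x_0(t-1)+B_{ii}u_i(t-1)+B_{i0}u_0(t-1).$$ -/

import Mathlib

open MeasureTheory ProbabilityTheory Matrix

noncomputable section

namespace MajorMinor

/-! Time is counted from `0`: the Lean time `t` is the time `t + 1` of the informal statement.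
With `N = T - 1`, the times `1, …, T` become `0, …, N`; controls act at `0, …, N - 1` and the
terminal cost is paid at `N`. -/

/-- The data of the control problem: one major agent (subscript `₀`) and `n` minor agents.
`A₁₀ i`, `A₁₁ i` are the blocks `A_{i0}`, `A_{ii}`, and likewise for `B`. `Q`, `QT`, `R` act on
the stacked state and on the stacked control. -/
structure Model (n : ℕ) where
  dx₀ : ℕ
  du₀ : ℕ
  dx : Fin n → ℕ
  du : Fin n → ℕ
  dy : Fin n → ℕ
  A₀₀ : Matrix (Fin dx₀) (Fin dx₀) ℝ
  A₁₀ : ∀ i, Matrix (Fin (dx i)) (Fin dx₀) ℝ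
  A₁₁ : ∀ i, Matrix (Fin (dx i)) (Fin (dx i)) ℝ
  B₀₀ : Matrix (Fin dx₀) (Fin du₀) ℝ
  B₁₀ : ∀ i, Matrix (Fin (dx i)) (Fin du₀) ℝ
  B₁₁ : ∀ i, Matrix (Fin (dx i)) (Fin (du i)) ℝ
  C : ∀ i, Matrix (Fin (dy i)) (Fin (dx i)) ℝ
  Q : Matrix (Fin dx₀ ⊕ (Σ i, Fin (dx i))) (Fin dx₀ ⊕ (Σ i, Fin (dx i))) ℝ
  QT : Matrix (Fin dx₀ ⊕ (Σ i, Fin (dx i))) (Fin dx₀ ⊕ (Σ i, Fin (dx i))) ℝ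
  R : Matrix (Fin du₀ ⊕ (Σ i, Fin (du i))) (Fin du₀ ⊕ (Σ i, Fin (du i))) ℝ

/-! ### Riccati and Kalman operators -/

section Operators

variable {l m p : Type*} [Fintype l] [Fintype m] [Fintype p] [DecidableEq m] [DecidableEq p]

/-- `ℛ(P, A, B, Q, R)` -/
def riccati (P A : Matrix l l ℝ) (B : Matrix l m ℝ) (Q : Matrix l l ℝ) (R : Matrix m m ℝ) :
    Matrix l l ℝ :=
  Q + Aᵀ * P * A - Aᵀ * P * B * (R + Bᵀ * P * B)⁻¹ * Bᵀ * P * A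

/-- `𝒢(P, A, B, R)` -/
def riccatiGain (P A : Matrix l l ℝ) (B : Matrix l m ℝ) (R : Matrix m m ℝ) : Matrix m l ℝ :=
  (R + Bᵀ * P * B)⁻¹ * Bᵀ * P * A

/-- The matrix inverted in `𝒦(P, A, C, S, S')`. -/
def innovationCov (P A : Matrix l l ℝ) (C : Matrix p l ℝ) (S : Matrix l l ℝ)
    (S' : Matrix p p ℝ) : Matrix p p ℝ :=
  C * A * P * Aᵀ * Cᵀ + C * S * Cᵀ + S'

/-- `𝒦(P, A, C, S, S')` -/
def kalmanGain (P A : Matrix l l ℝ) (C : Matrix p l ℝ) (S : Matrix l l ℝ)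
    (S' : Matrix p p ℝ) : Matrix l p ℝ :=
  (A * P * Aᵀ * Cᵀ + S * Cᵀ) * (innovationCov P A C S S')⁻¹

/-- `ℱ(P, A, C, S, S')` -/
def kalmanCov (P A : Matrix l l ℝ) (C : Matrix p l ℝ) (S : Matrix l l ℝ)
    (S' : Matrix p p ℝ) : Matrix l l ℝ :=
  A * P * Aᵀ + S -
    kalmanGain P A C S S' * innovationCov P A C S S' * (kalmanGain P A C S S')ᵀ

end Operators

/-! ### Matrices of the model, Riccati recursions, filter recursions -/

namespace Model

variable {n : ℕ} (M : Model n)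

/-- Coordinates of the stacked state `vec(x₀, …, xₙ)`. -/
abbrev StateIdx : Type := Fin M.dx₀ ⊕ (Σ i, Fin (M.dx i))

/-- Coordinates of the stacked control `vec(u₀, …, uₙ)`. -/
abbrev ControlIdx : Type := Fin M.du₀ ⊕ (Σ i, Fin (M.du i))

/-- The block lower triangular matrix `A`. -/
def A : Matrix M.StateIdx M.StateIdx ℝ :=
  Matrix.fromBlocks M.A₀₀ 0 (Matrix.of fun p b => M.A₁₀ p.1 p.2 b) (Matrix.blockDiagonal' M.A₁₁)

/-- The block lower triangular matrix `B`. -/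
def B : Matrix M.StateIdx M.ControlIdx ℝ :=
  Matrix.fromBlocks M.B₀₀ 0 (Matrix.of fun p b => M.B₁₀ p.1 p.2 b) (Matrix.blockDiagonal' M.B₁₁)

/-- `Q_{ii}` -/
def Qblock (i : Fin n) : Matrix (Fin (M.dx i)) (Fin (M.dx i)) ℝ :=
  M.Q.submatrix (fun a => Sum.inr ⟨i, a⟩) (fun a => Sum.inr ⟨i, a⟩)

/-- `[Q_T]_{ii}` -/
def QTblock (i : Fin n) : Matrix (Fin (M.dx i)) (Fin (M.dx i)) ℝ :=
  M.QT.submatrix (fun a => Sum.inr ⟨i, a⟩) (fun a => Sum.inr ⟨i, a⟩)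

/-- `R_{ii}` -/
def Rblock (i : Fin n) : Matrix (Fin (M.du i)) (Fin (M.du i)) ℝ :=
  M.R.submatrix (fun a => Sum.inr ⟨i, a⟩) (fun a => Sum.inr ⟨i, a⟩)

/-- Common Riccati matrix with `k` steps to go, so that `S^c(t) = riccatiCom (N - t)`. -/
def riccatiCom : ℕ → Matrix M.StateIdx M.StateIdx ℝ
  | 0 => M.QT
  | k + 1 => riccati (riccatiCom k) M.A M.B M.Q M.R

/-- Local Riccati matrix with `k` steps to go, so that `S^ℓ_i(t) = riccatiLoc i (N - t)`. -/
def riccatiLoc (i : Fin n) : ℕ → Matrix (Fin (M.dx i)) (Fin (M.dx i)) ℝ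
  | 0 => M.QTblock i
  | k + 1 => riccati (riccatiLoc i k) (M.A₁₁ i) (M.B₁₁ i) (M.Qblock i) (M.Rblock i)

/-- `L^c(t)`, for `t < N`. -/
def gainCom (N t : ℕ) : Matrix M.ControlIdx M.StateIdx ℝ :=
  riccatiGain (M.riccatiCom (N - (t + 1))) M.A M.B M.R

/-- `L^c_0(t)`, the block row of `L^c(t)` of the major agent. -/
def gainCom₀ (N t : ℕ) : Matrix (Fin M.du₀) M.StateIdx ℝ :=
  (M.gainCom N t).submatrix Sum.inl id

/-- `L^c_i(t)`, the block row of `L^c(t)` of the minor agent `i`. -/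
def gainComMinor (N : ℕ) (i : Fin n) (t : ℕ) : Matrix (Fin (M.du i)) M.StateIdx ℝ :=
  (M.gainCom N t).submatrix (fun a => Sum.inr ⟨i, a⟩) id

/-- `L^ℓ_i(t)`, for `t < N`. -/
def gainLoc (N : ℕ) (i : Fin n) (t : ℕ) : Matrix (Fin (M.du i)) (Fin (M.dx i)) ℝ :=
  riccatiGain (M.riccatiLoc i (N - (t + 1))) (M.A₁₁ i) (M.B₁₁ i) (M.Rblock i)

/-- Covariances of the initial states, process noises and observation noises of the minor
agents. -/
structure Covariances where
  x : ∀ i, Matrix (Fin (M.dx i)) (Fin (M.dx i)) ℝ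
  w : ∀ i, Matrix (Fin (M.dx i)) (Fin (M.dx i)) ℝ
  v : ∀ i, Matrix (Fin (M.dy i)) (Fin (M.dy i)) ℝ

variable {M} (S : M.Covariances)

/-- `P_i(t)`: before the first observation the error covariance is that of the initial state. -/
def errorCov (i : Fin n) : ℕ → Matrix (Fin (M.dx i)) (Fin (M.dx i)) ℝ
  | 0 => kalmanCov 0 (M.A₁₁ i) (M.C i) (S.x i) (S.v i)
  | t + 1 => kalmanCov (errorCov i t) (M.A₁₁ i) (M.C i) (S.w i) (S.v i)

/-- `K_i(t)` -/
def filterGain (i : Fin n) : ℕ → Matrix (Fin (M.dx i)) (Fin (M.dy i)) ℝ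
  | 0 => kalmanGain 0 (M.A₁₁ i) (M.C i) (S.x i) (S.v i)
  | t + 1 => kalmanGain (errorCov S i t) (M.A₁₁ i) (M.C i) (S.w i) (S.v i)

/-- The matrix whose inverse enters `K_i(t)`. -/
def filterInnovationCov (i : Fin n) : ℕ → Matrix (Fin (M.dy i)) (Fin (M.dy i)) ℝ
  | 0 => innovationCov 0 (M.A₁₁ i) (M.C i) (S.x i) (S.v i)
  | t + 1 => innovationCov (errorCov S i t) (M.A₁₁ i) (M.C i) (S.w i) (S.v i)

/-! ### Affine strategies -/

variable (M)

/-- Values of `I₀(t) = {x₀(0:t), u₀(0:t-1)}`. -/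
abbrev Info₀ (t : ℕ) : Type :=
  (Fin (t + 1) → Fin M.dx₀ → ℝ) × (Fin t → Fin M.du₀ → ℝ)

/-- Values of `I_i(t) = {x₀(0:t), y_i(0:t), u₀(0:t-1), u_i(0:t-1)}`. -/
abbrev Info (i : Fin n) (t : ℕ) : Type :=
  (Fin (t + 1) → Fin M.dx₀ → ℝ) × (Fin (t + 1) → Fin (M.dy i) → ℝ) ×
    (Fin t → Fin M.du₀ → ℝ) × (Fin t → Fin (M.du i) → ℝ)

/-- Affine control laws for all agents. -/
structure AffineStrategy where
  g₀ : ∀ t, M.Info₀ t →ᵃ[ℝ] (Fin M.du₀ → ℝ)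
  g : ∀ i t, M.Info i t →ᵃ[ℝ] (Fin (M.du i) → ℝ)

end Model

/-! ### Primitive random variables -/

/-- Initial states, process noises and observation noises. -/
structure Primitives {n : ℕ} (M : Model n) (Ω : Type*) where
  x₀ : Ω → Fin M.dx₀ → ℝ
  x : ∀ i, Ω → Fin (M.dx i) → ℝ
  w₀ : ℕ → Ω → Fin M.dx₀ → ℝ
  w : ∀ i, ℕ → Ω → Fin (M.dx i) → ℝ
  v : ∀ i, ℕ → Ω → Fin (M.dy i) → ℝ

/-- Labels of the primitive random variables of the times `0, …, N`. -/
inductive PrimIdx (n N : ℕ) : Type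
  | x₀ : PrimIdx n N
  | x (i : Fin n) : PrimIdx n N
  | w₀ (t : Fin (N + 1)) : PrimIdx n N
  | w (i : Fin n) (t : Fin (N + 1)) : PrimIdx n N
  | v (i : Fin n) (t : Fin (N + 1)) : PrimIdx n N

def PrimIdx.dim {n N : ℕ} (M : Model n) : PrimIdx n N → ℕ
  | .x₀ => M.dx₀
  | .x i => M.dx i
  | .w₀ _ => M.dx₀
  | .w i _ => M.dx i
  | .v i _ => M.dy i

def Primitives.var {n : ℕ} {M : Model n} {Ω : Type*} (P : Primitives M Ω) (N : ℕ) :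
    (k : PrimIdx n N) → Ω → Fin (k.dim M) → ℝ
  | .x₀ => P.x₀
  | .x i => P.x i
  | .w₀ t => P.w₀ t
  | .w i t => P.w i t
  | .v i t => P.v i t

/-- The covariance matrix of a random vector. -/
def covMatrix {Ω ι : Type*} [MeasurableSpace Ω] (μ : Measure Ω) (X : Ω → ι → ℝ) :
    Matrix ι ι ℝ :=
  Matrix.of fun a b => cov[fun ω => X ω a, fun ω => X ω b; μ]

/-- The primitive random variables are independent, with zero mean and finite variance, and those
of the minor agents have the covariances `S`. -/
structure Primitives.Admissible {n : ℕ} {M : Model n} {Ω : Type*} [MeasurableSpace Ω]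
    (P : Primitives M Ω) (μ : Measure Ω) (N : ℕ) (S : M.Covariances) : Prop where
  measurable : ∀ k, Measurable (P.var N k)
  indep : iIndepFun (P.var N) μ
  memLp : ∀ k, MemLp (P.var N k) 2 μ
  mean_zero : ∀ k, ∫ ω, P.var N k ω ∂μ = 0
  cov_x : ∀ i, covMatrix μ (P.x i) = S.x i
  cov_w : ∀ i, ∀ t ≤ N, covMatrix μ (P.w i t) = S.w i
  cov_v : ∀ i, ∀ t ≤ N, covMatrix μ (P.v i t) = S.v i

/-! ### The closed loop -/

section ClosedLoop

variable {n : ℕ} {M : Model n} {Ω : Type*} (P : Primitives M Ω) (g : M.AffineStrategy)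

mutual

/-- State `x₀(t)` of the major agent. -/
def x₀ (t : ℕ) (ω : Ω) : Fin M.dx₀ → ℝ :=
  match t with
  | 0 => P.x₀ ω
  | t + 1 => M.A₀₀ *ᵥ x₀ t ω + M.B₀₀ *ᵥ u₀ t ω + P.w₀ t ω
termination_by (t, 0)

/-- Control `u₀(t)` of the major agent. -/
def u₀ (t : ℕ) (ω : Ω) : Fin M.du₀ → ℝ :=
  g.g₀ t (fun s => x₀ s.1 ω, fun s => u₀ s.1 ω)
termination_by (t, 1)
decreasing_by
  all_goals
    have := s.isLt
    simp only [Prod.lex_def]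
    omega

end

mutual

/-- State `x_i(t)` of the minor agent `i`. -/
def x (i : Fin n) (t : ℕ) (ω : Ω) : Fin (M.dx i) → ℝ :=
  match t with
  | 0 => P.x i ω
  | t + 1 => M.A₁₁ i *ᵥ x i t ω + M.A₁₀ i *ᵥ x₀ P g t ω + M.B₁₁ i *ᵥ u i t ω
      + M.B₁₀ i *ᵥ u₀ P g t ω + P.w i t ω
termination_by (t, 0)

/-- Control `u_i(t)` of the minor agent `i`; the second entry of its data is `y_i(0:t)`. -/
def u (i : Fin n) (t : ℕ) (ω : Ω) : Fin (M.du i) → ℝ :=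
  g.g i t (fun s => x₀ P g s.1 ω, fun s => M.C i *ᵥ x i s.1 ω + P.v i s.1 ω,
    fun s => u₀ P g s.1 ω, fun s => u i s.1 ω)
termination_by (t, 1)
decreasing_by
  all_goals
    have := s.isLt
    simp only [Prod.lex_def]
    omega

end

/-- Output `y_i(t)` of the minor agent `i`. -/
def y (i : Fin n) (t : ℕ) (ω : Ω) : Fin (M.dy i) → ℝ :=
  M.C i *ᵥ x P g i t ω + P.v i t ω

/-- The information `I₀(t)`. -/
def info₀ (t : ℕ) (ω : Ω) : M.Info₀ t :=
  (fun s => x₀ P g s.1 ω, fun s => u₀ P g s.1 ω)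

/-- The information `I_i(t)`. -/
def info (i : Fin n) (t : ℕ) (ω : Ω) : M.Info i t :=
  (fun s => x₀ P g s.1 ω, fun s => y P g i s.1 ω, fun s => u₀ P g s.1 ω, fun s => u P g i s.1 ω)

theorem u₀_eq (t : ℕ) (ω : Ω) : u₀ P g t ω = g.g₀ t (info₀ P g t ω) := by
  rw [u₀]; rfl

theorem u_eq (i : Fin n) (t : ℕ) (ω : Ω) : u P g i t ω = g.g i t (info P g i t ω) := by
  rw [u]; rfl

/-- The stacked state `x(t)`. -/
def state (t : ℕ) (ω : Ω) : M.StateIdx → ℝ :=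
  Sum.elim (x₀ P g t ω) fun p => x P g p.1 t ω p.2

/-- The stacked control `u(t)`. -/
def control (t : ℕ) (ω : Ω) : M.ControlIdx → ℝ :=
  Sum.elim (u₀ P g t ω) fun p => u P g p.1 t ω p.2

variable [MeasurableSpace Ω] (μ : Measure Ω)

/-- The expected total cost `J(g)`. -/
def cost (N : ℕ) : ℝ :=
  ∫ ω, ((∑ t ∈ Finset.range N, (state P g t ω ⬝ᵥ M.Q *ᵥ state P g t ω
      + control P g t ω ⬝ᵥ M.R *ᵥ control P g t ω))
    + state P g N ω ⬝ᵥ M.QT *ᵥ state P g N ω) ∂μ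

/-- `g` is a best strategy among the affine ones. -/
def IsOptimal (N : ℕ) : Prop :=
  ∀ g' : M.AffineStrategy, cost P g μ N ≤ cost P g' μ N

end ClosedLoop

/-! ### LLMS and MMSE estimates -/

section Estimates

variable {Ω E ι : Type*} [MeasurableSpace Ω] [AddCommGroup E] [Module ℝ E] [Fintype ι]

/-- `f(Z)` has the least mean square error among all estimates of `X` that are affine in the data
`Z`. (For centred `X` and `Z` the minimum is attained by a linear `f`.) -/
def IsLLMSEstimator (μ : Measure Ω) (Z : Ω → E) (X : Ω → ι → ℝ) (f : E →ᵃ[ℝ] (ι → ℝ)) : Prop :=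
  ∀ h : E →ᵃ[ℝ] (ι → ℝ),
    ∫ ω, ∑ a, (X ω a - f (Z ω) a) ^ 2 ∂μ ≤ ∫ ω, ∑ a, (X ω a - h (Z ω) a) ^ 2 ∂μ

/-- The LLMS estimate of `X` given `Z`. -/
def llms (μ : Measure Ω) (Z : Ω → E) (X : Ω → ι → ℝ) (ω : Ω) : ι → ℝ :=
  Classical.epsilon (IsLLMSEstimator μ Z X) (Z ω)

variable {n : ℕ} {M : Model n} (P : Primitives M Ω) (g : M.AffineStrategy) (μ : Measure Ω)

/-- The major agent's LLMS estimate `x̂(t|c)` of the state of the system. -/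
def xhatCom (t : ℕ) : Ω → M.StateIdx → ℝ :=
  llms μ (info₀ P g t) (state P g t)

/-- The component `x̂_i(t|c)` of `x̂(t|c)`. -/
def xhatComMinor (i : Fin n) (t : ℕ) (ω : Ω) : Fin (M.dx i) → ℝ :=
  fun a => xhatCom P g μ t ω (Sum.inr ⟨i, a⟩)

/-- The LLMS estimate `x̂(t|i)` of the state of the system by the minor agent `i`. -/
def xhatMinor (i : Fin n) (t : ℕ) : Ω → M.StateIdx → ℝ :=
  llms μ (info P g i t) (state P g t)

/-- The component `x̂_i(t|i)` of `x̂(t|i)`. -/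
def xhatLoc (i : Fin n) (t : ℕ) (ω : Ω) : Fin (M.dx i) → ℝ :=
  fun a => xhatMinor P g μ i t ω (Sum.inr ⟨i, a⟩)

/-- The σ-algebra generated by `I₀(t)`. -/
abbrev commonSigma (t : ℕ) : MeasurableSpace Ω :=
  MeasurableSpace.comap (info₀ P g t) inferInstance

/-- The common control `u^c(t) = E[u(t) | I₀(t)]`. -/
def controlCom (t : ℕ) : Ω → M.ControlIdx → ℝ :=
  μ[control P g t | commonSigma P g t]

/-- The one-step prediction of `x_i(t+1)` from `x̂_i(t|i)`, `x₀(t)`, `u_i(t)`, `u₀(t)`. -/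
def prediction (i : Fin n) (t : ℕ) (ω : Ω) : Fin (M.dx i) → ℝ :=
  M.A₁₁ i *ᵥ xhatLoc P g μ i t ω + M.A₁₀ i *ᵥ x₀ P g t ω + M.B₁₁ i *ᵥ u P g i t ω
    + M.B₁₀ i *ᵥ u₀ P g t ω

/-- The controls of the times `0, …, N - 1` have the certainty-equivalent form
`u₀ = -L^c_0 x̂(t|c)`, `u_i = -L^c_i x̂(t|c) - L^ℓ_i (x̂_i(t|i) - x̂_i(t|c))`. -/
def HasOptimalForm (N : ℕ) : Prop :=
  ∀ t < N,
    (∀ᵐ ω ∂μ, u₀ P g t ω = -(M.gainCom₀ N t *ᵥ xhatCom P g μ t ω)) ∧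
    ∀ i, ∀ᵐ ω ∂μ, u P g i t ω = -(M.gainComMinor N i t *ᵥ xhatCom P g μ t ω)
      - M.gainLoc N i t *ᵥ (xhatLoc P g μ i t ω - xhatComMinor P g μ i t ω)

end Estimates

end MajorMinor

end

/-! A minor agent's state reacts to the other agents only through the data of the major agent, which
all agents share. Hence, under any affine strategy, controls and states split orthogonally as a
common part, a function of the primitive random variables of the major agent, plus one local part
for each minor agent, a function of that agent's primitive random variables, and the common state
is the major agent's estimate of the state. The cost splits accordingly into `n + 1`
linear-quadratic problems. Completing squares along the Riccati recursions turns the excess of each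
over a constant into a sum of squares, of the deviations of the controls from the certainty
equivalent ones, so that the minimum is attained exactly where all the deviations vanish.

LLMS estimates are `L²` projections to the affine functions of the data. The error of the
estimate of `x_i` given the data of minor agent `i` is that of the uncontrolled system driven by the
same noise, hence does not depend on the strategy; it obeys the Kalman recursion because the
innovation is orthogonal to the past data. -/

noncomputable section

namespace MajorMinor

/-! ### Random vectors with components in a space of random variables -/

section VecMem

variable {Ω E F ι κ : Type*} [AddCommGroup E] [Module ℝ E] [AddCommGroup F] [Module ℝ F]
  {W W' : Submodule ℝ (Ω → ℝ)}

/-- The random vector `Z` has its components in the space `W` of random variables. For `E = ι → ℝ`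
with `ι` finite it is enough to look at the coordinates; asking it of all linear functionals avoids
choosing a basis of the spaces of data. -/
def VecMem (W : Submodule ℝ (Ω → ℝ)) (Z : Ω → E) : Prop :=
  ∀ φ : E →ₗ[ℝ] ℝ, (fun ω => φ (Z ω)) ∈ W

namespace VecMem

theorem mono {Z : Ω → E} (hZ : VecMem W Z) (h : W ≤ W') : VecMem W' Z :=
  fun φ => h (hZ φ)

theorem map {Z : Ω → E} (hZ : VecMem W Z) (f : E →ₗ[ℝ] F) : VecMem W fun ω => f (Z ω) :=
  fun φ => hZ (φ ∘ₗ f)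

theorem zero : VecMem W fun _ : Ω => (0 : E) := fun φ => by
  simp only [map_zero]
  exact W.zero_mem

theorem add {Z Z' : Ω → E} (hZ : VecMem W Z) (hZ' : VecMem W Z') :
    VecMem W fun ω => Z ω + Z' ω := fun φ => by
  simp only [map_add]
  exact W.add_mem (hZ φ) (hZ' φ)

theorem neg {Z : Ω → E} (hZ : VecMem W Z) : VecMem W fun ω => -Z ω :=
  hZ.map (-LinearMap.id)

theorem sub {Z Z' : Ω → E} (hZ : VecMem W Z) (hZ' : VecMem W Z') :
    VecMem W fun ω => Z ω - Z' ω := by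
  simpa only [sub_eq_add_neg] using hZ.add hZ'.neg

theorem sum {s : Finset ι} {Z : ι → Ω → E} (hZ : ∀ a ∈ s, VecMem W (Z a)) :
    VecMem W fun ω => ∑ a ∈ s, Z a ω := fun φ => by
  have : (fun ω => φ (∑ a ∈ s, Z a ω)) = ∑ a ∈ s, fun ω => φ (Z a ω) := by
    funext ω
    simp only [map_sum, Finset.sum_apply]
  rw [this]
  exact W.sum_mem fun a ha => hZ a ha φ

theorem prodMk {Z : Ω → E} {Z' : Ω → F} (hZ : VecMem W Z) (hZ' : VecMem W Z') :
    VecMem W fun ω => (Z ω, Z' ω) := by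
  simpa using (hZ.map (LinearMap.inl ℝ E F)).add (hZ'.map (LinearMap.inr ℝ E F))

theorem pi [Finite ι] {Z : Ω → ι → E} (hZ : ∀ a, VecMem W fun ω => Z ω a) : VecMem W Z := by
  classical
  cases nonempty_fintype ι
  have := VecMem.sum (s := Finset.univ) fun a _ => (hZ a).map (LinearMap.single ℝ (fun _ => E) a)
  simpa only [LinearMap.coe_single, Finset.univ_sum_single] using this

theorem of_apply [Finite ι] {Z : Ω → ι → ℝ} (hZ : ∀ a, (fun ω => Z ω a) ∈ W) : VecMem W Z :=
  VecMem.pi fun a φ => by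
    have : (fun ω => φ (Z ω a)) = φ 1 • fun ω => Z ω a := by
      funext ω
      rw [Pi.smul_apply, smul_eq_mul, mul_comm, ← smul_eq_mul, ← map_smul, smul_eq_mul, mul_one]
    rw [this]
    exact W.smul_mem _ (hZ a)

theorem apply {Z : Ω → ι → ℝ} (hZ : VecMem W Z) (a : ι) : (fun ω => Z ω a) ∈ W :=
  hZ (LinearMap.proj a)

theorem eval {Z : Ω → ι → E} (hZ : VecMem W Z) (a : ι) : VecMem W fun ω => Z ω a :=
  hZ.map (LinearMap.proj a)

theorem precomp {Z : Ω → ι → ℝ} (hZ : VecMem W Z) (e : κ → ι) :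
    VecMem W fun ω a => Z ω (e a) :=
  hZ.map (LinearMap.funLeft ℝ ℝ e)

theorem fst {Z : Ω → E × F} (hZ : VecMem W Z) : VecMem W fun ω => (Z ω).1 :=
  hZ.map (LinearMap.fst ℝ E F)

theorem snd {Z : Ω → E × F} (hZ : VecMem W Z) : VecMem W fun ω => (Z ω).2 :=
  hZ.map (LinearMap.snd ℝ E F)

theorem mulVec [Fintype ι] {Z : Ω → ι → ℝ} (hZ : VecMem W Z) (A : Matrix κ ι ℝ) :
    VecMem W fun ω => A *ᵥ Z ω :=
  hZ.map A.mulVecLin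

theorem sumElim [Finite ι] [Finite κ] {Z : Ω → ι → ℝ} {Z' : Ω → κ → ℝ} (hZ : VecMem W Z)
    (hZ' : VecMem W Z') : VecMem W fun ω => Sum.elim (Z ω) (Z' ω) :=
  .of_apply <| Sum.rec hZ.apply hZ'.apply

theorem const (hW : (fun _ => 1) ∈ W) (c : E) : VecMem W fun _ => c := fun φ => by
  have : (fun _ : Ω => φ c) = φ c • fun _ => (1 : ℝ) := by
    funext ω
    rw [Pi.smul_apply, smul_eq_mul, mul_one]
  rw [this]
  exact W.smul_mem _ hW

theorem affine {Z : Ω → E} (hZ : VecMem W Z) (hW : (fun _ => 1) ∈ W) (f : E →ᵃ[ℝ] F) :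
    VecMem W fun ω => f (Z ω) := by
  have : (fun ω => f (Z ω)) = fun ω => f.linear (Z ω) + f 0 :=
    funext fun ω => congrFun f.decomp (Z ω)
  rw [this]
  exact (hZ.map f.linear).add (const hW (f 0))

theorem exists_add_of_sup [Finite ι] {Z : Ω → ι → ℝ} (hZ : VecMem (W ⊔ W') Z) :
    ∃ X Y : Ω → ι → ℝ, VecMem W X ∧ VecMem W' Y ∧ ∀ ω, Z ω = X ω + Y ω := by
  choose f hf k hk hfk using fun a => Submodule.mem_sup.1 (hZ.apply a)
  exact ⟨fun ω a => f a ω, fun ω a => k a ω, of_apply hf, of_apply hk,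
    fun ω => funext fun a => (congrFun (hfk a) ω).symm⟩

end VecMem

/-- The random variables that are affine functions of the data `Z`. -/
def affineFunctionsOf (Z : Ω → E) : Submodule ℝ (Ω → ℝ) where
  carrier := {h | ∃ f : E →ᵃ[ℝ] ℝ, ∀ ω, f (Z ω) = h ω}
  add_mem' := by
    rintro _ _ ⟨f, hf⟩ ⟨f', hf'⟩
    exact ⟨f + f', fun ω => by simp [hf, hf']⟩
  zero_mem' := ⟨0, fun _ => rfl⟩
  smul_mem' := by
    rintro c _ ⟨f, hf⟩
    exact ⟨c • f, fun ω => by simp [hf]⟩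

theorem one_mem_affineFunctionsOf (Z : Ω → E) : (fun _ => 1) ∈ affineFunctionsOf Z :=
  ⟨AffineMap.const ℝ E 1, fun _ => rfl⟩

theorem vecMem_affineFunctionsOf (Z : Ω → E) : VecMem (affineFunctionsOf Z) Z :=
  fun φ => ⟨φ.toAffineMap, fun _ => rfl⟩

theorem vecMem_affineFunctionsOf_affine (Z : Ω → E) (f : E →ᵃ[ℝ] F) :
    VecMem (affineFunctionsOf Z) fun ω => f (Z ω) :=
  (vecMem_affineFunctionsOf Z).affine (one_mem_affineFunctionsOf Z) f

theorem affineFunctionsOf_le {Z : Ω → E} (hW : (fun _ => 1) ∈ W) (hZ : VecMem W Z) :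
    affineFunctionsOf Z ≤ W := by
  rintro h ⟨f, hf⟩
  rw [← funext hf]
  exact hZ.affine hW f LinearMap.id

theorem VecMem.exists_affineMap {Z : Ω → E} {X : Ω → ι → ℝ} (h : VecMem (affineFunctionsOf Z) X) :
    ∃ f : E →ᵃ[ℝ] (ι → ℝ), ∀ ω, f (Z ω) = X ω := by
  choose f hf using h.apply
  exact ⟨AffineMap.pi f, fun ω => funext fun a => hf a ω⟩

end VecMem

section ComponentSpan

variable {Ω ι : Type*} {W : Submodule ℝ (Ω → ℝ)}

/-- The linear functions of the random vector `X`. -/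
def componentSpan (X : Ω → ι → ℝ) : Submodule ℝ (Ω → ℝ) :=
  Submodule.span ℝ (Set.range fun a ω => X ω a)

theorem vecMem_componentSpan [Finite ι] (X : Ω → ι → ℝ) : VecMem (componentSpan X) X :=
  VecMem.of_apply fun a => Submodule.subset_span ⟨a, rfl⟩

theorem componentSpan_le {X : Ω → ι → ℝ} (hX : VecMem W X) : componentSpan X ≤ W :=
  Submodule.span_le.2 (Set.range_subset_iff.2 hX.apply)

end ComponentSpan

/-! ### Second moments -/

section Moments

variable {Ω ι κ l : Type*} [MeasurableSpace Ω] {μ : Measure Ω} {W W' U U' : Submodule ℝ (Ω → ℝ)}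

/-- The square integrable random variables, as honest functions: data and strategies are evaluated
pointwise, so almost everywhere classes are not enough. -/
def squareIntegrable (μ : Measure Ω) : Submodule ℝ (Ω → ℝ) where
  carrier := {f | MemLp f 2 μ}
  add_mem' := fun hf hg => hf.add hg
  zero_mem' := MemLp.zero
  smul_mem' := fun c _ hf => hf.const_smul c

theorem integrable_mul_of_mem {f h : Ω → ℝ} (hf : f ∈ squareIntegrable μ)
    (hh : h ∈ squareIntegrable μ) : Integrable (fun ω => f ω * h ω) μ :=
  MemLp.integrable_mul (p := 2) (q := 2) hf hh

theorem integrable_of_mem [IsFiniteMeasure μ] {f : Ω → ℝ} (hf : f ∈ squareIntegrable μ) :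
    Integrable f μ :=
  MemLp.integrable one_le_two hf

theorem one_mem_squareIntegrable [IsFiniteMeasure μ] : (fun _ => 1) ∈ squareIntegrable μ :=
  memLp_const (1 : ℝ)

/-- The centred square integrable random variables. -/
def centred (μ : Measure Ω) [IsFiniteMeasure μ] : Submodule ℝ (Ω → ℝ) where
  carrier := {f | f ∈ squareIntegrable μ ∧ ∫ ω, f ω ∂μ = 0}
  add_mem' := by
    rintro f h ⟨hf, hf0⟩ ⟨hh, hh0⟩
    refine ⟨add_mem hf hh, ?_⟩
    simp only [Pi.add_apply]
    rw [integral_add (integrable_of_mem hf) (integrable_of_mem hh), hf0, hh0, add_zero]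
  zero_mem' := ⟨zero_mem _, by simp⟩
  smul_mem' := by
    rintro c f ⟨hf, hf0⟩
    refine ⟨Submodule.smul_mem _ c hf, ?_⟩
    simp only [Pi.smul_apply, smul_eq_mul]
    rw [integral_const_mul, hf0, mul_zero]

theorem centred_le_squareIntegrable [IsFiniteMeasure μ] : centred μ ≤ squareIntegrable μ :=
  fun _ hf => hf.1

theorem mem_centred_congr [IsFiniteMeasure μ] {f h : Ω → ℝ} (hf : f ∈ squareIntegrable μ)
    (hh : h ∈ centred μ) (hfh : f =ᵐ[μ] h) : f ∈ centred μ :=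
  ⟨hf, (integral_congr_ae hfh).trans hh.2⟩

theorem VecMem.centred_congr [IsFiniteMeasure μ] {ι : Type*} [Finite ι] {X Y : Ω → ι → ℝ}
    (hX : VecMem (squareIntegrable μ) X) (hY : VecMem (centred μ) Y) (h : X =ᵐ[μ] Y) :
    VecMem (centred μ) X :=
  .of_apply fun a => mem_centred_congr (hX.apply a) (hY.apply a) (h.fun_comp fun x => x a)

/-- Orthogonality of two spaces of random variables in `L²`, to be used for spaces of square
integrable random variables only: the Bochner integral of a non-integrable product is `0`. -/
def Orthogonal (μ : Measure Ω) (W W' : Submodule ℝ (Ω → ℝ)) : Prop :=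
  ∀ f ∈ W, ∀ h ∈ W', ∫ ω, f ω * h ω ∂μ = 0

theorem Orthogonal.symm (h : Orthogonal μ W W') : Orthogonal μ W' W := fun f hf k hk => by
  simp_rw [mul_comm (f _)]
  exact h k hk f hf

theorem Orthogonal.mono (h : Orthogonal μ W W') (hU : U ≤ W) (hU' : U' ≤ W') :
    Orthogonal μ U U' :=
  fun f hf k hk => h f (hU hf) k (hU' hk)

theorem orthogonal_span_left {s : Set (Ω → ℝ)} (hs : s ⊆ squareIntegrable μ)
    (hU : U ≤ squareIntegrable μ) (h : ∀ f ∈ s, ∀ k ∈ U, ∫ ω, f ω * k ω ∂μ = 0) :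
    Orthogonal μ (Submodule.span ℝ s) U := by
  intro f hf k hk
  have hle : Submodule.span ℝ s ≤ squareIntegrable μ := Submodule.span_le.2 hs
  induction hf using Submodule.span_induction with
  | mem f hf => exact h f hf k hk
  | zero => simp
  | add f f' hf hf' ih ih' =>
    simp only [Pi.add_apply, add_mul]
    rw [integral_add (integrable_mul_of_mem (hle hf) (hU hk))
      (integrable_mul_of_mem (hle hf') (hU hk)), ih, ih', add_zero]
  | smul c f _ ih =>
    simp only [Pi.smul_apply, smul_eq_mul, mul_assoc]
    rw [integral_const_mul, ih, mul_zero]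

theorem orthogonal_span_span {s s' : Set (Ω → ℝ)} (hs : s ⊆ squareIntegrable μ)
    (hs' : s' ⊆ squareIntegrable μ) (h : ∀ f ∈ s, ∀ k ∈ s', ∫ ω, f ω * k ω ∂μ = 0) :
    Orthogonal μ (Submodule.span ℝ s) (Submodule.span ℝ s') := by
  refine orthogonal_span_left hs (Submodule.span_le.2 hs') fun f hf k hk => ?_
  have hf' : Submodule.span ℝ {f} ≤ squareIntegrable μ := by simpa using hs hf
  refine (orthogonal_span_left hs' hf' fun k hk f' hf' => ?_).symm f
    (Submodule.mem_span_singleton_self f) k hk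
  obtain ⟨c, rfl⟩ := Submodule.mem_span_singleton.1 hf'
  simp only [Pi.smul_apply, smul_eq_mul, mul_left_comm _ c, mul_comm (k _)]
  rw [integral_const_mul, h f hf k hk, mul_zero]

theorem orthogonal_sup_left (hW : W ≤ squareIntegrable μ) (hW' : W' ≤ squareIntegrable μ)
    (hU : U ≤ squareIntegrable μ) (h : Orthogonal μ W U) (h' : Orthogonal μ W' U) :
    Orthogonal μ (W ⊔ W') U := by
  rw [← Submodule.span_eq W, ← Submodule.span_eq W', ← Submodule.span_union]
  exact orthogonal_span_left (Set.union_subset hW hW') hU fun f hf => hf.elim (h f) (h' f)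

/-- The matrix of second moments `E[X Yᵀ]`. -/
def moment (μ : Measure Ω) (X : Ω → ι → ℝ) (Y : Ω → κ → ℝ) : Matrix ι κ ℝ :=
  Matrix.of fun a b => ∫ ω, X ω a * Y ω b ∂μ

theorem moment_transpose (X : Ω → ι → ℝ) (Y : Ω → κ → ℝ) : (moment μ X Y)ᵀ = moment μ Y X := by
  ext a b
  simp [moment, mul_comm]

theorem moment_add_left {X X' : Ω → ι → ℝ} {Y : Ω → κ → ℝ} (hX : VecMem (squareIntegrable μ) X)
    (hX' : VecMem (squareIntegrable μ) X') (hY : VecMem (squareIntegrable μ) Y) :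
    moment μ (fun ω => X ω + X' ω) Y = moment μ X Y + moment μ X' Y := by
  ext a b
  simp only [moment, of_apply, Pi.add_apply, add_mul, Matrix.add_apply]
  exact integral_add (integrable_mul_of_mem (hX.apply a) (hY.apply b))
    (integrable_mul_of_mem (hX'.apply a) (hY.apply b))

theorem moment_mulVec_left [Fintype ι] {X : Ω → ι → ℝ} {Y : Ω → κ → ℝ}
    (hX : VecMem (squareIntegrable μ) X) (hY : VecMem (squareIntegrable μ) Y) (A : Matrix l ι ℝ) :
    moment μ (fun ω => A *ᵥ X ω) Y = A * moment μ X Y := by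
  ext a b
  simp only [moment, of_apply, mulVec, dotProduct, Matrix.mul_apply, Finset.sum_mul, mul_assoc]
  rw [integral_finsetSum _ fun c _ =>
    (integrable_mul_of_mem (hX.apply c) (hY.apply b)).const_mul (A a c)]
  simp only [integral_const_mul]

theorem moment_sub_left {X X' : Ω → ι → ℝ} {Y : Ω → κ → ℝ} (hX : VecMem (squareIntegrable μ) X)
    (hX' : VecMem (squareIntegrable μ) X') (hY : VecMem (squareIntegrable μ) Y) :
    moment μ (fun ω => X ω - X' ω) Y = moment μ X Y - moment μ X' Y := by
  ext a b
  simp only [moment, of_apply, Pi.sub_apply, sub_mul, Matrix.sub_apply]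
  exact integral_sub (integrable_mul_of_mem (hX.apply a) (hY.apply b))
    (integrable_mul_of_mem (hX'.apply a) (hY.apply b))

theorem moment_add_right {X : Ω → ι → ℝ} {Y Y' : Ω → κ → ℝ} (hX : VecMem (squareIntegrable μ) X)
    (hY : VecMem (squareIntegrable μ) Y) (hY' : VecMem (squareIntegrable μ) Y') :
    moment μ X (fun ω => Y ω + Y' ω) = moment μ X Y + moment μ X Y' := by
  rw [← moment_transpose, moment_add_left hY hY' hX, transpose_add, moment_transpose,
    moment_transpose]

theorem moment_sub_right {X : Ω → ι → ℝ} {Y Y' : Ω → κ → ℝ} (hX : VecMem (squareIntegrable μ) X)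
    (hY : VecMem (squareIntegrable μ) Y) (hY' : VecMem (squareIntegrable μ) Y') :
    moment μ X (fun ω => Y ω - Y' ω) = moment μ X Y - moment μ X Y' := by
  rw [← moment_transpose, moment_sub_left hY hY' hX, transpose_sub, moment_transpose,
    moment_transpose]

theorem moment_mulVec_right [Fintype κ] {X : Ω → ι → ℝ} {Y : Ω → κ → ℝ}
    (hX : VecMem (squareIntegrable μ) X) (hY : VecMem (squareIntegrable μ) Y) (A : Matrix l κ ℝ) :
    moment μ X (fun ω => A *ᵥ Y ω) = moment μ X Y * Aᵀ := by
  rw [← moment_transpose, moment_mulVec_left hY hX, transpose_mul, moment_transpose]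

theorem moment_eq_zero_comm {X : Ω → ι → ℝ} {Y : Ω → κ → ℝ} :
    moment μ X Y = 0 ↔ moment μ Y X = 0 := by
  rw [← moment_transpose, transpose_eq_zero]

theorem Orthogonal.moment_eq_zero (h : Orthogonal μ W W') {X : Ω → ι → ℝ} {Y : Ω → κ → ℝ}
    (hX : VecMem W X) (hY : VecMem W' Y) : moment μ X Y = 0 := by
  ext a b
  exact h _ (hX.apply a) _ (hY.apply b)

theorem covMatrix_eq_moment [IsFiniteMeasure μ] {X : Ω → ι → ℝ} (hX : VecMem (centred μ) X) :
    covMatrix μ X = moment μ X X := by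
  ext a b
  simp only [covMatrix, moment, of_apply, covariance, (hX.apply a).2, (hX.apply b).2, sub_zero]

theorem covMatrix_congr {X Y : Ω → ι → ℝ} (h : X =ᵐ[μ] Y) : covMatrix μ X = covMatrix μ Y := by
  ext a b
  have h' (a : ι) : (fun ω => X ω a) =ᵐ[μ] fun ω => Y ω a := h.fun_comp fun z => z a
  simp only [covMatrix, of_apply, covariance, integral_congr_ae (h' a), integral_congr_ae (h' b)]
  refine integral_congr_ae ?_
  filter_upwards [h] with ω hω
  rw [hω]

theorem moment_congr {X Y : Ω → ι → ℝ} (h : X =ᵐ[μ] Y) : moment μ X X = moment μ Y Y := by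
  ext a b
  refine integral_congr_ae ?_
  filter_upwards [h] with ω hω
  rw [hω]

/-! ### Expected quadratic forms -/

section QuadForm

variable [Fintype ι] [Fintype κ]

/-- `E[Xᵀ Q X]` -/
def quadForm (μ : Measure Ω) (Q : Matrix ι ι ℝ) (X : Ω → ι → ℝ) : ℝ :=
  ∫ ω, X ω ⬝ᵥ Q *ᵥ X ω ∂μ

theorem integrable_quadForm {X : Ω → ι → ℝ} (hX : VecMem (squareIntegrable μ) X)
    (Q : Matrix ι ι ℝ) : Integrable (fun ω => X ω ⬝ᵥ Q *ᵥ X ω) μ :=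
  integrable_finsetSum _ fun a _ => integrable_mul_of_mem (hX.apply a) ((hX.mulVec Q).apply a)

theorem quadForm_eq_trace {X : Ω → ι → ℝ} (hX : VecMem (squareIntegrable μ) X)
    (Q : Matrix ι ι ℝ) : quadForm μ Q X = (Q * moment μ X X).trace := by
  rw [← moment_mulVec_left hX hX]
  simp only [quadForm, dotProduct, trace, diag_apply, moment, of_apply]
  rw [integral_finsetSum _ fun a _ =>
    integrable_mul_of_mem (hX.apply a) ((hX.mulVec Q).apply a)]
  simp only [mul_comm]

theorem quadForm_add {X Y : Ω → ι → ℝ} (hX : VecMem (squareIntegrable μ) X)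
    (hY : VecMem (squareIntegrable μ) Y) (h : moment μ X Y = 0) (Q : Matrix ι ι ℝ) :
    quadForm μ Q (fun ω => X ω + Y ω) = quadForm μ Q X + quadForm μ Q Y := by
  rw [quadForm_eq_trace (hX.add hY), quadForm_eq_trace hX, quadForm_eq_trace hY,
    moment_add_left hX hY (hX.add hY), moment_add_right hX hX hY, moment_add_right hY hX hY, h,
    moment_eq_zero_comm.1 h, add_zero, zero_add, Matrix.mul_add, trace_add]

theorem dotProduct_mulVec_nonneg {Q : Matrix ι ι ℝ} (hQ : Q.PosSemidef) (x : ι → ℝ) :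
    0 ≤ x ⬝ᵥ Q *ᵥ x := by
  simpa only [star_trivial] using hQ.dotProduct_mulVec_nonneg x

theorem quadForm_nonneg {Q : Matrix ι ι ℝ} (hQ : Q.PosSemidef) (X : Ω → ι → ℝ) :
    0 ≤ quadForm μ Q X :=
  integral_nonneg fun ω => dotProduct_mulVec_nonneg hQ (X ω)

theorem quadForm_eq_zero_iff {Q : Matrix ι ι ℝ} (hQ : Q.PosDef) {X : Ω → ι → ℝ}
    (hX : VecMem (squareIntegrable μ) X) : quadForm μ Q X = 0 ↔ ∀ᵐ ω ∂μ, X ω = 0 := by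
  rw [quadForm, integral_eq_zero_iff_of_nonneg
    (fun ω => dotProduct_mulVec_nonneg hQ.posSemidef (X ω)) (integrable_quadForm hX Q)]
  refine Filter.eventually_congr (.of_forall fun ω => ⟨fun h => ?_, fun h => by simp [h]⟩)
  by_contra hne
  have hpos := hQ.dotProduct_mulVec_pos hne
  rw [star_trivial] at hpos
  exact hpos.ne' h

theorem quadForm_one [DecidableEq ι] (X : Ω → ι → ℝ) :
    quadForm μ 1 X = ∫ ω, ∑ a, X ω a ^ 2 ∂μ := by
  simp only [quadForm, one_mulVec, dotProduct, pow_two]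

end QuadForm

theorem add_ae_eq_zero_iff [Finite ι] {X Y : Ω → ι → ℝ}
    (hX : VecMem (squareIntegrable μ) X) (hY : VecMem (squareIntegrable μ) Y)
    (h : moment μ X Y = 0) :
    (∀ᵐ ω ∂μ, X ω + Y ω = 0) ↔ (∀ᵐ ω ∂μ, X ω = 0) ∧ ∀ᵐ ω ∂μ, Y ω = 0 := by
  classical
  cases nonempty_fintype ι
  rw [← quadForm_eq_zero_iff PosDef.one (hX.add hY), quadForm_add hX hY h,
    add_eq_zero_iff_of_nonneg (quadForm_nonneg PosSemidef.one X)
      (quadForm_nonneg PosSemidef.one Y),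
    quadForm_eq_zero_iff PosDef.one hX, quadForm_eq_zero_iff PosDef.one hY]

/-! ### Least squares -/

/-- `p` is the `L²` projection of the random vector `X` to the space `W`, characterized by the
normal equations. -/
structure IsProjection (μ : Measure Ω) (W : Submodule ℝ (Ω → ℝ)) (X p : Ω → ι → ℝ) : Prop where
  mem : VecMem W p
  normal_eq : ∀ a, ∀ h ∈ W, ∫ ω, (X ω a - p ω a) * h ω ∂μ = 0

theorem exists_projection (hW : W ≤ squareIntegrable μ) [FiniteDimensional ℝ W] {f : Ω → ℝ}
    (hf : f ∈ squareIntegrable μ) : ∃ p ∈ W, ∀ h ∈ W, ∫ ω, (f ω - p ω) * h ω ∂μ = 0 := by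
  let toLp : squareIntegrable μ →ₗ[ℝ] Lp ℝ 2 μ :=
    { toFun := fun f => MemLp.toLp f.1 f.2
      map_add' := fun _ _ => rfl
      map_smul' := fun _ _ => rfl }
  let K : Submodule ℝ (Lp ℝ 2 μ) := LinearMap.range (toLp ∘ₗ Submodule.inclusion hW)
  have : FiniteDimensional ℝ K := inferInstance
  obtain ⟨p, hp⟩ := K.starProjection_apply_mem (toLp ⟨f, hf⟩)
  refine ⟨p.1, p.2, fun h hh => ?_⟩
  have hinner := Submodule.starProjection_inner_eq_zero (K := K) (toLp ⟨f, hf⟩)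
    (toLp ⟨h, hW hh⟩) ⟨⟨h, hh⟩, rfl⟩
  rw [← hp, LinearMap.comp_apply, ← map_sub, L2.inner_def] at hinner
  rw [← hinner]
  have hfp : (fun ω => f ω - p.1 ω) ∈ squareIntegrable μ := sub_mem hf (hW p.2)
  refine integral_congr_ae ?_
  filter_upwards [MemLp.coeFn_toLp (hW hh), MemLp.coeFn_toLp hfp] with ω hhω hfpω
  change (toLp ⟨h, hW hh⟩ : Ω → ℝ) ω = h ω at hhω
  change (toLp (⟨f, hf⟩ - Submodule.inclusion hW p) : Ω → ℝ) ω = f ω - p.1 ω at hfpω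
  rw [hhω, hfpω, RCLike.inner_apply, conj_trivial, mul_comm]

theorem exists_isProjection [Finite ι] (hW : W ≤ squareIntegrable μ) [FiniteDimensional ℝ W]
    {X : Ω → ι → ℝ} (hX : VecMem (squareIntegrable μ) X) : ∃ p, IsProjection μ W X p := by
  choose p hp hXp using fun a => exists_projection hW (hX.apply a)
  exact ⟨fun ω a => p a ω, VecMem.of_apply hp, hXp⟩

namespace IsProjection

variable {X p q : Ω → ι → ℝ}

theorem moment_error_eq_zero (hp : IsProjection μ W X p) {Y : Ω → κ → ℝ} (hY : VecMem W Y) :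
    moment μ (fun ω => X ω - p ω) Y = 0 := by
  ext a b
  exact hp.normal_eq a _ (hY.apply b)

theorem error_mem (hp : IsProjection μ W X p) (hW : W ≤ squareIntegrable μ)
    (hX : VecMem (squareIntegrable μ) X) : VecMem (squareIntegrable μ) fun ω => X ω - p ω :=
  hX.sub (hp.mem.mono hW)

theorem of_orthogonal (hp : VecMem W p) (herror : VecMem U fun ω => X ω - p ω)
    (h : Orthogonal μ U W) : IsProjection μ W X p :=
  ⟨hp, fun a => h _ (herror.apply a)⟩

theorem sup_add (hp : IsProjection μ W X p) (hq : IsProjection μ W' (fun ω => X ω - p ω) q)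
    (hX : VecMem (squareIntegrable μ) X) (hW : W ≤ squareIntegrable μ)
    (hW' : W' ≤ squareIntegrable μ) (h : Orthogonal μ W' W) :
    IsProjection μ (W ⊔ W') X fun ω => p ω + q ω := by
  refine ⟨(hp.mem.mono le_sup_left).add (hq.mem.mono le_sup_right), fun a f hf => ?_⟩
  obtain ⟨k, hk, k', hk', rfl⟩ := Submodule.mem_sup.1 hf
  have hqa : (fun ω => q ω a) ∈ squareIntegrable μ := (hq.mem.mono hW').apply a
  have hXp : (fun ω => X ω a - p ω a) ∈ squareIntegrable μ := (hp.error_mem hW hX).apply a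
  have hXpq : (fun ω => X ω a - p ω a - q ω a) ∈ squareIntegrable μ := sub_mem hXp hqa
  have hWpart : ∫ ω, (X ω a - p ω a - q ω a) * k ω ∂μ = 0 := by
    simp only [sub_mul _ (q _ a)]
    rw [integral_sub (integrable_mul_of_mem hXp (hW hk)) (integrable_mul_of_mem hqa (hW hk)),
      hp.normal_eq a k hk, h _ (hq.mem.apply a) k hk, sub_zero]
  have hWpart' : ∫ ω, (X ω a - p ω a - q ω a) * k' ω ∂μ = 0 := hq.normal_eq a k' hk'
  simp only [Pi.add_apply, ← sub_sub, mul_add]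
  rw [integral_add (integrable_mul_of_mem hXpq (hW hk)) (integrable_mul_of_mem hXpq (hW' hk')),
    hWpart, hWpart', add_zero]

theorem orthogonal_componentSpan_error (hp : IsProjection μ W X p) (hW : W ≤ squareIntegrable μ)
    (hX : VecMem (squareIntegrable μ) X) :
    Orthogonal μ (componentSpan fun ω => X ω - p ω) W :=
  orthogonal_span_left (Set.range_subset_iff.2 (hp.error_mem hW hX).apply) hW <| by
    rintro _ ⟨a, rfl⟩
    exact hp.normal_eq a

theorem mulVec_add [Fintype ι] (hp : IsProjection μ W X p) (A : Matrix l ι ℝ) {Y : Ω → l → ℝ}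
    (hX : VecMem (squareIntegrable μ) X) (hW : W ≤ squareIntegrable μ)
    (hY : VecMem (squareIntegrable μ) Y) (hYU : VecMem U Y) (hU : Orthogonal μ U W) :
    IsProjection μ W (fun ω => A *ᵥ X ω + Y ω) fun ω => A *ᵥ p ω := by
  refine ⟨hp.mem.mulVec A, fun a h hh => ?_⟩
  have hhW : VecMem W fun ω (_ : Unit) => h ω := .of_apply fun _ => hh
  have hXp := hp.error_mem hW hX
  have hmoment : moment μ (fun ω => A *ᵥ (X ω - p ω) + Y ω) (fun ω (_ : Unit) => h ω) = 0 := by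
    rw [moment_add_left (hXp.mulVec A) hY (hhW.mono hW), moment_mulVec_left hXp (hhW.mono hW),
      hp.moment_error_eq_zero hhW, hU.moment_eq_zero hYU hhW, Matrix.mul_zero, add_zero]
  rw [← show _ = (0 : ℝ) from congrFun (congrFun hmoment a) ()]
  simp only [moment, of_apply, mulVec_sub, sub_add_eq_add_sub, Pi.sub_apply, Pi.add_apply]

theorem mulVec_of_moment_eq_zero [Finite ι] [Fintype κ] {K : Matrix ι κ ℝ} {Y : Ω → κ → ℝ}
    (hX : VecMem (squareIntegrable μ) X) (hY : VecMem (squareIntegrable μ) Y)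
    (h : moment μ (fun ω => X ω - K *ᵥ Y ω) Y = 0) :
    IsProjection μ (componentSpan Y) X fun ω => K *ᵥ Y ω := by
  have hXY := hX.sub (hY.mulVec K)
  refine of_orthogonal ((vecMem_componentSpan Y).mulVec K) (vecMem_componentSpan _)
    (orthogonal_span_span (Set.range_subset_iff.2 hXY.apply) (Set.range_subset_iff.2 hY.apply) ?_)
  rintro _ ⟨a, rfl⟩ _ ⟨b, rfl⟩
  exact congrFun (congrFun h a) b

section QuadForm

variable [Fintype ι] [DecidableEq ι]

theorem quadForm_sub_eq (hp : IsProjection μ W X p) (hW : W ≤ squareIntegrable μ)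
    (hX : VecMem (squareIntegrable μ) X) (hq : VecMem W q) :
    quadForm μ 1 (fun ω => X ω - q ω) =
      quadForm μ 1 (fun ω => X ω - p ω) + quadForm μ 1 (fun ω => p ω - q ω) := by
  rw [← quadForm_add (hp.error_mem hW hX) ((hp.mem.sub hq).mono hW)
    (hp.moment_error_eq_zero (hp.mem.sub hq))]
  simp only [sub_add_sub_cancel]

theorem ae_eq_of_quadForm_le (hp : IsProjection μ W X p) (hW : W ≤ squareIntegrable μ)
    (hX : VecMem (squareIntegrable μ) X) (hq : VecMem W q)
    (hle : quadForm μ 1 (fun ω => X ω - q ω) ≤ quadForm μ 1 fun ω => X ω - p ω) :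
    ∀ᵐ ω ∂μ, q ω = p ω := by
  rw [hp.quadForm_sub_eq hW hX hq] at hle
  have h0 : quadForm μ 1 (fun ω => p ω - q ω) = 0 :=
    le_antisymm (by linarith) (quadForm_nonneg PosSemidef.one _)
  filter_upwards [(quadForm_eq_zero_iff PosDef.one ((hp.mem.sub hq).mono hW)).1 h0] with ω hω
  exact (sub_eq_zero.1 hω).symm

end QuadForm

theorem ae_eq [Finite ι] (hp : IsProjection μ W X p) (hq : IsProjection μ W X q)
    (hW : W ≤ squareIntegrable μ) (hX : VecMem (squareIntegrable μ) X) :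
    ∀ᵐ ω ∂μ, p ω = q ω := by
  classical
  cases nonempty_fintype ι
  refine hq.ae_eq_of_quadForm_le hW hX hp.mem ?_
  rw [hp.quadForm_sub_eq hW hX hq.mem]
  exact le_add_of_nonneg_right (quadForm_nonneg PosSemidef.one _)

end IsProjection

section LLMS

variable {E : Type*} [AddCommGroup E] [Module ℝ E] [Fintype ι] {Z : Ω → E} {X p : Ω → ι → ℝ}

theorem isLLMSEstimator_iff_quadForm [DecidableEq ι] {f : E →ᵃ[ℝ] (ι → ℝ)} :
    IsLLMSEstimator μ Z X f ↔ ∀ h : E →ᵃ[ℝ] (ι → ℝ),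
      quadForm μ 1 (fun ω => X ω - f (Z ω)) ≤ quadForm μ 1 fun ω => X ω - h (Z ω) := by
  simp only [IsLLMSEstimator, quadForm_one, Pi.sub_apply]

variable [IsFiniteMeasure μ]

theorem affineFunctionsOf_le_squareIntegrable (hZ : VecMem (squareIntegrable μ) Z) :
    affineFunctionsOf Z ≤ squareIntegrable μ :=
  affineFunctionsOf_le one_mem_squareIntegrable hZ

namespace IsProjection

theorem isLLMSEstimator {f : E →ᵃ[ℝ] (ι → ℝ)} (hZ : VecMem (squareIntegrable μ) Z)
    (hX : VecMem (squareIntegrable μ) X)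
    (hf : IsProjection μ (affineFunctionsOf Z) X fun ω => f (Z ω)) : IsLLMSEstimator μ Z X f := by
  classical
  refine isLLMSEstimator_iff_quadForm.2 fun h => ?_
  rw [hf.quadForm_sub_eq (affineFunctionsOf_le_squareIntegrable hZ) hX
    (vecMem_affineFunctionsOf_affine Z h)]
  exact le_add_of_nonneg_right (quadForm_nonneg PosSemidef.one _)

theorem exists_isLLMSEstimator (hp : IsProjection μ (affineFunctionsOf Z) X p)
    (hZ : VecMem (squareIntegrable μ) Z) (hX : VecMem (squareIntegrable μ) X) :
    ∃ f, IsLLMSEstimator μ Z X f := by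
  obtain ⟨f, hf⟩ := hp.mem.exists_affineMap
  obtain rfl : (fun ω => f (Z ω)) = p := funext hf
  exact ⟨f, isLLMSEstimator hZ hX hp⟩

theorem ae_eq_of_isLLMSEstimator {f : E →ᵃ[ℝ] (ι → ℝ)}
    (hp : IsProjection μ (affineFunctionsOf Z) X p) (hZ : VecMem (squareIntegrable μ) Z)
    (hX : VecMem (squareIntegrable μ) X) (hf : IsLLMSEstimator μ Z X f) :
    ∀ᵐ ω ∂μ, f (Z ω) = p ω := by
  classical
  obtain ⟨f', hf'⟩ := hp.mem.exists_affineMap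
  refine hp.ae_eq_of_quadForm_le (affineFunctionsOf_le_squareIntegrable hZ) hX
    (vecMem_affineFunctionsOf_affine Z f) ?_
  simpa only [hf'] using isLLMSEstimator_iff_quadForm.1 hf f'

theorem llms_ae_eq (hp : IsProjection μ (affineFunctionsOf Z) X p)
    (hZ : VecMem (squareIntegrable μ) Z) (hX : VecMem (squareIntegrable μ) X) :
    ∀ᵐ ω ∂μ, llms μ Z X ω = p ω :=
  hp.ae_eq_of_isLLMSEstimator hZ hX (Classical.epsilon_spec (hp.exists_isLLMSEstimator hZ hX))

theorem exists_linear_isLLMSEstimator [NeZero μ]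
    (hp : IsProjection μ (affineFunctionsOf Z) X p) (hZ : VecMem (centred μ) Z)
    (hX : VecMem (centred μ) X) :
    ∃ f : E →ₗ[ℝ] (ι → ℝ), IsLLMSEstimator μ Z X f.toAffineMap := by
  have hZ2 := hZ.mono centred_le_squareIntegrable
  obtain ⟨f, hf⟩ := hp.mem.exists_affineMap
  have hfZ (ω : Ω) : p ω = f.linear (Z ω) + f 0 := (hf ω).symm.trans (congrFun f.decomp _)
  -- The normal equation against the constant `1` says that the error has mean zero.
  have hf0 : f 0 = 0 := by
    funext a
    have hcentred : (fun ω => X ω a - f.linear (Z ω) a) ∈ centred μ :=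
      (hX.sub (hZ.map f.linear)).apply a
    have herror := hp.normal_eq a _ (one_mem_affineFunctionsOf Z)
    simp only [hfZ, mul_one, Pi.add_apply, ← sub_sub] at herror
    rw [integral_sub (integrable_of_mem hcentred.1) (integrable_const _)] at herror
    have hmean : ∫ ω, (X ω a - f.linear (Z ω) a) ∂μ = 0 := hcentred.2
    simpa [hmean, measureReal_univ_ne_zero] using herror
  obtain rfl : (fun ω => f.linear (Z ω)) = p := by
    funext ω
    rw [hfZ, hf0, add_zero]
  exact ⟨f.linear, isLLMSEstimator hZ2 (hX.mono centred_le_squareIntegrable) hp⟩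

end IsProjection

end LLMS

end Moments

/-! ### Completing squares -/

section CompleteSquare

variable {l m : Type*} [Fintype l] {P Q : Matrix l l ℝ} {R : Matrix m m ℝ}

theorem dotProduct_mulVec_comm_of_isSymm (hP : P.IsSymm) (x y : l → ℝ) :
    x ⬝ᵥ P *ᵥ y = y ⬝ᵥ P *ᵥ x := by
  rw [← dotProduct_transpose_mulVec, hP.eq]

theorem posDef_add_conj [Finite m] (hP : P.PosSemidef) (hR : R.PosDef) (B : Matrix l m ℝ) :
    (R + Bᵀ * P * B).PosDef :=
  hR.add_posSemidef (hP.conjTranspose_mul_mul_same B)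

theorem dotProduct_transpose_mul_mul_mulVec {k j : Type*} [Fintype k] [Fintype j]
    (G : Matrix l k ℝ) (P : Matrix l l ℝ) (H : Matrix l j ℝ) (a : k → ℝ) (b : j → ℝ) :
    a ⬝ᵥ (Gᵀ * P * H) *ᵥ b = (G *ᵥ a) ⬝ᵥ P *ᵥ (H *ᵥ b) := by
  rw [Matrix.mul_assoc, ← mulVec_mulVec, ← mulVec_mulVec, dotProduct_transpose_mulVec,
    dotProduct_comm]

variable [Fintype m]

theorem complete_square (hP : P.IsSymm) (hR : R.IsSymm) (A Q : Matrix l l ℝ) (B : Matrix l m ℝ)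
    {L : Matrix m l ℝ} (hL : (R + Bᵀ * P * B) * L = Bᵀ * P * A) (x : l → ℝ) (u : m → ℝ) :
    x ⬝ᵥ Q *ᵥ x + u ⬝ᵥ R *ᵥ u + (A *ᵥ x + B *ᵥ u) ⬝ᵥ P *ᵥ (A *ᵥ x + B *ᵥ u) =
      x ⬝ᵥ (Q + Aᵀ * P * A - Lᵀ * (R + Bᵀ * P * B) * L) *ᵥ x +
        (u + L *ᵥ x) ⬝ᵥ (R + Bᵀ * P * B) *ᵥ (u + L *ᵥ x) := by
  have hD : (R + Bᵀ * P * B).IsSymm := hR.add <| by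
    simp only [IsSymm, transpose_mul, transpose_transpose, hP.eq, Matrix.mul_assoc]
  have hu : u ⬝ᵥ (R + Bᵀ * P * B) *ᵥ u = u ⬝ᵥ R *ᵥ u + (B *ᵥ u) ⬝ᵥ P *ᵥ (B *ᵥ u) := by
    rw [add_mulVec, dotProduct_add, dotProduct_transpose_mul_mul_mulVec]
  have hux : u ⬝ᵥ (R + Bᵀ * P * B) *ᵥ (L *ᵥ x) = (B *ᵥ u) ⬝ᵥ P *ᵥ (A *ᵥ x) := by
    rw [mulVec_mulVec, hL, dotProduct_transpose_mul_mul_mulVec]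
  simp only [sub_mulVec, add_mulVec _ (Aᵀ * P * A), dotProduct_sub, dotProduct_add,
    dotProduct_transpose_mul_mul_mulVec, mulVec_add, add_dotProduct, hu, hux,
    dotProduct_mulVec_comm_of_isSymm hD (L *ᵥ x) u,
    dotProduct_mulVec_comm_of_isSymm hP (A *ᵥ x) (B *ᵥ u)]
  ring

variable [DecidableEq m]

theorem mul_riccatiGain (hP : P.PosSemidef) (hR : R.PosDef) (A : Matrix l l ℝ)
    (B : Matrix l m ℝ) : (R + Bᵀ * P * B) * riccatiGain P A B R = Bᵀ * P * A := by
  have hdet := (isUnit_iff_isUnit_det _).1 (posDef_add_conj hP hR B).isUnit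
  simp only [riccatiGain, ← Matrix.mul_assoc, mul_nonsing_inv _ hdet, Matrix.one_mul]

theorem riccati_eq_sub_conj (hP : P.PosSemidef) (hR : R.PosDef) (A Q : Matrix l l ℝ)
    (B : Matrix l m ℝ) :
    riccati P A B Q R = Q + Aᵀ * P * A -
      (riccatiGain P A B R)ᵀ * (R + Bᵀ * P * B) * riccatiGain P A B R := by
  have hP' : Pᵀ = P := isHermitian_iff_isSymm.1 hP.isHermitian
  have hD : (R + Bᵀ * P * B)ᵀ = R + Bᵀ * P * B :=
    isHermitian_iff_isSymm.1 (posDef_add_conj hP hR B).isHermitian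
  rw [Matrix.mul_assoc _ (R + _), mul_riccatiGain hP hR, riccati, riccatiGain, transpose_mul,
    transpose_mul, transpose_mul, transpose_nonsing_inv, hD, hP', transpose_transpose]
  simp only [Matrix.mul_assoc]

theorem riccati_complete_square (hP : P.PosSemidef) (hR : R.PosDef) (A Q : Matrix l l ℝ)
    (B : Matrix l m ℝ) (x : l → ℝ) (u : m → ℝ) :
    x ⬝ᵥ Q *ᵥ x + u ⬝ᵥ R *ᵥ u + (A *ᵥ x + B *ᵥ u) ⬝ᵥ P *ᵥ (A *ᵥ x + B *ᵥ u) =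
      x ⬝ᵥ riccati P A B Q R *ᵥ x + (u + riccatiGain P A B R *ᵥ x) ⬝ᵥ
        (R + Bᵀ * P * B) *ᵥ (u + riccatiGain P A B R *ᵥ x) := by
  rw [riccati_eq_sub_conj hP hR]
  exact complete_square (isHermitian_iff_isSymm.1 hP.isHermitian)
    (isHermitian_iff_isSymm.1 hR.isHermitian) A Q B (mul_riccatiGain hP hR A B) x u

theorem riccati_posSemidef (hP : P.PosSemidef) (hQ : Q.PosSemidef) (hR : R.PosDef)
    (A : Matrix l l ℝ) (B : Matrix l m ℝ) : (riccati P A B Q R).PosSemidef := by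
  refine PosSemidef.of_dotProduct_mulVec_nonneg ?_ fun x => ?_
  · rw [riccati_eq_sub_conj hP hR]
    exact (hQ.isHermitian.add (isHermitian_conjTranspose_mul_mul A hP.isHermitian)).sub
      (isHermitian_conjTranspose_mul_mul _ (posDef_add_conj hP hR B).isHermitian)
  · -- The value of the Riccati form is the cost of the feedback `u = -L x`.
    have hcost := riccati_complete_square hP hR A Q B x (-(riccatiGain P A B R *ᵥ x))
    rw [neg_add_cancel, zero_dotProduct, add_zero] at hcost
    rw [star_trivial, ← hcost]
    exact add_nonneg (add_nonneg (dotProduct_mulVec_nonneg hQ _)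
      (dotProduct_mulVec_nonneg hR.posSemidef _)) (dotProduct_mulVec_nonneg hP _)

variable {Ω : Type*} [MeasurableSpace Ω] {μ : Measure Ω}

theorem quadForm_dynamics (hP : P.PosSemidef) (hR : R.PosDef) (A Q : Matrix l l ℝ)
    (B : Matrix l m ℝ) {x w : Ω → l → ℝ} {u : Ω → m → ℝ}
    (hx : VecMem (squareIntegrable μ) x) (hu : VecMem (squareIntegrable μ) u)
    (hw : VecMem (squareIntegrable μ) w) (hxw : moment μ x w = 0) (huw : moment μ u w = 0) :
    quadForm μ Q x + quadForm μ R u + quadForm μ P (fun ω => A *ᵥ x ω + B *ᵥ u ω + w ω) =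
      quadForm μ (riccati P A B Q R) x + quadForm μ P w +
        quadForm μ (R + Bᵀ * P * B) fun ω => u ω + riccatiGain P A B R *ᵥ x ω := by
  have hz : VecMem (squareIntegrable μ) fun ω => A *ᵥ x ω + B *ᵥ u ω :=
    (hx.mulVec A).add (hu.mulVec B)
  have hzw : moment μ (fun ω => A *ᵥ x ω + B *ᵥ u ω) w = 0 := by
    rw [moment_add_left (hx.mulVec A) (hu.mulVec B) hw, moment_mulVec_left hx hw,
      moment_mulVec_left hu hw, hxw, huw, Matrix.mul_zero, Matrix.mul_zero, add_zero]
  have hv : VecMem (squareIntegrable μ) fun ω => u ω + riccatiGain P A B R *ᵥ x ω :=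
    hu.add (hx.mulVec _)
  have hsquare : quadForm μ Q x + quadForm μ R u + quadForm μ P (fun ω => A *ᵥ x ω + B *ᵥ u ω) =
      quadForm μ (riccati P A B Q R) x +
        quadForm μ (R + Bᵀ * P * B) fun ω => u ω + riccatiGain P A B R *ᵥ x ω := by
    have hxu : Integrable (fun ω => x ω ⬝ᵥ Q *ᵥ x ω + u ω ⬝ᵥ R *ᵥ u ω) μ :=
      (integrable_quadForm hx Q).add (integrable_quadForm hu R)
    simp only [quadForm]
    rw [← integral_add (integrable_quadForm hx Q) (integrable_quadForm hu R),
      ← integral_add hxu (integrable_quadForm hz P),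
      ← integral_add (integrable_quadForm hx _) (integrable_quadForm hv _)]
    simp only [riccati_complete_square hP hR]
  rw [quadForm_add hz hw hzw]
  linarith

/-- `S k` is the Riccati matrix with `k` steps to go. -/
theorem sum_quadForm_eq {A Q : Matrix l l ℝ} {B : Matrix l m ℝ} (hR : R.PosDef)
    {S : ℕ → Matrix l l ℝ} (hS : ∀ k, (S k).PosSemidef)
    (hSsucc : ∀ k, S (k + 1) = riccati (S k) A B Q R) {N : ℕ}
    {x w : ℕ → Ω → l → ℝ} {u : ℕ → Ω → m → ℝ}
    (hx : ∀ t < N, VecMem (squareIntegrable μ) (x t))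
    (hu : ∀ t < N, VecMem (squareIntegrable μ) (u t))
    (hw : ∀ t < N, VecMem (squareIntegrable μ) (w t))
    (hdyn : ∀ t < N, x (t + 1) = fun ω => A *ᵥ x t ω + B *ᵥ u t ω + w t ω)
    (hxw : ∀ t < N, moment μ (x t) (w t) = 0) (huw : ∀ t < N, moment μ (u t) (w t) = 0) :
    (∑ t ∈ Finset.range N, (quadForm μ Q (x t) + quadForm μ R (u t))) + quadForm μ (S 0) (x N) =
      (quadForm μ (S N) (x 0) + ∑ t ∈ Finset.range N, quadForm μ (S (N - (t + 1))) (w t)) +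
        ∑ t ∈ Finset.range N, quadForm μ (R + Bᵀ * S (N - (t + 1)) * B)
          (fun ω => u t ω + riccatiGain (S (N - (t + 1))) A B R *ᵥ x t ω) := by
  have hstep : ∀ t ∈ Finset.range N, quadForm μ Q (x t) + quadForm μ R (u t) =
      (quadForm μ (S (N - t)) (x t) - quadForm μ (S (N - (t + 1))) (x (t + 1))) +
      (quadForm μ (S (N - (t + 1))) (w t) + quadForm μ (R + Bᵀ * S (N - (t + 1)) * B)
          (fun ω => u t ω + riccatiGain (S (N - (t + 1))) A B R *ᵥ x t ω)) := fun t ht => by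
    have ht := Finset.mem_range.1 ht
    have := quadForm_dynamics (hS (N - (t + 1))) hR A Q B (hx t ht) (hu t ht) (hw t ht)
      (hxw t ht) (huw t ht)
    rw [← hdyn t ht, ← hSsucc, show N - (t + 1) + 1 = N - t by omega] at this
    linarith
  rw [Finset.sum_congr rfl hstep, Finset.sum_add_distrib, Finset.sum_add_distrib,
    Finset.sum_range_sub' (fun t => quadForm μ (S (N - t)) (x t)), Nat.sub_zero, Nat.sub_self]
  ring

end CompleteSquare

/-! ### One step of the recursive least squares filter -/

section Filter

variable {Ω l p : Type*} [MeasurableSpace Ω] {μ : Measure Ω} [Fintype l]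
  {ξ : Ω → l → ℝ} {v : Ω → p → ℝ} {C : Matrix p l ℝ} {K : Matrix l p ℝ}

theorem moment_observation (hξ : VecMem (squareIntegrable μ) ξ)
    (hv : VecMem (squareIntegrable μ) v) (hξv : moment μ ξ v = 0) :
    moment μ ξ (fun ω => C *ᵥ ξ ω + v ω) = moment μ ξ ξ * Cᵀ := by
  rw [moment_add_right hξ (hξ.mulVec C) hv, moment_mulVec_right hξ hξ, hξv, add_zero]

theorem moment_observation_observation (hξ : VecMem (squareIntegrable μ) ξ)
    (hv : VecMem (squareIntegrable μ) v) (hξv : moment μ ξ v = 0) :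
    moment μ (fun ω => C *ᵥ ξ ω + v ω) (fun ω => C *ᵥ ξ ω + v ω) =
      C * moment μ ξ ξ * Cᵀ + moment μ v v := by
  rw [moment_add_left (hξ.mulVec C) hv ((hξ.mulVec C).add hv),
    moment_mulVec_left hξ ((hξ.mulVec C).add hv), moment_observation hξ hv hξv,
    moment_add_right hv (hξ.mulVec C) hv, moment_mulVec_right hv hξ, moment_eq_zero_comm.1 hξv,
    Matrix.zero_mul, zero_add, Matrix.mul_assoc]

variable [Fintype p]

theorem moment_filterError_observation (hξ : VecMem (squareIntegrable μ) ξ)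
    (hv : VecMem (squareIntegrable μ) v) (hξv : moment μ ξ v = 0)
    (hK : K * (C * moment μ ξ ξ * Cᵀ + moment μ v v) = moment μ ξ ξ * Cᵀ) :
    moment μ (fun ω => ξ ω - K *ᵥ (C *ᵥ ξ ω + v ω)) (fun ω => C *ᵥ ξ ω + v ω) = 0 := by
  have hν : VecMem (squareIntegrable μ) fun ω => C *ᵥ ξ ω + v ω := (hξ.mulVec C).add hv
  rw [moment_sub_left hξ (hν.mulVec K) hν, moment_mulVec_left hν hν,
    moment_observation hξ hv hξv, moment_observation_observation hξ hv hξv, hK, sub_self]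

theorem moment_filterError (hξ : VecMem (squareIntegrable μ) ξ)
    (hv : VecMem (squareIntegrable μ) v) (hξv : moment μ ξ v = 0)
    (hK : K * (C * moment μ ξ ξ * Cᵀ + moment μ v v) = moment μ ξ ξ * Cᵀ) :
    moment μ (fun ω => ξ ω - K *ᵥ (C *ᵥ ξ ω + v ω)) (fun ω => ξ ω - K *ᵥ (C *ᵥ ξ ω + v ω)) =
      moment μ ξ ξ - K * (C * moment μ ξ ξ * Cᵀ + moment μ v v) * Kᵀ := by
  have hν : VecMem (squareIntegrable μ) fun ω => C *ᵥ ξ ω + v ω := (hξ.mulVec C).add hv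
  have hM : (C * moment μ ξ ξ * Cᵀ + moment μ v v)ᵀ = C * moment μ ξ ξ * Cᵀ + moment μ v v := by
    simp only [transpose_add, transpose_mul, transpose_transpose, moment_transpose,
      Matrix.mul_assoc]
  have hνξ : moment μ (fun ω => C *ᵥ ξ ω + v ω) ξ =
      (C * moment μ ξ ξ * Cᵀ + moment μ v v) * Kᵀ := by
    rw [← moment_transpose, moment_observation hξ hv hξv, ← hK, transpose_mul, hM]
  rw [moment_sub_right (hξ.sub (hν.mulVec K)) hξ (hν.mulVec K),
    moment_mulVec_right (hξ.sub (hν.mulVec K)) hν, moment_filterError_observation hξ hv hξv hK,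
    Matrix.zero_mul, sub_zero, moment_sub_left hξ (hν.mulVec K) hξ, moment_mulVec_left hν hξ,
    hνξ, ← Matrix.mul_assoc]

end Filter

/-! ### Stacked vectors -/

section Stacked

variable {n : ℕ} {ι₀ : Type*} {κ : Fin n → Type*}

/-- The component of a stacked vector that belongs to the minor agent `i`. -/
def minorPart (i : Fin n) (X : (ι₀ ⊕ Σ i, κ i) → ℝ) : κ i → ℝ := fun a => X (Sum.inr ⟨i, a⟩)

/-- The stacked vector `vec(0, X₁, …, Xₙ)`. -/
def minorStack (X : ∀ i, κ i → ℝ) : (ι₀ ⊕ Σ i, κ i) → ℝ := Sum.elim 0 fun p => X p.1 p.2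

theorem minorStack_zero : minorStack (ι₀ := ι₀) (fun i => (0 : κ i → ℝ)) = 0 :=
  Sum.elim_zero_zero

theorem stacked_ext {X Y : (ι₀ ⊕ Σ i, κ i) → ℝ} (h₀ : ∀ a, X (Sum.inl a) = Y (Sum.inl a))
    (h : ∀ i, minorPart i X = minorPart i Y) : X = Y := by
  funext a
  rcases a with a | ⟨i, a⟩
  · exact h₀ a
  · exact congrFun (h i) a

variable {Ω : Type*}

theorem VecMem.minorPart {W : Submodule ℝ (Ω → ℝ)} {X : Ω → (ι₀ ⊕ Σ i, κ i) → ℝ}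
    (hX : VecMem W X) (i : Fin n) : VecMem W fun ω => minorPart i (X ω) :=
  hX.precomp fun a => Sum.inr ⟨i, a⟩

theorem VecMem.minorStack [Finite ι₀] [∀ i, Finite (κ i)] {W : Submodule ℝ (Ω → ℝ)}
    {X : ∀ i, Ω → κ i → ℝ} (hX : ∀ i, VecMem W (X i)) :
    VecMem W fun ω => minorStack (ι₀ := ι₀) fun i => X i ω :=
  VecMem.of_apply fun a => by
    rcases a with _ | ⟨i, a⟩
    · exact W.zero_mem
    · exact (hX i).apply a

variable [MeasurableSpace Ω] {μ : Measure Ω}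

theorem moment_minorStack_right {κ' : Type*} {Y : Ω → κ' → ℝ} {X : ∀ i, Ω → κ i → ℝ}
    (h : ∀ i, moment μ Y (X i) = 0) :
    moment μ Y (fun ω => minorStack (ι₀ := ι₀) fun i => X i ω) = 0 := by
  ext a (b | ⟨i, b⟩)
  · simp [moment, minorStack]
  · exact congrFun (congrFun (h i) a) b

theorem stacked_ae_eq_zero_iff {X : Ω → (ι₀ ⊕ Σ i, κ i) → ℝ} :
    (∀ᵐ ω ∂μ, X ω = 0) ↔ (∀ᵐ ω ∂μ, (fun a => X ω (Sum.inl a)) = 0) ∧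
      ∀ i, ∀ᵐ ω ∂μ, MajorMinor.minorPart i (X ω) = 0 := by
  rw [← ae_all_iff, ← Filter.eventually_and]
  refine Filter.eventually_congr (.of_forall fun ω => ⟨fun h => ?_, fun h => ?_⟩)
  · rw [h]
    exact ⟨rfl, fun _ => rfl⟩
  · exact stacked_ext (congrFun h.1) h.2

theorem IsProjection.add_minorStack [Finite ι₀] [∀ i, Finite (κ i)] {W : Submodule ℝ (Ω → ℝ)}
    {Z : Ω → (ι₀ ⊕ Σ i, κ i) → ℝ} {X p : ∀ i, Ω → κ i → ℝ} (hZ : VecMem W Z)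
    (hp : ∀ i, IsProjection μ W (X i) (p i)) :
    IsProjection μ W (fun ω => Z ω + minorStack fun i => X i ω)
      fun ω => Z ω + minorStack fun i => p i ω := by
  refine ⟨hZ.add (VecMem.minorStack fun i => (hp i).mem), ?_⟩
  rintro (a | ⟨i, a⟩) h hh
  · simp [minorStack]
  · simpa only [Pi.add_apply, add_sub_add_left_eq_sub, minorStack, Sum.elim_inr]
      using (hp i).normal_eq a h hh

theorem moment_minorStack {X : ∀ i, Ω → κ i → ℝ} (h : ∀ i j, i ≠ j → moment μ (X i) (X j) = 0) :
    moment μ (fun ω => minorStack (ι₀ := ι₀) fun i => X i ω)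
        (fun ω => minorStack (ι₀ := ι₀) fun i => X i ω) =
      fromBlocks 0 0 0 (blockDiagonal' fun i => moment μ (X i) (X i)) := by
  ext (a | ⟨i, a⟩) (b | ⟨j, b⟩)
  · simp [moment, minorStack]
  · simp [moment, minorStack]
  · simp [moment, minorStack]
  · rw [fromBlocks_apply₂₂]
    rcases eq_or_ne i j with rfl | hij
    · rw [blockDiagonal'_apply_eq]
      rfl
    · rw [blockDiagonal'_apply_ne _ _ _ hij]
      exact congrFun (congrFun (h i j hij) a) b

variable [Fintype ι₀] [∀ i, Fintype (κ i)]

theorem quadForm_minorStack {X : ∀ i, Ω → κ i → ℝ} (hX : ∀ i, VecMem (squareIntegrable μ) (X i))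
    (h : ∀ i j, i ≠ j → moment μ (X i) (X j) = 0)
    (Q : Matrix (ι₀ ⊕ Σ i, κ i) (ι₀ ⊕ Σ i, κ i) ℝ) :
    quadForm μ Q (fun ω => minorStack fun i => X i ω) =
      ∑ i, quadForm μ (Q.submatrix (fun a => Sum.inr ⟨i, a⟩) fun a => Sum.inr ⟨i, a⟩) (X i) := by
  have hblock (i : Fin n) (a : κ i) :
      ∑ j, ∑ b, Q (Sum.inr ⟨i, a⟩) (Sum.inr ⟨j, b⟩) *
        blockDiagonal' (fun i => moment μ (X i) (X i)) ⟨j, b⟩ ⟨i, a⟩ =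
      ∑ b, Q (Sum.inr ⟨i, a⟩) (Sum.inr ⟨i, b⟩) * moment μ (X i) (X i) b a := by
    rw [Finset.sum_eq_single i]
    · simp only [blockDiagonal'_apply_eq]
    · intro j _ hj
      simp only [blockDiagonal'_apply_ne _ _ _ hj, mul_zero, Finset.sum_const_zero]
    · simp
  rw [quadForm_eq_trace (VecMem.minorStack hX), moment_minorStack h]
  simp only [quadForm_eq_trace (hX _)]
  simp only [trace, diag_apply, Matrix.mul_apply, submatrix_apply, Fintype.sum_sum_type,
    Fintype.sum_sigma, fromBlocks_apply₁₁, fromBlocks_apply₁₂, fromBlocks_apply₂₁,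
    fromBlocks_apply₂₂, Matrix.zero_apply, mul_zero, Finset.sum_const_zero, zero_add, hblock]

theorem quadForm_add_minorStack {Y : Ω → (ι₀ ⊕ Σ i, κ i) → ℝ} {X : ∀ i, Ω → κ i → ℝ}
    (hY : VecMem (squareIntegrable μ) Y) (hX : ∀ i, VecMem (squareIntegrable μ) (X i))
    (hYX : ∀ i, moment μ Y (X i) = 0) (h : ∀ i j, i ≠ j → moment μ (X i) (X j) = 0)
    (Q : Matrix (ι₀ ⊕ Σ i, κ i) (ι₀ ⊕ Σ i, κ i) ℝ) :
    quadForm μ Q (fun ω => Y ω + minorStack fun i => X i ω) = quadForm μ Q Y +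
      ∑ i, quadForm μ (Q.submatrix (fun a => Sum.inr ⟨i, a⟩) fun a => Sum.inr ⟨i, a⟩) (X i) := by
  rw [quadForm_add hY (VecMem.minorStack hX) (moment_minorStack_right hYX),
    quadForm_minorStack hX h]

end Stacked

section BlockTriangular

variable {n : ℕ} {ι₀ κ₀ : Type*} {ι κ : Fin n → Type*} [Fintype κ₀] [∀ i, Fintype (κ i)]
  (D : Matrix ι₀ κ₀ ℝ) (E : ∀ i, Matrix (ι i) κ₀ ℝ) (F : ∀ i, Matrix (ι i) (κ i) ℝ)
  (X : (κ₀ ⊕ Σ i, κ i) → ℝ)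

theorem blockTriangular_mulVec_inl :
    (fun a => (fromBlocks D 0 (Matrix.of fun p b => E p.1 p.2 b) (blockDiagonal' F) *ᵥ X)
      (Sum.inl a)) = D *ᵥ fun a => X (Sum.inl a) := by
  rw [fromBlocks_mulVec, zero_mulVec, add_zero]
  rfl

theorem blockTriangular_mulVec_minorPart (i : Fin n) :
    minorPart i (fromBlocks D 0 (Matrix.of fun p b => E p.1 p.2 b) (blockDiagonal' F) *ᵥ X) =
      E i *ᵥ (fun a => X (Sum.inl a)) + F i *ᵥ minorPart i X := by
  have hdiag (a : ι i) : (blockDiagonal' F *ᵥ (X ∘ Sum.inr)) ⟨i, a⟩ =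
      (F i *ᵥ minorPart i X) a := by
    simp only [mulVec, dotProduct, Fintype.sum_sigma]
    rw [Finset.sum_eq_single i]
    · simp only [blockDiagonal'_apply_eq, Function.comp, minorPart]
    · intro j _ hj
      simp only [blockDiagonal'_apply_ne _ _ _ hj.symm, zero_mul, Finset.sum_const_zero]
    · simp
  rw [fromBlocks_mulVec]
  funext a
  exact congrArg _ (hdiag a)

end BlockTriangular

/-! ### The information of the agents in terms of the primitive random variables -/

section Spaces

variable {n : ℕ} {M : Model n} {Ω : Type*} (P : Primitives M Ω)

/-- The affine functions of `x₀(0), w₀(0), …, w₀(t-1)`. -/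
def commonSpace (t : ℕ) : Submodule ℝ (Ω → ℝ) :=
  Submodule.span ℝ {h | h = (fun _ => 1) ∨ (∃ a, h = fun ω => P.x₀ ω a) ∨
    ∃ s < t, ∃ a, h = fun ω => P.w₀ s ω a}

/-- The state of the minor agent `i` when nothing acts on it but its own noise. -/
def freeState (i : Fin n) : ℕ → Ω → Fin (M.dx i) → ℝ
  | 0 => P.x i
  | t + 1 => fun ω => M.A₁₁ i *ᵥ freeState i t ω + P.w i t ω

/-- The output of the minor agent `i` when nothing acts on it but its own noise. -/
def freeOutput (i : Fin n) (t : ℕ) (ω : Ω) : Fin (M.dy i) → ℝ :=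
  M.C i *ᵥ freeState P i t ω + P.v i t ω

/-- The linear functions of the free outputs up to time `t`. -/
def localSpace (i : Fin n) (t : ℕ) : Submodule ℝ (Ω → ℝ) :=
  Submodule.span ℝ {h | ∃ s ≤ t, ∃ a, h = fun ω => freeOutput P i s ω a}

/-- The random variables that are affine functions of `I_i(t)`, whatever the strategy. -/
def agentSpace (i : Fin n) (t : ℕ) : Submodule ℝ (Ω → ℝ) := commonSpace P t ⊔ localSpace P i t

variable {P}

theorem commonSpace_le {t : ℕ} {W : Submodule ℝ (Ω → ℝ)} (h1 : (fun _ => 1) ∈ W)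
    (hx : VecMem W P.x₀) (hw : ∀ s < t, VecMem W (P.w₀ s)) : commonSpace P t ≤ W := by
  refine Submodule.span_le.2 ?_
  rintro h (rfl | ⟨a, rfl⟩ | ⟨s, hs, a, rfl⟩)
  · exact h1
  · exact hx.apply a
  · exact (hw s hs).apply a

theorem localSpace_le {i : Fin n} {t : ℕ} {W : Submodule ℝ (Ω → ℝ)}
    (hy : ∀ s ≤ t, VecMem W (freeOutput P i s)) : localSpace P i t ≤ W := by
  refine Submodule.span_le.2 ?_
  rintro h ⟨s, hs, a, rfl⟩
  exact (hy s hs).apply a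

variable (P)

theorem one_mem_commonSpace (t : ℕ) : (fun _ => 1) ∈ commonSpace P t :=
  Submodule.subset_span (Or.inl rfl)

theorem vecMem_commonSpace_x₀ (t : ℕ) : VecMem (commonSpace P t) P.x₀ :=
  VecMem.of_apply fun a => Submodule.subset_span (Or.inr (Or.inl ⟨a, rfl⟩))

theorem vecMem_commonSpace_w₀ {s t : ℕ} (h : s < t) : VecMem (commonSpace P t) (P.w₀ s) :=
  VecMem.of_apply fun a => Submodule.subset_span (Or.inr (Or.inr ⟨s, h, a, rfl⟩))

theorem vecMem_localSpace (i : Fin n) {s t : ℕ} (h : s ≤ t) :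
    VecMem (localSpace P i t) (freeOutput P i s) :=
  VecMem.of_apply fun a => Submodule.subset_span ⟨s, h, a, rfl⟩

theorem commonSpace_mono {s t : ℕ} (h : s ≤ t) : commonSpace P s ≤ commonSpace P t :=
  commonSpace_le (one_mem_commonSpace P t) (vecMem_commonSpace_x₀ P t)
    fun _ hr => vecMem_commonSpace_w₀ P (hr.trans_le h)

theorem localSpace_mono (i : Fin n) {s t : ℕ} (h : s ≤ t) : localSpace P i s ≤ localSpace P i t :=
  localSpace_le fun _ hr => vecMem_localSpace P i (hr.trans h)

theorem agentSpace_mono (i : Fin n) {s t : ℕ} (h : s ≤ t) : agentSpace P i s ≤ agentSpace P i t :=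
  sup_le_sup (commonSpace_mono P h) (localSpace_mono P i h)

theorem commonSpace_le_agentSpace (i : Fin n) (t : ℕ) : commonSpace P t ≤ agentSpace P i t :=
  le_sup_left

theorem localSpace_le_agentSpace (i : Fin n) (t : ℕ) : localSpace P i t ≤ agentSpace P i t :=
  le_sup_right

theorem one_mem_agentSpace (i : Fin n) (t : ℕ) : (fun _ => 1) ∈ agentSpace P i t :=
  commonSpace_le_agentSpace P i t (one_mem_commonSpace P t)

instance localSpace_finiteDimensional (i : Fin n) (t : ℕ) :
    FiniteDimensional ℝ (localSpace P i t) := by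
  refine FiniteDimensional.span_of_finite ℝ ?_
  refine ((Set.finite_Iic t).biUnion fun s _ =>
    Set.finite_range fun (a : Fin (M.dy i)) (ω : Ω) => freeOutput P i s ω a).subset ?_
  rintro h ⟨s, hs, a, rfl⟩
  exact Set.mem_biUnion (Set.mem_Iic.2 hs) ⟨a, rfl⟩

variable (g : M.AffineStrategy)

theorem x₀_zero (ω : Ω) : x₀ P g 0 ω = P.x₀ ω := by rw [x₀]

theorem x₀_succ (t : ℕ) (ω : Ω) :
    x₀ P g (t + 1) ω = M.A₀₀ *ᵥ x₀ P g t ω + M.B₀₀ *ᵥ u₀ P g t ω + P.w₀ t ω := by rw [x₀]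

theorem x_zero (i : Fin n) (ω : Ω) : x P g i 0 ω = P.x i ω := by rw [x]

theorem x_succ (i : Fin n) (t : ℕ) (ω : Ω) :
    x P g i (t + 1) ω = M.A₁₁ i *ᵥ x P g i t ω + M.A₁₀ i *ᵥ x₀ P g t ω + M.B₁₁ i *ᵥ u P g i t ω
      + M.B₁₀ i *ᵥ u₀ P g t ω + P.w i t ω := by rw [x]

/-- The part of the state of a minor agent that is due to the controls and to the major agent. -/
def drift (i : Fin n) (t : ℕ) (ω : Ω) : Fin (M.dx i) → ℝ := x P g i t ω - freeState P i t ω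

theorem drift_zero (i : Fin n) (ω : Ω) : drift P g i 0 ω = 0 := by
  rw [drift, x_zero, freeState, sub_self]

theorem drift_succ (i : Fin n) (t : ℕ) (ω : Ω) :
    drift P g i (t + 1) ω = M.A₁₁ i *ᵥ drift P g i t ω + M.A₁₀ i *ᵥ x₀ P g t ω
      + M.B₁₁ i *ᵥ u P g i t ω + M.B₁₀ i *ᵥ u₀ P g t ω := by
  simp only [drift, x_succ, freeState, mulVec_sub]
  abel

theorem y_eq_drift (i : Fin n) (t : ℕ) (ω : Ω) :
    y P g i t ω = M.C i *ᵥ drift P g i t ω + freeOutput P i t ω := by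
  rw [y, drift, freeOutput, mulVec_sub]
  abel

theorem vecMem_info₀ (t : ℕ) : VecMem (commonSpace P t) (info₀ P g t) := by
  induction t with
  | zero =>
    refine .prodMk (.pi fun s => ?_) (.pi fun s => s.elim0)
    simpa only [Fin.val_eq_zero, x₀_zero] using vecMem_commonSpace_x₀ P 0
  | succ t ih =>
    have hinfo := ih.mono (commonSpace_mono P t.le_succ)
    have hu : VecMem (commonSpace P (t + 1)) (u₀ P g t) := by
      rw [funext (u₀_eq P g t)]
      exact hinfo.affine (one_mem_commonSpace P _) _
    have hx : VecMem (commonSpace P (t + 1)) (x₀ P g (t + 1)) := by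
      rw [funext (x₀_succ P g t)]
      exact (((hinfo.fst.eval (Fin.last t)).mulVec _).add (hu.mulVec _)).add
        (vecMem_commonSpace_w₀ P t.lt_succ_self)
    exact .prodMk (.pi (Fin.lastCases hx fun s => hinfo.fst.eval s))
      (.pi (Fin.lastCases hu fun s => hinfo.snd.eval s))

theorem vecMem_u₀ (t : ℕ) : VecMem (commonSpace P t) (u₀ P g t) := by
  rw [funext (u₀_eq P g t)]
  exact (vecMem_info₀ P g t).affine (one_mem_commonSpace P t) _

theorem vecMem_y_of_drift {i : Fin n} {t : ℕ} (h : VecMem (agentSpace P i t) (drift P g i t)) :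
    VecMem (agentSpace P i t) (y P g i t) := by
  rw [funext (y_eq_drift P g i t)]
  exact (h.mulVec _).add ((vecMem_localSpace P i le_rfl).mono (localSpace_le_agentSpace P i t))

theorem vecMem_drift_and_info (i : Fin n) (t : ℕ) :
    VecMem (agentSpace P i t) (drift P g i t) ∧ VecMem (agentSpace P i t) (info P g i t) := by
  induction t with
  | zero =>
    have hdrift : VecMem (agentSpace P i 0) (drift P g i 0) := by
      rw [funext (drift_zero P g i)]
      exact .zero
    have hinfo₀ := (vecMem_info₀ P g 0).mono (commonSpace_le_agentSpace P i 0)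
    refine ⟨hdrift, .prodMk hinfo₀.fst (.prodMk (.pi fun s => ?_)
      (.prodMk hinfo₀.snd (.pi fun s => s.elim0)))⟩
    simpa only [Fin.val_eq_zero] using vecMem_y_of_drift P g hdrift
  | succ t ih =>
    have hinfo₀ := (vecMem_info₀ P g (t + 1)).mono (commonSpace_le_agentSpace P i (t + 1))
    have hinfo := ih.2.mono (agentSpace_mono P i t.le_succ)
    have hu : VecMem (agentSpace P i (t + 1)) (u P g i t) := by
      rw [funext (u_eq P g i t)]
      exact hinfo.affine (one_mem_agentSpace P i _) _
    have hdrift : VecMem (agentSpace P i (t + 1)) (drift P g i (t + 1)) := by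
      rw [funext (drift_succ P g i t)]
      exact ((((ih.1.mono (agentSpace_mono P i t.le_succ)).mulVec _).add
        ((hinfo.fst.eval (Fin.last t)).mulVec _)).add (hu.mulVec _)).add
        ((hinfo₀.snd.eval (Fin.last t)).mulVec _)
    exact ⟨hdrift, .prodMk hinfo₀.fst (.prodMk
      (.pi (Fin.lastCases (vecMem_y_of_drift P g hdrift) fun s => hinfo.snd.fst.eval s))
      (.prodMk hinfo₀.snd (.pi (Fin.lastCases hu fun s => hinfo.snd.snd.snd.eval s))))⟩

theorem vecMem_info (i : Fin n) (t : ℕ) : VecMem (agentSpace P i t) (info P g i t) :=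
  (vecMem_drift_and_info P g i t).2

theorem vecMem_u (i : Fin n) (t : ℕ) : VecMem (agentSpace P i t) (u P g i t) := by
  rw [funext (u_eq P g i t)]
  exact (vecMem_info P g i t).affine (one_mem_agentSpace P i t) _

/-! An affine function on `M.AffineStrategy × Ω` of the data is one on `Ω` whose coefficients do not
depend on the strategy. -/

theorem commonSpace_le_comap {t : ℕ} {W : Submodule ℝ (M.AffineStrategy × Ω → ℝ)}
    (h1 : (fun _ => 1) ∈ W) (hx₀ : ∀ s ≤ t, VecMem W fun q => x₀ P q.1 s q.2)
    (hu₀ : ∀ s < t, VecMem W fun q => u₀ P q.1 s q.2) :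
    commonSpace P t ≤ W.comap (LinearMap.funLeft ℝ ℝ Prod.snd) := by
  have hinit : VecMem W fun q => P.x₀ q.2 := by
    simpa only [x₀_zero] using hx₀ 0 t.zero_le
  have hnoise : ∀ s < t, VecMem W fun q => P.w₀ s q.2 := fun s hs => by
    simpa only [x₀_succ, add_assoc, add_sub_cancel_left] using
      ((hx₀ (s + 1) hs).sub ((hx₀ s hs.le).mulVec M.A₀₀)).sub ((hu₀ s hs).mulVec M.B₀₀)
  exact commonSpace_le h1 hinit hnoise

theorem commonSpace_le_comap_info₀ (t : ℕ) : commonSpace P t ≤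
    (affineFunctionsOf fun q : M.AffineStrategy × Ω => info₀ P q.1 t q.2).comap
      (LinearMap.funLeft ℝ ℝ Prod.snd) :=
  have hinfo := vecMem_affineFunctionsOf fun q : M.AffineStrategy × Ω => info₀ P q.1 t q.2
  commonSpace_le_comap P (one_mem_affineFunctionsOf _)
    (fun s hs => hinfo.fst.eval ⟨s, Nat.lt_succ_of_le hs⟩) fun s hs => hinfo.snd.eval ⟨s, hs⟩

theorem agentSpace_le_comap_info (i : Fin n) (t : ℕ) : agentSpace P i t ≤
    (affineFunctionsOf fun q : M.AffineStrategy × Ω => info P q.1 i t q.2).comap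
      (LinearMap.funLeft ℝ ℝ Prod.snd) := by
  set W := affineFunctionsOf fun q : M.AffineStrategy × Ω => info P q.1 i t q.2
  have hinfo : VecMem W _ :=
    vecMem_affineFunctionsOf fun q : M.AffineStrategy × Ω => info P q.1 i t q.2
  have hx₀ : ∀ s ≤ t, VecMem W fun q => x₀ P q.1 s q.2 :=
    fun s hs => hinfo.fst.eval ⟨s, Nat.lt_succ_of_le hs⟩
  have hu₀ : ∀ s < t, VecMem W fun q => u₀ P q.1 s q.2 :=
    fun s hs => hinfo.snd.snd.fst.eval ⟨s, hs⟩
  have hy : ∀ s ≤ t, VecMem W fun q => y P q.1 i s q.2 :=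
    fun s hs => hinfo.snd.fst.eval ⟨s, Nat.lt_succ_of_le hs⟩
  have hu : ∀ s < t, VecMem W fun q => u P q.1 i s q.2 :=
    fun s hs => hinfo.snd.snd.snd.eval ⟨s, hs⟩
  have hdrift : ∀ s ≤ t, VecMem W fun q => drift P q.1 i s q.2 := fun s => by
    induction s with
    | zero =>
      intro _
      simp only [drift_zero]
      exact .zero
    | succ s ih =>
      intro hs
      simp only [drift_succ]
      exact ((((ih (by omega)).mulVec _).add ((hx₀ s (by omega)).mulVec _)).add
        ((hu s (by omega)).mulVec _)).add ((hu₀ s (by omega)).mulVec _)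
  have houtput : ∀ s ≤ t, VecMem W fun q => freeOutput P i s q.2 := fun s hs => by
    simpa only [y_eq_drift, add_sub_cancel_left] using
      (hy s hs).sub ((hdrift s hs).mulVec (M.C i))
  exact sup_le (commonSpace_le_comap P (one_mem_affineFunctionsOf _) hx₀ hu₀)
    (localSpace_le houtput)

theorem exists_affineMap_info₀ {ι : Type*} {t : ℕ} {X : Ω → ι → ℝ}
    (hX : VecMem (commonSpace P t) X) :
    ∃ f : M.Info₀ t →ᵃ[ℝ] (ι → ℝ), ∀ g ω, f (info₀ P g t ω) = X ω := by
  have h : VecMem (affineFunctionsOf fun q : M.AffineStrategy × Ω => info₀ P q.1 t q.2)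
      fun q => X q.2 := hX.mono (commonSpace_le_comap_info₀ P t)
  obtain ⟨f, hf⟩ := h.exists_affineMap
  exact ⟨f, fun g ω => hf (g, ω)⟩

theorem exists_affineMap_info {ι : Type*} {i : Fin n} {t : ℕ} {X : Ω → ι → ℝ}
    (hX : VecMem (agentSpace P i t) X) :
    ∃ f : M.Info i t →ᵃ[ℝ] (ι → ℝ), ∀ g ω, f (info P g i t ω) = X ω := by
  have h : VecMem (affineFunctionsOf fun q : M.AffineStrategy × Ω => info P q.1 i t q.2)
      fun q => X q.2 := hX.mono (agentSpace_le_comap_info P i t)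
  obtain ⟨f, hf⟩ := h.exists_affineMap
  exact ⟨f, fun g ω => hf (g, ω)⟩

theorem affineFunctionsOf_info₀ (t : ℕ) : affineFunctionsOf (info₀ P g t) = commonSpace P t := by
  refine le_antisymm (affineFunctionsOf_le (one_mem_commonSpace P t) (vecMem_info₀ P g t))
    fun h hh => ?_
  obtain ⟨f, hf⟩ := commonSpace_le_comap_info₀ P t hh
  exact ⟨f, fun ω => hf (g, ω)⟩

theorem affineFunctionsOf_info (i : Fin n) (t : ℕ) :
    affineFunctionsOf (info P g i t) = agentSpace P i t := by
  refine le_antisymm (affineFunctionsOf_le (one_mem_agentSpace P i t) (vecMem_info P g i t))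
    fun h hh => ?_
  obtain ⟨f, hf⟩ := agentSpace_le_comap_info P i t hh
  exact ⟨f, fun ω => hf (g, ω)⟩

end Spaces

/-! ### Common and local parts of the controls and states -/

section Decomposition

variable {n : ℕ} {M : Model n} {Ω : Type*} (P : Primitives M Ω) (g : M.AffineStrategy)

/-- `uc` and `ul` are common and local parts of the controls under the strategy `g`. -/
structure IsDecomposition (uc : ℕ → Ω → M.ControlIdx → ℝ)
    (ul : ∀ i : Fin n, ℕ → Ω → Fin (M.du i) → ℝ) : Prop where
  major : ∀ t ω, u₀ P g t ω = fun a => uc t ω (Sum.inl a)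
  minor : ∀ i t ω, u P g i t ω = minorPart i (uc t ω) + ul i t ω
  common_mem : ∀ t, VecMem (commonSpace P t) (uc t)
  local_mem : ∀ i t, VecMem (localSpace P i t) (ul i t)

theorem exists_isDecomposition : ∃ uc ul, IsDecomposition P g uc ul := by
  choose X Y hX hY h using fun i t => (vecMem_u P g i t).exists_add_of_sup
  refine ⟨fun t ω => Sum.elim (u₀ P g t ω) fun p => X p.1 t ω p.2, Y, fun t ω => rfl, h,
    fun t => VecMem.sumElim (vecMem_u₀ P g t) (VecMem.of_apply fun p => (hX p.1 t).apply p.2), hY⟩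

/-- The common part of the stacked state. -/
def commonState (uc : ℕ → Ω → M.ControlIdx → ℝ) : ℕ → Ω → M.StateIdx → ℝ
  | 0 => fun ω => Sum.elim (P.x₀ ω) 0
  | t + 1 => fun ω => M.A *ᵥ commonState uc t ω + M.B *ᵥ uc t ω + Sum.elim (P.w₀ t ω) 0

/-- The effect of the local part of the controls on the state of a minor agent. -/
def localDrift (i : Fin n) (ul : ℕ → Ω → Fin (M.du i) → ℝ) : ℕ → Ω → Fin (M.dx i) → ℝ
  | 0 => fun _ => 0
  | t + 1 => fun ω => M.A₁₁ i *ᵥ localDrift i ul t ω + M.B₁₁ i *ᵥ ul t ω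

/-- The state that a minor agent would have if the common parts of all controls, the initial state
and the noise of the major agent vanished. -/
def localState (i : Fin n) (ul : ℕ → Ω → Fin (M.du i) → ℝ) (t : ℕ) (ω : Ω) :
    Fin (M.dx i) → ℝ :=
  localDrift i ul t ω + freeState P i t ω

theorem localState_zero (i : Fin n) (ul : ℕ → Ω → Fin (M.du i) → ℝ) :
    localState P i ul 0 = P.x i :=
  funext fun _ => zero_add _

theorem localState_succ (i : Fin n) (ul : ℕ → Ω → Fin (M.du i) → ℝ) (t : ℕ) :
    localState P i ul (t + 1) =
      fun ω => M.A₁₁ i *ᵥ localState P i ul t ω + M.B₁₁ i *ᵥ ul t ω + P.w i t ω := by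
  funext ω
  simp only [localState, localDrift, freeState, mulVec_add]
  abel

variable {P g} {uc : ℕ → Ω → M.ControlIdx → ℝ} {ul : ∀ i : Fin n, ℕ → Ω → Fin (M.du i) → ℝ}

theorem vecMem_commonState (h : ∀ t, VecMem (commonSpace P t) (uc t)) (t : ℕ) :
    VecMem (commonSpace P t) (commonState P uc t) := by
  induction t with
  | zero => exact VecMem.sumElim (vecMem_commonSpace_x₀ P 0) VecMem.zero
  | succ t ih =>
    have hm := commonSpace_mono P t.le_succ
    exact (((ih.mono hm).mulVec _).add (((h t).mono hm).mulVec _)).add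
      (VecMem.sumElim (vecMem_commonSpace_w₀ P t.lt_succ_self) VecMem.zero)

theorem vecMem_localDrift {i : Fin n} {ul : ℕ → Ω → Fin (M.du i) → ℝ}
    (h : ∀ t, VecMem (localSpace P i t) (ul t)) (t : ℕ) :
    VecMem (localSpace P i t) (localDrift i ul t) := by
  induction t with
  | zero => exact VecMem.zero
  | succ t ih =>
    have hm := localSpace_mono P i t.le_succ
    exact ((ih.mono hm).mulVec _).add (((h t).mono hm).mulVec _)

theorem IsDecomposition.x₀_eq (h : IsDecomposition P g uc ul) (t : ℕ) (ω : Ω) :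
    x₀ P g t ω = fun a => commonState P uc t ω (Sum.inl a) := by
  induction t with
  | zero => rw [x₀_zero]; rfl
  | succ t ih =>
    have hA := blockTriangular_mulVec_inl M.A₀₀ M.A₁₀ M.A₁₁ (commonState P uc t ω)
    have hB := blockTriangular_mulVec_inl M.B₀₀ M.B₁₀ M.B₁₁ (uc t ω)
    rw [x₀_succ, ih, h.major, ← hA, ← hB]
    rfl

theorem IsDecomposition.x_eq (h : IsDecomposition P g uc ul) (i : Fin n) (t : ℕ) (ω : Ω) :
    x P g i t ω = minorPart i (commonState P uc t ω) + localState P i (ul i) t ω := by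
  induction t with
  | zero =>
    rw [x_zero, localState_zero]
    exact (zero_add _).symm
  | succ t ih =>
    have hA := blockTriangular_mulVec_minorPart M.A₀₀ M.A₁₀ M.A₁₁ (commonState P uc t ω) i
    have hB := blockTriangular_mulVec_minorPart M.B₀₀ M.B₁₀ M.B₁₁ (uc t ω) i
    have hsucc : minorPart i (commonState P uc (t + 1) ω) =
        minorPart i (M.A *ᵥ commonState P uc t ω) + minorPart i (M.B *ᵥ uc t ω) := by
      funext a
      simp [minorPart, commonState]
    rw [x_succ, ih, h.major, h.minor, h.x₀_eq, hsucc, Model.A, Model.B, hA, hB, localState_succ]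
    simp only [mulVec_add]
    abel

theorem IsDecomposition.state_eq (h : IsDecomposition P g uc ul) (t : ℕ) (ω : Ω) :
    state P g t ω = commonState P uc t ω +
      minorStack fun i => localState P i (ul i) t ω := by
  refine stacked_ext (fun a => ?_) fun i => ?_
  · simp [state, h.x₀_eq, minorStack]
  · exact h.x_eq i t ω

theorem IsDecomposition.control_eq (h : IsDecomposition P g uc ul) (t : ℕ) (ω : Ω) :
    control P g t ω = uc t ω + minorStack fun i => ul i t ω := by
  refine stacked_ext (fun a => ?_) fun i => ?_
  · simp [control, h.major, minorStack]
  · exact h.minor i t ω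

theorem exists_strategy (hc : ∀ t, VecMem (commonSpace P t) (uc t))
    (hl : ∀ i t, VecMem (localSpace P i t) (ul i t)) :
    ∃ g : M.AffineStrategy, IsDecomposition P g uc ul := by
  choose f₀ hf₀ using fun t => exists_affineMap_info₀ P ((hc t).precomp Sum.inl)
  choose f hf using fun i t => exists_affineMap_info P
    ((((hc t).mono (commonSpace_le_agentSpace P i t)).minorPart i).add
      ((hl i t).mono (localSpace_le_agentSpace P i t)))
  exact ⟨⟨f₀, f⟩, fun t ω => by rw [u₀_eq]; exact hf₀ t _ ω,
    fun i t ω => by rw [u_eq]; exact hf i t _ ω, hc, hl⟩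

end Decomposition

/-! ### Linear functions of the primitive random variables -/

theorem VecMem.measurable {Ω ι : Type*} {_m : MeasurableSpace Ω} {W : Submodule ℝ (Ω → ℝ)}
    {Z : Ω → ι → ℝ} (hZ : VecMem W Z) (hW : ∀ f ∈ W, Measurable f) : Measurable Z :=
  measurable_pi_lambda _ fun a => hW _ (hZ.apply a)

section PrimSpace

variable {n : ℕ} {M : Model n} {Ω : Type*} (P : Primitives M Ω) (N : ℕ)

/-- The linear functions of the primitive random variables with labels in `K`. -/
def primSpace (K : Set (PrimIdx n N)) : Submodule ℝ (Ω → ℝ) :=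
  Submodule.span ℝ {h | ∃ k ∈ K, ∃ a, h = fun ω => P.var N k ω a}

/-- Labels of `x₀(0), w₀(0), …, w₀(t-1)`. -/
def commonIdx (n N t : ℕ) : Set (PrimIdx n N) := fun k =>
  match k with
  | .x₀ => True
  | .w₀ s => s.1 < t
  | _ => False

/-- Labels of `x_i(0), w_i(0), …, w_i(t-1), v_i(0), …, v_i(t)`. -/
def localIdx {n : ℕ} (N : ℕ) (i : Fin n) (t : ℕ) : Set (PrimIdx n N) := fun k =>
  match k with
  | .x j => j = i
  | .w j s => j = i ∧ s.1 < t
  | .v j s => j = i ∧ s.1 ≤ t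
  | _ => False

variable {N}

theorem vecMem_primSpace {K : Set (PrimIdx n N)} {k : PrimIdx n N} (hk : k ∈ K) :
    VecMem (primSpace P N K) (P.var N k) :=
  VecMem.of_apply fun a => Submodule.subset_span ⟨k, hk, a, rfl⟩

theorem primSpace_mono {K K' : Set (PrimIdx n N)} (h : K ⊆ K') :
    primSpace P N K ≤ primSpace P N K' :=
  Submodule.span_mono fun _ ⟨k, hk, a, e⟩ => ⟨k, h hk, a, e⟩

theorem localIdx_mono (i : Fin n) {s t : ℕ} (h : s ≤ t) : localIdx N i s ⊆ localIdx N i t := by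
  rintro (_ | _ | _ | ⟨_, _⟩ | ⟨_, _⟩) hk
  exacts [hk, hk, hk, ⟨hk.1, hk.2.trans_le h⟩, ⟨hk.1, hk.2.trans h⟩]

theorem disjoint_commonIdx_localIdx (i : Fin n) (s t : ℕ) :
    Disjoint (commonIdx n N s) (localIdx N i t) := by
  rw [Set.disjoint_left]
  rintro (_ | _ | _ | ⟨_, _⟩ | ⟨_, _⟩) hcommon hlocal
  exacts [hlocal, hcommon, hlocal, hcommon, hcommon]

theorem disjoint_localIdx {i j : Fin n} (hij : i ≠ j) (s t : ℕ) :
    Disjoint (localIdx N i s) (localIdx N j t) := by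
  rw [Set.disjoint_left]
  rintro (_ | _ | _ | ⟨_, _⟩ | ⟨_, _⟩) hi hj
  exacts [hi, hij (hi.symm.trans hj), hi, hij (hi.1.symm.trans hj.1), hij (hi.1.symm.trans hj.1)]

theorem vecMem_freeState (i : Fin n) {t : ℕ} (ht : t ≤ N) :
    VecMem (primSpace P N (localIdx N i t)) (freeState P i t) := by
  induction t with
  | zero => exact vecMem_primSpace P (k := .x i) (show i = i from rfl)
  | succ t ih =>
    exact (((ih (by omega)).mono (primSpace_mono P (localIdx_mono i t.le_succ))).mulVec _).add
      (vecMem_primSpace P (k := .w i ⟨t, by omega⟩) ⟨rfl, t.lt_succ_self⟩)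

theorem localSpace_le_primSpace (i : Fin n) {t : ℕ} (ht : t ≤ N) :
    localSpace P i t ≤ primSpace P N (localIdx N i t) :=
  localSpace_le fun s hs =>
    (((vecMem_freeState P i (hs.trans ht)).mono (primSpace_mono P (localIdx_mono i hs))).mulVec
      _).add (vecMem_primSpace P (k := .v i ⟨s, by omega⟩) ⟨rfl, hs⟩)

theorem commonSpace_le_primSpace {t : ℕ} (ht : t ≤ N + 1) :
    commonSpace P t ≤ Submodule.span ℝ {fun _ => 1} ⊔ primSpace P N (commonIdx n N t) := by
  refine commonSpace_le (le_sup_left (α := Submodule ℝ (Ω → ℝ))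
      (Submodule.mem_span_singleton_self _)) ?_ fun s hs => ?_
  · exact (vecMem_primSpace P (K := commonIdx n N t) (k := .x₀) trivial).mono le_sup_right
  · exact (vecMem_primSpace P (K := commonIdx n N t) (k := .w₀ ⟨s, by omega⟩) hs).mono le_sup_right

variable {P} {g : M.AffineStrategy} {uc : ℕ → Ω → M.ControlIdx → ℝ}
  {ul : ∀ i : Fin n, ℕ → Ω → Fin (M.du i) → ℝ}

theorem IsDecomposition.vecMem_localState (hd : IsDecomposition P g uc ul) (i : Fin n) {t : ℕ}
    (ht : t ≤ N) : VecMem (primSpace P N (localIdx N i t)) (localState P i (ul i) t) :=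
  ((vecMem_localDrift (hd.local_mem i) t).mono (localSpace_le_primSpace P i ht)).add
    (vecMem_freeState P i ht)

end PrimSpace

section Probability

variable {n N : ℕ} {M : Model n} {Ω : Type*} {P : Primitives M Ω}

/-- The σ-algebra generated by the primitive random variables with labels in `K`. -/
abbrev primSigma (P : Primitives M Ω) (K : Set (PrimIdx n N)) : MeasurableSpace Ω :=
  ⨆ k ∈ K, MeasurableSpace.comap (P.var N k) inferInstance

theorem measurable_of_mem_primSpace {K : Set (PrimIdx n N)} {f : Ω → ℝ}
    (hf : f ∈ primSpace P N K) : Measurable[primSigma P K] f := by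
  induction hf using Submodule.span_induction with
  | mem f hf =>
    obtain ⟨k, hk, a, rfl⟩ := hf
    have hvar : Measurable[MeasurableSpace.comap (P.var N k) inferInstance] (P.var N k) :=
      comap_measurable _
    exact ((measurable_pi_apply a).comp hvar).mono
      (le_iSup₂ (f := fun k (_ : k ∈ K) => MeasurableSpace.comap (P.var N k) _) k hk) le_rfl
  | zero => exact measurable_const
  | add f h _ _ hf hh => exact hf.add hh
  | smul c f _ hf => exact hf.const_smul c

theorem measurable_of_mem_commonSpace {t : ℕ} (ht : t ≤ N + 1) {f : Ω → ℝ}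
    (hf : f ∈ commonSpace P t) : Measurable[primSigma P (commonIdx n N t)] f := by
  obtain ⟨k, hk, h, hh, rfl⟩ := Submodule.mem_sup.1 (commonSpace_le_primSpace P ht hf)
  obtain ⟨c, rfl⟩ := Submodule.mem_span_singleton.1 hk
  exact Measurable.add measurable_const (measurable_of_mem_primSpace hh)

theorem commonSigma_le_primSigma (g : M.AffineStrategy) {t : ℕ} (ht : t ≤ N + 1) :
    commonSigma P g t ≤ primSigma P (commonIdx n N t) := by
  let := primSigma P (commonIdx n N t)
  have hinfo := vecMem_info₀ P g t
  have hmeas : ∀ f ∈ commonSpace P t, Measurable f := fun _ => measurable_of_mem_commonSpace ht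
  exact Measurable.comap_le <| Measurable.prodMk
    (measurable_pi_lambda _ fun s => (hinfo.fst.eval s).measurable hmeas)
    (measurable_pi_lambda _ fun s => (hinfo.snd.eval s).measurable hmeas)

theorem stronglyMeasurable_commonSigma {ι : Type*} [Finite ι] (g : M.AffineStrategy) {t : ℕ}
    {X : Ω → ι → ℝ} (hX : VecMem (commonSpace P t) X) :
    StronglyMeasurable[commonSigma P g t] X := by
  cases nonempty_fintype ι
  obtain ⟨f, hf⟩ := exists_affineMap_info₀ P hX
  rw [← funext (hf g)]
  exact (f.continuous_of_finiteDimensional.measurable.comp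
    (comap_measurable _)).stronglyMeasurable

variable [MeasurableSpace Ω] {μ : Measure Ω} {S : M.Covariances}

theorem Primitives.Admissible.primSigma_le (hP : P.Admissible μ N S) (K : Set (PrimIdx n N)) :
    primSigma P K ≤ ‹MeasurableSpace Ω› :=
  iSup₂_le fun k _ => (hP.measurable k).comap_le

theorem Primitives.Admissible.indep_primSigma (hP : P.Admissible μ N S) {K K' : Set (PrimIdx n N)}
    (h : Disjoint K K') : Indep (primSigma P K) (primSigma P K') μ :=
  indep_iSup_of_disjoint (fun k => (hP.measurable k).comap_le) hP.indep.iIndep h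

variable [IsProbabilityMeasure μ]

theorem integral_eq_zero_of_vecMem_centred {ι : Type*} [Fintype ι] {X : Ω → ι → ℝ}
    (hX : VecMem (centred μ) X) : ∫ ω, X ω ∂μ = 0 := by
  funext a
  rw [eval_integral fun a => integrable_of_mem (hX.apply a).1]
  exact (hX.apply a).2

namespace Primitives.Admissible

theorem vecMem_centred_var (hP : P.Admissible μ N S) (k : PrimIdx n N) :
    VecMem (centred μ) (P.var N k) :=
  VecMem.of_apply fun a => by
    have hLp : ∀ a, MemLp (fun ω => P.var N k ω a) 2 μ := memLp_pi_iff.1 (hP.memLp k)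
    refine ⟨hLp a, ?_⟩
    rw [← eval_integral (f := P.var N k) (fun a => (hLp a).integrable one_le_two) a,
      hP.mean_zero k]
    rfl

theorem primSpace_le_centred (hP : P.Admissible μ N S) (K : Set (PrimIdx n N)) :
    primSpace P N K ≤ centred μ :=
  Submodule.span_le.2 <| by
    rintro _ ⟨k, -, a, rfl⟩
    exact (hP.vecMem_centred_var k).apply a

theorem primSpace_le_squareIntegrable (hP : P.Admissible μ N S) (K : Set (PrimIdx n N)) :
    primSpace P N K ≤ squareIntegrable μ :=
  (hP.primSpace_le_centred K).trans centred_le_squareIntegrable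

theorem orthogonal_primSpace (hP : P.Admissible μ N S) {K K' : Set (PrimIdx n N)}
    (h : Disjoint K K') : Orthogonal μ (primSpace P N K) (primSpace P N K') := by
  refine orthogonal_span_span (Submodule.span_le.1 (hP.primSpace_le_squareIntegrable K))
    (Submodule.span_le.1 (hP.primSpace_le_squareIntegrable K')) ?_
  rintro _ ⟨k, hk, a, rfl⟩ _ ⟨l, hl, b, rfl⟩
  have hkl : k ≠ l := fun e => Set.disjoint_left.1 h hk (e ▸ hl)
  have hindep := (hP.indep.indepFun hkl).comp (measurable_pi_apply a) (measurable_pi_apply b)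
  have hka := (hP.vecMem_centred_var k).apply a
  have hlb := (hP.vecMem_centred_var l).apply b
  exact (hindep.integral_mul_eq_mul_integral hka.1.1 hlb.1.1).trans (mul_eq_zero_of_left hka.2 _)

theorem commonSpace_le_squareIntegrable (hP : P.Admissible μ N S) {t : ℕ} (ht : t ≤ N + 1) :
    commonSpace P t ≤ squareIntegrable μ :=
  (commonSpace_le_primSpace P ht).trans (sup_le
    ((Submodule.span_singleton_le_iff_mem _ _).2 one_mem_squareIntegrable)
    (hP.primSpace_le_squareIntegrable _))

theorem localSpace_le_squareIntegrable (hP : P.Admissible μ N S) (i : Fin n) {t : ℕ}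
    (ht : t ≤ N) : localSpace P i t ≤ squareIntegrable μ :=
  (localSpace_le_primSpace P i ht).trans (hP.primSpace_le_squareIntegrable _)

theorem agentSpace_le_squareIntegrable (hP : P.Admissible μ N S) (i : Fin n) {t : ℕ}
    (ht : t ≤ N) : agentSpace P i t ≤ squareIntegrable μ :=
  sup_le (hP.commonSpace_le_squareIntegrable (by omega)) (hP.localSpace_le_squareIntegrable i ht)

theorem orthogonal_commonSpace_primSpace (hP : P.Admissible μ N S) {t : ℕ} (ht : t ≤ N + 1)
    {K : Set (PrimIdx n N)} (h : Disjoint (commonIdx n N t) K) :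
    Orthogonal μ (commonSpace P t) (primSpace P N K) := by
  have hone : Orthogonal μ (Submodule.span ℝ {fun _ => 1}) (primSpace P N K) :=
    orthogonal_span_left (Set.singleton_subset_iff.2 one_mem_squareIntegrable)
      (hP.primSpace_le_squareIntegrable K) fun f hf k hk => by
        simpa only [Set.mem_singleton_iff.1 hf, one_mul] using (hP.primSpace_le_centred K hk).2
  exact (orthogonal_sup_left
    ((Submodule.span_singleton_le_iff_mem _ _).2 one_mem_squareIntegrable)
    (hP.primSpace_le_squareIntegrable _) (hP.primSpace_le_squareIntegrable _) hone
    (hP.orthogonal_primSpace h)).mono (commonSpace_le_primSpace P ht) le_rfl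

theorem orthogonal_commonSpace_primSpace_localIdx (hP : P.Admissible μ N S) {s t : ℕ}
    (hs : s ≤ N + 1) (i : Fin n) :
    Orthogonal μ (commonSpace P s) (primSpace P N (localIdx N i t)) :=
  hP.orthogonal_commonSpace_primSpace hs (disjoint_commonIdx_localIdx i s t)

theorem condExp_commonSigma_primSpace (hP : P.Admissible μ N S) (g : M.AffineStrategy)
    {ι : Type*} [Fintype ι] {t : ℕ} (ht : t ≤ N + 1) {K : Set (PrimIdx n N)}
    (hK : Disjoint (commonIdx n N t) K) {Y : Ω → ι → ℝ} (hY : VecMem (primSpace P N K) Y) :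
    μ[Y | commonSigma P g t] =ᵐ[μ] 0 := by
  have hle := commonSigma_le_primSigma (P := P) g ht
  have hmeas : StronglyMeasurable[primSigma P K] Y :=
    (hY.measurable fun _ => measurable_of_mem_primSpace).stronglyMeasurable
  have hmean := integral_eq_zero_of_vecMem_centred (hY.mono (hP.primSpace_le_centred K))
  refine (condExp_indep_eq (hP.primSigma_le K) (hle.trans (hP.primSigma_le _)) hmeas
    (indep_of_indep_of_le_right (hP.indep_primSigma hK.symm) hle)).trans ?_
  rw [hmean]
  rfl

theorem condExp_commonSigma_add (hP : P.Admissible μ N S) (g : M.AffineStrategy) {ι : Type*}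
    [Fintype ι] {t : ℕ} (ht : t ≤ N + 1) {X Y : Ω → ι → ℝ} (hX : VecMem (commonSpace P t) X)
    {K : Set (PrimIdx n N)} (hK : Disjoint (commonIdx n N t) K) (hY : VecMem (primSpace P N K) Y) :
    μ[fun ω => X ω + Y ω | commonSigma P g t] =ᵐ[μ] X := by
  have hXint : Integrable X μ := .of_eval fun a =>
    integrable_of_mem (hP.commonSpace_le_squareIntegrable ht (hX.apply a))
  have hYint : Integrable Y μ := .of_eval fun a =>
    integrable_of_mem (hP.primSpace_le_squareIntegrable K (hY.apply a))
  have hXcond : μ[X | commonSigma P g t] = X :=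
    condExp_of_stronglyMeasurable ((commonSigma_le_primSigma g ht).trans (hP.primSigma_le _))
      (stronglyMeasurable_commonSigma g hX) hXint
  have hYcond := hP.condExp_commonSigma_primSpace g ht hK hY
  calc μ[X + Y | commonSigma P g t]
      =ᵐ[μ] μ[X | commonSigma P g t] + μ[Y | commonSigma P g t] := condExp_add hXint hYint _
    _ =ᵐ[μ] X + 0 := by rw [hXcond]; exact .add .rfl hYcond
    _ = X := add_zero X

end Primitives.Admissible

end Probability

/-! ### Estimates -/

section Estimation

variable {n N : ℕ} {M : Model n} {Ω : Type*} [MeasurableSpace Ω] {μ : Measure Ω}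
  {P : Primitives M Ω} {S : M.Covariances}

/-- `p i t` is the least squares estimate of the free state of the minor agent `i` from its free
outputs up to time `t`. -/
structure IsFreeEstimate (P : Primitives M Ω) (μ : Measure Ω) (N : ℕ)
    (p : ∀ i : Fin n, ℕ → Ω → Fin (M.dx i) → ℝ) : Prop where
  mem : ∀ i t, VecMem (localSpace P i t) (p i t)
  normal_eq : ∀ i, ∀ t ≤ N, ∀ a, ∀ h ∈ localSpace P i t,
    ∫ ω, (freeState P i t ω a - p i t ω a) * h ω ∂μ = 0

variable {p : ∀ i : Fin n, ℕ → Ω → Fin (M.dx i) → ℝ}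

theorem IsFreeEstimate.isProjection (hp : IsFreeEstimate P μ N p) (i : Fin n) {t : ℕ}
    (ht : t ≤ N) : IsProjection μ (localSpace P i t) (freeState P i t) (p i t) :=
  ⟨hp.mem i t, hp.normal_eq i t ht⟩

theorem IsFreeEstimate.vecMem_error (hp : IsFreeEstimate P μ N p) (i : Fin n) {t : ℕ}
    (ht : t ≤ N) : VecMem (primSpace P N (localIdx N i t)) fun ω => freeState P i t ω - p i t ω :=
  (vecMem_freeState P i ht).sub ((hp.mem i t).mono (localSpace_le_primSpace P i ht))

/-- The estimate of the stacked state by the minor agent `i`. -/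
def minorEstimate (P : Primitives M Ω) (p : ∀ i : Fin n, ℕ → Ω → Fin (M.dx i) → ℝ)
    (uc : ℕ → Ω → M.ControlIdx → ℝ) (ul : ∀ i : Fin n, ℕ → Ω → Fin (M.du i) → ℝ) (i : Fin n)
    (t : ℕ) (ω : Ω) : M.StateIdx → ℝ :=
  commonState P uc t ω +
    minorStack fun j => if j = i then localDrift j (ul j) t ω + p j t ω else 0

variable [IsProbabilityMeasure μ] {g : M.AffineStrategy} {uc : ℕ → Ω → M.ControlIdx → ℝ}
  {ul : ∀ i : Fin n, ℕ → Ω → Fin (M.du i) → ℝ}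

theorem Primitives.Admissible.exists_isFreeEstimate (hP : P.Admissible μ N S) :
    ∃ p, IsFreeEstimate P μ N p := by
  have hproj : ∀ i t, ∃ q, VecMem (localSpace P i t) q ∧
      (t ≤ N → IsProjection μ (localSpace P i t) (freeState P i t) q) := fun i t => by
    by_cases ht : t ≤ N
    · obtain ⟨q, hq⟩ := exists_isProjection (hP.localSpace_le_squareIntegrable i ht)
        ((vecMem_freeState P i ht).mono (hP.primSpace_le_squareIntegrable _))
      exact ⟨q, hq.mem, fun _ => hq⟩
    · exact ⟨fun _ => 0, .zero, fun h => absurd h ht⟩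
  choose p hmem hp using hproj
  exact ⟨p, hmem, fun i t ht => (hp i t ht).normal_eq⟩

theorem Primitives.Admissible.vecMem_info₀ (hP : P.Admissible μ N S) {t : ℕ} (ht : t ≤ N) :
    VecMem (squareIntegrable μ) (info₀ P g t) :=
  (MajorMinor.vecMem_info₀ P g t).mono (hP.commonSpace_le_squareIntegrable (by omega))

theorem Primitives.Admissible.vecMem_info (hP : P.Admissible μ N S) (i : Fin n) {t : ℕ}
    (ht : t ≤ N) : VecMem (squareIntegrable μ) (info P g i t) :=
  (MajorMinor.vecMem_info P g i t).mono (hP.agentSpace_le_squareIntegrable i ht)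

namespace IsDecomposition

theorem vecMem_state (hP : P.Admissible μ N S) (hd : IsDecomposition P g uc ul) {t : ℕ}
    (ht : t ≤ N) : VecMem (squareIntegrable μ) (state P g t) := by
  rw [funext (hd.state_eq t)]
  exact ((vecMem_commonState hd.common_mem t).mono
    (hP.commonSpace_le_squareIntegrable (by omega))).add (VecMem.minorStack fun i =>
      (hd.vecMem_localState i ht).mono (hP.primSpace_le_squareIntegrable _))

theorem isProjection_commonState (hP : P.Admissible μ N S) (hd : IsDecomposition P g uc ul)
    {t : ℕ} (ht : t ≤ N) :
    IsProjection μ (affineFunctionsOf (info₀ P g t)) (state P g t) (commonState P uc t) := by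
  rw [affineFunctionsOf_info₀, funext (hd.state_eq t)]
  have hlocal (i : Fin n) : IsProjection μ (commonSpace P t) (localState P i (ul i) t)
      fun _ => 0 :=
    .of_orthogonal .zero (by simpa only [sub_zero] using hd.vecMem_localState i ht)
      (hP.orthogonal_commonSpace_primSpace_localIdx (by omega) i).symm
  simpa only [minorStack_zero, add_zero] using
    IsProjection.add_minorStack (vecMem_commonState hd.common_mem t) hlocal

theorem xhatCom_ae (hP : P.Admissible μ N S) (hd : IsDecomposition P g uc ul) {t : ℕ}
    (ht : t ≤ N) : ∀ᵐ ω ∂μ, xhatCom P g μ t ω = commonState P uc t ω :=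
  (hd.isProjection_commonState hP ht).llms_ae_eq (hP.vecMem_info₀ ht) (hd.vecMem_state hP ht)

theorem isProjection_localState (hP : P.Admissible μ N S) (hd : IsDecomposition P g uc ul)
    (hp : IsFreeEstimate P μ N p) (i : Fin n) {t : ℕ} (ht : t ≤ N) :
    IsProjection μ (agentSpace P i t) (localState P i (ul i) t)
      fun ω => localDrift i (ul i) t ω + p i t ω := by
  have hlocal : IsProjection μ (localSpace P i t) (localState P i (ul i) t)
      fun ω => localDrift i (ul i) t ω + p i t ω := by
    refine ⟨(vecMem_localDrift (hd.local_mem i) t).add (hp.mem i t), ?_⟩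
    simpa only [localState, Pi.add_apply, add_sub_add_left_eq_sub] using hp.normal_eq i t ht
  have hcommon : IsProjection μ (commonSpace P t)
      (fun ω => localState P i (ul i) t ω - (localDrift i (ul i) t ω + p i t ω)) fun _ => 0 :=
    .of_orthogonal .zero
      (by simpa only [localState, add_sub_add_left_eq_sub, sub_zero] using hp.vecMem_error i ht)
      (hP.orthogonal_commonSpace_primSpace_localIdx (by omega) i).symm
  rw [agentSpace, sup_comm]
  simpa only [add_zero] using hlocal.sup_add hcommon
    ((hd.vecMem_localState i ht).mono (hP.primSpace_le_squareIntegrable _))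
    (hP.localSpace_le_squareIntegrable i ht) (hP.commonSpace_le_squareIntegrable (by omega))
    ((hP.orthogonal_commonSpace_primSpace_localIdx (by omega) i).mono le_rfl
      (localSpace_le_primSpace P i ht))

theorem isProjection_localState_of_ne (hP : P.Admissible μ N S) (hd : IsDecomposition P g uc ul)
    {i j : Fin n} (hij : i ≠ j) {t : ℕ} (ht : t ≤ N) :
    IsProjection μ (agentSpace P i t) (localState P j (ul j) t)
      fun _ => 0 := by
  have horth : Orthogonal μ (agentSpace P i t) (primSpace P N (localIdx N j t)) :=
    orthogonal_sup_left (hP.commonSpace_le_squareIntegrable (by omega))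
      (hP.localSpace_le_squareIntegrable i ht) (hP.primSpace_le_squareIntegrable _)
      (hP.orthogonal_commonSpace_primSpace_localIdx (by omega) j)
      ((hP.orthogonal_primSpace (disjoint_localIdx hij t t)).mono
        (localSpace_le_primSpace P i ht) le_rfl)
  exact .of_orthogonal .zero (by simpa only [sub_zero] using hd.vecMem_localState j ht) horth.symm

theorem isProjection_minorEstimate (hP : P.Admissible μ N S) (hd : IsDecomposition P g uc ul)
    (hp : IsFreeEstimate P μ N p) (i : Fin n) {t : ℕ} (ht : t ≤ N) :
    IsProjection μ (affineFunctionsOf (info P g i t)) (state P g t)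
      (minorEstimate P p uc ul i t) := by
  rw [affineFunctionsOf_info, funext (hd.state_eq t)]
  refine IsProjection.add_minorStack
    (p := fun j ω => if j = i then localDrift j (ul j) t ω + p j t ω else 0)
    ((vecMem_commonState hd.common_mem t).mono (commonSpace_le_agentSpace P i t)) fun j => ?_
  rcases eq_or_ne j i with rfl | hij
  · simpa only [if_true] using hd.isProjection_localState hP hp j ht
  · simpa only [if_neg hij] using hd.isProjection_localState_of_ne hP hij.symm ht

theorem xhatMinor_ae (hP : P.Admissible μ N S) (hd : IsDecomposition P g uc ul)
    (hp : IsFreeEstimate P μ N p) (i : Fin n) {t : ℕ} (ht : t ≤ N) :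
    ∀ᵐ ω ∂μ, xhatMinor P g μ i t ω = minorEstimate P p uc ul i t ω :=
  (hd.isProjection_minorEstimate hP hp i ht).llms_ae_eq (hP.vecMem_info i ht)
    (hd.vecMem_state hP ht)

theorem xhatLoc_ae (hP : P.Admissible μ N S) (hd : IsDecomposition P g uc ul)
    (hp : IsFreeEstimate P μ N p) (i : Fin n) {t : ℕ} (ht : t ≤ N) :
    ∀ᵐ ω ∂μ, xhatLoc P g μ i t ω =
      minorPart i (commonState P uc t ω) + (localDrift i (ul i) t ω + p i t ω) := by
  filter_upwards [hd.xhatMinor_ae hP hp i ht] with ω hω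
  funext a
  rw [xhatLoc, hω]
  simp [minorEstimate, minorStack, minorPart]

end IsDecomposition

theorem IsFreeEstimate.xhatLoc_ae (hP : P.Admissible μ N S) (hp : IsFreeEstimate P μ N p)
    (g : M.AffineStrategy) (i : Fin n) {t : ℕ} (ht : t ≤ N) :
    ∀ᵐ ω ∂μ, xhatLoc P g μ i t ω = x P g i t ω - (freeState P i t ω - p i t ω) := by
  obtain ⟨uc, ul, hd⟩ := exists_isDecomposition P g
  filter_upwards [hd.xhatLoc_ae hP hp i ht] with ω hω
  rw [hω, hd.x_eq, localState]
  abel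

end Estimation

/-! ### The Kalman filter -/

section PriorCov

variable {n : ℕ} {M : Model n} (S : M.Covariances) (i : Fin n)

/-- The covariance of the error of the prediction of `x_i(t)` before `y_i(t)` is observed. -/
def priorCov : ℕ → Matrix (Fin (M.dx i)) (Fin (M.dx i)) ℝ
  | 0 => S.x i
  | t + 1 => M.A₁₁ i * Model.errorCov S i t * (M.A₁₁ i)ᵀ + S.w i

theorem filterInnovationCov_eq (t : ℕ) :
    Model.filterInnovationCov S i t = M.C i * priorCov S i t * (M.C i)ᵀ + S.v i := by
  cases t <;> simp only [Model.filterInnovationCov, innovationCov, priorCov, Matrix.mul_zero,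
    Matrix.zero_mul, zero_add, Matrix.mul_add, Matrix.add_mul, Matrix.mul_assoc]

theorem filterGain_eq (t : ℕ) : Model.filterGain S i t =
    priorCov S i t * (M.C i)ᵀ * (Model.filterInnovationCov S i t)⁻¹ := by
  cases t <;> simp only [Model.filterGain, Model.filterInnovationCov, kalmanGain, priorCov,
    Matrix.mul_zero, Matrix.zero_mul, zero_add, Matrix.add_mul]

theorem errorCov_eq (t : ℕ) : Model.errorCov S i t = priorCov S i t -
    Model.filterGain S i t * Model.filterInnovationCov S i t * (Model.filterGain S i t)ᵀ := by
  cases t <;> simp only [Model.errorCov, kalmanCov, Model.filterGain, Model.filterInnovationCov,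
    priorCov, Matrix.mul_zero, Matrix.zero_mul, zero_add]

theorem filterGain_mul {t : ℕ} (hu : IsUnit (Model.filterInnovationCov S i t)) :
    Model.filterGain S i t * Model.filterInnovationCov S i t = priorCov S i t * (M.C i)ᵀ := by
  rw [filterGain_eq, Matrix.mul_assoc, Matrix.nonsing_inv_mul _ ((isUnit_iff_isUnit_det _).1 hu),
    Matrix.mul_one]

end PriorCov

section Kalman

variable {n : ℕ} {M : Model n} {Ω : Type*} (P : Primitives M Ω)
  (p : ∀ i : Fin n, ℕ → Ω → Fin (M.dx i) → ℝ) (i : Fin n)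

/-- The linear functions of the free outputs before time `t`. -/
def priorSpace : ℕ → Submodule ℝ (Ω → ℝ)
  | 0 => ⊥
  | t + 1 => localSpace P i t

/-- The prediction of the free state at time `t` from the free outputs before time `t`. -/
def freePrediction : ℕ → Ω → Fin (M.dx i) → ℝ
  | 0 => fun _ => 0
  | t + 1 => fun ω => M.A₁₁ i *ᵥ p i t ω

/-- The error of the prediction of the free state. -/
def predictionError (t : ℕ) (ω : Ω) : Fin (M.dx i) → ℝ :=
  freeState P i t ω - freePrediction p i t ω

/-- The error of the prediction of the free output. -/
def innovation (t : ℕ) (ω : Ω) : Fin (M.dy i) → ℝ :=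
  M.C i *ᵥ predictionError P p i t ω + P.v i t ω

theorem predictionError_zero : predictionError P p i 0 = P.x i :=
  funext fun _ => sub_zero _

theorem predictionError_succ (t : ℕ) : predictionError P p i (t + 1) =
    fun ω => M.A₁₁ i *ᵥ (freeState P i t ω - p i t ω) + P.w i t ω := by
  funext ω
  simp only [predictionError, freeState, freePrediction, mulVec_sub]
  abel

theorem innovation_eq (t : ℕ) (ω : Ω) :
    innovation P p i t ω = freeOutput P i t ω - M.C i *ᵥ freePrediction p i t ω := by
  rw [innovation, predictionError, freeOutput, mulVec_sub]
  abel

theorem priorSpace_le_localSpace (t : ℕ) : priorSpace P i t ≤ localSpace P i t := by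
  cases t with
  | zero => exact bot_le
  | succ t => exact localSpace_mono P i t.le_succ

variable {P p i} in
theorem localSpace_eq_sup_componentSpan_innovation {t : ℕ}
    (hmem : VecMem (priorSpace P i t) (freePrediction p i t)) :
    localSpace P i t = priorSpace P i t ⊔ componentSpan (innovation P p i t) := by
  have hpred := hmem.mulVec (M.C i)
  refine le_antisymm (localSpace_le fun s hs => ?_)
    (sup_le (priorSpace_le_localSpace P i t) (componentSpan_le ?_))
  · rcases hs.eq_or_lt with rfl | hst
    · have hsum : freeOutput P i s =
          fun ω => M.C i *ᵥ freePrediction p i s ω + innovation P p i s ω := by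
        simp only [innovation_eq, add_sub_cancel]
      rw [hsum]
      exact (hpred.mono le_sup_left).add ((vecMem_componentSpan _).mono le_sup_right)
    · obtain ⟨r, rfl⟩ := Nat.exists_eq_add_of_lt hst
      exact (vecMem_localSpace P i (by omega)).mono le_sup_left
  · rw [funext (innovation_eq P p i t)]
    exact (vecMem_localSpace P i le_rfl).sub (hpred.mono (priorSpace_le_localSpace P i t))

variable {P p i} {N : ℕ}

theorem localIdx_subset_ne_v {s t : ℕ} (hst : s < t) (ht : t ≤ N) :
    localIdx N i s ⊆ {.v i ⟨t, Nat.lt_succ_of_le ht⟩}ᶜ := by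
  rintro k hk rfl
  exact hst.not_ge hk.2

theorem w_notMem_localIdx {t : ℕ} (ht : t ≤ N) :
    .w i ⟨t, Nat.lt_succ_of_le ht⟩ ∉ localIdx N i t :=
  fun h => lt_irrefl t h.2

theorem vecMem_w {t : ℕ} (ht : t ≤ N) :
    VecMem (primSpace P N {.w i ⟨t, Nat.lt_succ_of_le ht⟩}) (P.w i t) :=
  vecMem_primSpace P (k := .w i ⟨t, Nat.lt_succ_of_le ht⟩) rfl

theorem vecMem_v {t : ℕ} (ht : t ≤ N) :
    VecMem (primSpace P N {.v i ⟨t, Nat.lt_succ_of_le ht⟩}) (P.v i t) :=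
  vecMem_primSpace P (k := .v i ⟨t, Nat.lt_succ_of_le ht⟩) rfl

theorem priorSpace_le_primSpace {t : ℕ} (ht : t ≤ N) :
    priorSpace P i t ≤ primSpace P N {.v i ⟨t, Nat.lt_succ_of_le ht⟩}ᶜ := by
  cases t with
  | zero => exact bot_le
  | succ t =>
    exact (localSpace_le_primSpace P i (by omega)).trans
      (primSpace_mono P (localIdx_subset_ne_v t.lt_succ_self ht))

variable [MeasurableSpace Ω] {μ : Measure Ω} {S : M.Covariances}

theorem IsFreeEstimate.vecMem_predictionError (hp : IsFreeEstimate P μ N p) {t : ℕ}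
    (ht : t ≤ N) :
    VecMem (primSpace P N {.v i ⟨t, Nat.lt_succ_of_le ht⟩}ᶜ) (predictionError P p i t) := by
  cases t with
  | zero =>
    rw [predictionError_zero]
    exact vecMem_primSpace P (k := .x i) (by simp)
  | succ t =>
    rw [predictionError_succ]
    exact (((hp.vecMem_error i (by omega)).mono
      (primSpace_mono P (localIdx_subset_ne_v t.lt_succ_self ht))).mulVec _).add
      (vecMem_primSpace P (k := .w i ⟨t, by omega⟩) (by simp))

variable [IsProbabilityMeasure μ]

namespace Primitives.Admissible

theorem orthogonal_primSpace_singleton (hP : P.Admissible μ N S) {k : PrimIdx n N}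
    {K : Set (PrimIdx n N)} (hk : k ∉ K) : Orthogonal μ (primSpace P N {k}) (primSpace P N K) :=
  hP.orthogonal_primSpace (Set.disjoint_singleton_left.2 hk)

theorem moment_x (hP : P.Admissible μ N S) : moment μ (P.x i) (P.x i) = S.x i :=
  (covMatrix_eq_moment (hP.vecMem_centred_var (.x i))).symm.trans (hP.cov_x i)

theorem moment_w (hP : P.Admissible μ N S) {t : ℕ} (ht : t ≤ N) :
    moment μ (P.w i t) (P.w i t) = S.w i :=
  (covMatrix_eq_moment (hP.vecMem_centred_var (.w i ⟨t, Nat.lt_succ_of_le ht⟩))).symm.trans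
    (hP.cov_w i t ht)

theorem moment_v (hP : P.Admissible μ N S) {t : ℕ} (ht : t ≤ N) :
    moment μ (P.v i t) (P.v i t) = S.v i :=
  (covMatrix_eq_moment (hP.vecMem_centred_var (.v i ⟨t, Nat.lt_succ_of_le ht⟩))).symm.trans
    (hP.cov_v i t ht)

theorem filterGain_mul_moment (hP : P.Admissible μ N S) {t : ℕ} (ht : t ≤ N)
    (hprior : moment μ (predictionError P p i t) (predictionError P p i t) = priorCov S i t)
    (hu : IsUnit (Model.filterInnovationCov S i t)) :
    Model.filterGain S i t * (M.C i * moment μ (predictionError P p i t) (predictionError P p i t) *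
      (M.C i)ᵀ + moment μ (P.v i t) (P.v i t)) =
        moment μ (predictionError P p i t) (predictionError P p i t) * (M.C i)ᵀ := by
  rw [hprior, hP.moment_v ht, ← filterInnovationCov_eq, filterGain_mul S i hu]

end Primitives.Admissible

namespace IsFreeEstimate

theorem isProjection_freePrediction (hP : P.Admissible μ N S) (hp : IsFreeEstimate P μ N p)
    {t : ℕ} (ht : t ≤ N) :
    IsProjection μ (priorSpace P i t) (freeState P i t) (freePrediction p i t) := by
  cases t with
  | zero =>
    refine ⟨.zero, fun a h hh => ?_⟩
    rw [(Submodule.mem_bot ℝ).1 hh]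
    simp
  | succ t =>
    have htN : t ≤ N := by omega
    have hlocal := localSpace_le_primSpace P i htN
    exact (hp.isProjection i htN).mulVec_add (M.A₁₁ i)
      ((vecMem_freeState P i htN).mono (hP.primSpace_le_squareIntegrable _))
      (hP.localSpace_le_squareIntegrable i htN)
      ((vecMem_w htN).mono (hP.primSpace_le_squareIntegrable _)) (vecMem_w htN)
      ((hP.orthogonal_primSpace_singleton (w_notMem_localIdx htN)).mono le_rfl hlocal)

theorem isProjection_freeOutput (hP : P.Admissible μ N S) (hp : IsFreeEstimate P μ N p)
    {t : ℕ} (ht : t ≤ N) :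
    IsProjection μ (priorSpace P i t) (freeOutput P i t)
      fun ω => M.C i *ᵥ freePrediction p i t ω :=
  (hp.isProjection_freePrediction hP ht).mulVec_add (M.C i)
    ((vecMem_freeState P i ht).mono (hP.primSpace_le_squareIntegrable _))
    ((priorSpace_le_primSpace ht).trans (hP.primSpace_le_squareIntegrable _))
    ((vecMem_v ht).mono (hP.primSpace_le_squareIntegrable _)) (vecMem_v ht)
    ((hP.orthogonal_primSpace disjoint_compl_right).mono le_rfl (priorSpace_le_primSpace ht))

theorem orthogonal_innovation (hP : P.Admissible μ N S) (hp : IsFreeEstimate P μ N p)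
    {t : ℕ} (ht : t ≤ N) :
    Orthogonal μ (componentSpan (innovation P p i t)) (priorSpace P i t) := by
  rw [funext (innovation_eq P p i t)]
  exact (hp.isProjection_freeOutput hP ht).orthogonal_componentSpan_error
    ((priorSpace_le_primSpace ht).trans (hP.primSpace_le_squareIntegrable _))
    ((vecMem_localSpace P i le_rfl).mono (hP.localSpace_le_squareIntegrable i ht))

theorem moment_predictionError_v (hP : P.Admissible μ N S) (hp : IsFreeEstimate P μ N p) {t : ℕ}
    (ht : t ≤ N) : moment μ (predictionError P p i t) (P.v i t) = 0 :=
  (hP.orthogonal_primSpace disjoint_compl_left).moment_eq_zero (hp.vecMem_predictionError ht)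
    (vecMem_v ht)

variable {K : Matrix (Fin (M.dx i)) (Fin (M.dy i)) ℝ}

theorem isProjection_update (hP : P.Admissible μ N S) (hp : IsFreeEstimate P μ N p) {t : ℕ}
    (ht : t ≤ N) (hK : K * (M.C i * moment μ (predictionError P p i t) (predictionError P p i t) *
      (M.C i)ᵀ + moment μ (P.v i t) (P.v i t)) =
        moment μ (predictionError P p i t) (predictionError P p i t) * (M.C i)ᵀ) :
    IsProjection μ (localSpace P i t) (freeState P i t)
      fun ω => freePrediction p i t ω + K *ᵥ innovation P p i t ω := by
  have hξ := (hp.vecMem_predictionError (i := i) ht).mono (hP.primSpace_le_squareIntegrable _)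
  have hv := (vecMem_v (P := P) (i := i) ht).mono (hP.primSpace_le_squareIntegrable _)
  have hν : VecMem (squareIntegrable μ) (innovation P p i t) := (hξ.mulVec _).add hv
  have hpred := hp.isProjection_freePrediction (i := i) hP ht
  have hinnov : IsProjection μ (componentSpan (innovation P p i t)) (predictionError P p i t)
      fun ω => K *ᵥ innovation P p i t ω :=
    .mulVec_of_moment_eq_zero hξ hν
      (moment_filterError_observation hξ hv (hp.moment_predictionError_v hP ht) hK)
  rw [localSpace_eq_sup_componentSpan_innovation hpred.mem]
  exact hpred.sup_add hinnov
    ((vecMem_freeState P i ht).mono (hP.primSpace_le_squareIntegrable _))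
    ((priorSpace_le_primSpace ht).trans (hP.primSpace_le_squareIntegrable _))
    (componentSpan_le hν) (hp.orthogonal_innovation hP ht)

theorem error_ae_of_gain (hP : P.Admissible μ N S) (hp : IsFreeEstimate P μ N p) {t : ℕ}
    (ht : t ≤ N) (hK : K * (M.C i * moment μ (predictionError P p i t) (predictionError P p i t) *
      (M.C i)ᵀ + moment μ (P.v i t) (P.v i t)) =
        moment μ (predictionError P p i t) (predictionError P p i t) * (M.C i)ᵀ) :
    ∀ᵐ ω ∂μ, freeState P i t ω - p i t ω =
      predictionError P p i t ω - K *ᵥ innovation P p i t ω := by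
  filter_upwards [(hp.isProjection i ht).ae_eq (hp.isProjection_update hP ht hK)
    (hP.localSpace_le_squareIntegrable i ht)
    ((vecMem_freeState P i ht).mono (hP.primSpace_le_squareIntegrable _))] with ω hω
  rw [hω, predictionError, sub_sub]

theorem moment_error_of_prior (hP : P.Admissible μ N S) (hp : IsFreeEstimate P μ N p) {t : ℕ}
    (ht : t ≤ N)
    (hprior : moment μ (predictionError P p i t) (predictionError P p i t) = priorCov S i t)
    (hu : IsUnit (Model.filterInnovationCov S i t)) :
    moment μ (fun ω => freeState P i t ω - p i t ω) (fun ω => freeState P i t ω - p i t ω) =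
      Model.errorCov S i t := by
  have hK := hP.filterGain_mul_moment ht hprior hu
  rw [moment_congr (hp.error_ae_of_gain hP ht hK), errorCov_eq, filterInnovationCov_eq, ← hprior,
    ← hP.moment_v ht]
  exact moment_filterError
    ((hp.vecMem_predictionError ht).mono (hP.primSpace_le_squareIntegrable _))
    ((vecMem_v ht).mono (hP.primSpace_le_squareIntegrable _)) (hp.moment_predictionError_v hP ht) hK

theorem moment_predictionError_succ (hP : P.Admissible μ N S) (hp : IsFreeEstimate P μ N p)
    {t : ℕ} (ht : t ≤ N) :
    moment μ (predictionError P p i (t + 1)) (predictionError P p i (t + 1)) =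
      M.A₁₁ i * moment μ (fun ω => freeState P i t ω - p i t ω)
        (fun ω => freeState P i t ω - p i t ω) * (M.A₁₁ i)ᵀ + S.w i := by
  have herror := hp.vecMem_error i ht
  have hwerror := (hP.orthogonal_primSpace_singleton (w_notMem_localIdx ht)).moment_eq_zero
    (vecMem_w ht) herror
  have he := herror.mono (hP.primSpace_le_squareIntegrable _)
  have hw := (vecMem_w (P := P) (i := i) ht).mono (hP.primSpace_le_squareIntegrable _)
  rw [predictionError_succ, moment_observation_observation he hw (moment_eq_zero_comm.1 hwerror),
    hP.moment_w ht]

theorem moment_predictionError (hP : P.Admissible μ N S) (hp : IsFreeEstimate P μ N p) {t : ℕ}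
    (ht : t ≤ N) (hu : ∀ s < t, IsUnit (Model.filterInnovationCov S i s)) :
    moment μ (predictionError P p i t) (predictionError P p i t) = priorCov S i t := by
  induction t with
  | zero =>
    rw [predictionError_zero]
    exact hP.moment_x
  | succ t ih =>
    have hprior := ih (by omega) fun s hs => hu s (by omega)
    rw [hp.moment_predictionError_succ hP (by omega),
      hp.moment_error_of_prior hP (by omega) hprior (hu t t.lt_succ_self), priorCov]

theorem moment_error (hP : P.Admissible μ N S) (hp : IsFreeEstimate P μ N p) {t : ℕ}
    (ht : t ≤ N) (hu : ∀ s ≤ t, IsUnit (Model.filterInnovationCov S i s)) :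
    moment μ (fun ω => freeState P i t ω - p i t ω) (fun ω => freeState P i t ω - p i t ω) =
      Model.errorCov S i t :=
  hp.moment_error_of_prior hP ht (hp.moment_predictionError hP ht fun s hs => hu s hs.le)
    (hu t le_rfl)

theorem error_ae (hP : P.Admissible μ N S) (hp : IsFreeEstimate P μ N p) {t : ℕ}
    (ht : t ≤ N) (hu : ∀ s ≤ t, IsUnit (Model.filterInnovationCov S i s)) :
    ∀ᵐ ω ∂μ, freeState P i t ω - p i t ω =
      predictionError P p i t ω - Model.filterGain S i t *ᵥ innovation P p i t ω :=
  hp.error_ae_of_gain hP ht (hP.filterGain_mul_moment ht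
    (hp.moment_predictionError hP ht fun s hs => hu s hs.le) (hu t le_rfl))

end IsFreeEstimate

end Kalman

/-! ### Completion of squares in the cost -/

section Riccati

variable {n : ℕ} {M : Model n}

theorem riccatiCom_posSemidef (hQ : M.Q.PosSemidef) (hQT : M.QT.PosSemidef) (hR : M.R.PosDef)
    (k : ℕ) : (M.riccatiCom k).PosSemidef := by
  induction k with
  | zero => exact hQT
  | succ k ih => exact riccati_posSemidef ih hQ hR _ _

theorem Rblock_posDef (hR : M.R.PosDef) (i : Fin n) : (M.Rblock i).PosDef :=
  hR.submatrix (Sum.inr_injective.comp sigma_mk_injective)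

theorem riccatiLoc_posSemidef (hQ : M.Q.PosSemidef) (hQT : M.QT.PosSemidef) (hR : M.R.PosDef)
    (i : Fin n) (k : ℕ) : (M.riccatiLoc i k).PosSemidef := by
  induction k with
  | zero => exact hQT.submatrix _
  | succ k ih => exact riccati_posSemidef ih (hQ.submatrix _) (Rblock_posDef hR i) _ _

/-- The weight of the common deviation at time `t`. -/
def commonWeight (M : Model n) (N t : ℕ) : Matrix M.ControlIdx M.ControlIdx ℝ :=
  M.R + M.Bᵀ * M.riccatiCom (N - (t + 1)) * M.B

/-- The weight of the local deviation at time `t`. -/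
def localWeight (M : Model n) (N : ℕ) (i : Fin n) (t : ℕ) :
    Matrix (Fin (M.du i)) (Fin (M.du i)) ℝ :=
  M.Rblock i + (M.B₁₁ i)ᵀ * M.riccatiLoc i (N - (t + 1)) * M.B₁₁ i

theorem commonWeight_posDef (hQ : M.Q.PosSemidef) (hQT : M.QT.PosSemidef) (hR : M.R.PosDef)
    (N t : ℕ) : (commonWeight M N t).PosDef :=
  posDef_add_conj (riccatiCom_posSemidef hQ hQT hR _) hR _

theorem localWeight_posDef (hQ : M.Q.PosSemidef) (hQT : M.QT.PosSemidef) (hR : M.R.PosDef)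
    (N : ℕ) (i : Fin n) (t : ℕ) : (localWeight M N i t).PosDef :=
  posDef_add_conj (riccatiLoc_posSemidef hQ hQT hR i _) (Rblock_posDef hR i) _

end Riccati

section CostDefs

variable {n : ℕ} {M : Model n} {Ω : Type*} (P : Primitives M Ω)
  (p : ∀ i : Fin n, ℕ → Ω → Fin (M.dx i) → ℝ) (N : ℕ)
  (uc : ℕ → Ω → M.ControlIdx → ℝ) (ul : ∀ i : Fin n, ℕ → Ω → Fin (M.du i) → ℝ)

/-- The deviation of the common part of the controls from certainty equivalence. -/
def commonDeviation (t : ℕ) (ω : Ω) : M.ControlIdx → ℝ :=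
  uc t ω + M.gainCom N t *ᵥ commonState P uc t ω

/-- The deviation of the local part of the controls from certainty equivalence. -/
def localDeviation (i : Fin n) (t : ℕ) (ω : Ω) : Fin (M.du i) → ℝ :=
  ul i t ω + M.gainLoc N i t *ᵥ (localDrift i (ul i) t ω + p i t ω)

variable {P uc ul} {g : M.AffineStrategy}

namespace IsDecomposition

theorem vecMem_commonDeviation (hd : IsDecomposition P g uc ul) (t : ℕ) :
    VecMem (commonSpace P t) (commonDeviation P N uc t) :=
  (hd.common_mem t).add ((vecMem_commonState hd.common_mem t).mulVec _)

variable {N} in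
theorem vecMem_primSpace_local (hd : IsDecomposition P g uc ul) (i : Fin n) {t : ℕ} (ht : t ≤ N) :
    VecMem (primSpace P N (localIdx N i t)) (ul i t) :=
  (hd.local_mem i t).mono (localSpace_le_primSpace P i ht)

end IsDecomposition

variable (P uc ul) [MeasurableSpace Ω] (μ : Measure Ω)

/-- The expected cost of the common parts of state and control. -/
def commonCost : ℝ :=
  (∑ t ∈ Finset.range N, (quadForm μ M.Q (commonState P uc t) + quadForm μ M.R (uc t))) +
    quadForm μ M.QT (commonState P uc N)

/-- The expected cost of the local parts of state and control of a minor agent. -/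
def localCost (i : Fin n) : ℝ :=
  (∑ t ∈ Finset.range N,
    (quadForm μ (M.Qblock i) (localState P i (ul i) t) + quadForm μ (M.Rblock i) (ul i t))) +
    quadForm μ (M.QTblock i) (localState P i (ul i) N)

/-- The part of the common cost that no strategy can avoid. -/
def minimalCommonCost : ℝ :=
  quadForm μ (M.riccatiCom N) (fun ω => Sum.elim (P.x₀ ω) 0) +
    ∑ t ∈ Finset.range N,
      quadForm μ (M.riccatiCom (N - (t + 1))) (fun ω => Sum.elim (P.w₀ t ω) 0)

/-- The part of the local cost that no strategy can avoid; the last sum is the price of observing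
the state only partially. -/
def minimalLocalCost (i : Fin n) : ℝ :=
  (quadForm μ (M.riccatiLoc i N) (P.x i) +
    ∑ t ∈ Finset.range N, quadForm μ (M.riccatiLoc i (N - (t + 1))) (P.w i t)) +
    ∑ t ∈ Finset.range N, quadForm μ (localWeight M N i t)
      (fun ω => M.gainLoc N i t *ᵥ (freeState P i t ω - p i t ω))

/-- The part of the cost that is due to deviations from certainty equivalence. -/
def costGap : ℝ :=
  ∑ t ∈ Finset.range N, (quadForm μ (commonWeight M N t) (commonDeviation P N uc t) +
    ∑ i, quadForm μ (localWeight M N i t) (localDeviation p N ul i t))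

/-- The controls are certainty equivalent at the times `0, …, N - 1`. -/
def IsCertaintyEquivalent : Prop :=
  ∀ t < N, (∀ᵐ ω ∂μ, commonDeviation P N uc t ω = 0) ∧
    ∀ i, ∀ᵐ ω ∂μ, localDeviation p N ul i t ω = 0

end CostDefs

section Cost

variable {n N : ℕ} {M : Model n} {Ω : Type*} [MeasurableSpace Ω] {μ : Measure Ω}
  {P : Primitives M Ω} {S : M.Covariances} {p : ∀ i : Fin n, ℕ → Ω → Fin (M.dx i) → ℝ}
  {g : M.AffineStrategy} {uc : ℕ → Ω → M.ControlIdx → ℝ}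
  {ul : ∀ i : Fin n, ℕ → Ω → Fin (M.du i) → ℝ}

theorem cost_eq_sum_quadForm (hx : ∀ t ≤ N, VecMem (squareIntegrable μ) (state P g t))
    (hu : ∀ t < N, VecMem (squareIntegrable μ) (control P g t)) :
    cost P g μ N =
      (∑ t ∈ Finset.range N, (quadForm μ M.Q (state P g t) + quadForm μ M.R (control P g t))) +
        quadForm μ M.QT (state P g N) := by
  have hstate : ∀ t ∈ Finset.range N,
      Integrable (fun ω => state P g t ω ⬝ᵥ M.Q *ᵥ state P g t ω) μ :=
    fun t ht => integrable_quadForm (hx t (Finset.mem_range.1 ht).le) M.Q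
  have hcontrol : ∀ t ∈ Finset.range N,
      Integrable (fun ω => control P g t ω ⬝ᵥ M.R *ᵥ control P g t ω) μ :=
    fun t ht => integrable_quadForm (hu t (Finset.mem_range.1 ht)) M.R
  have hrunning : ∀ t ∈ Finset.range N,
      Integrable (fun ω => state P g t ω ⬝ᵥ M.Q *ᵥ state P g t ω +
        control P g t ω ⬝ᵥ M.R *ᵥ control P g t ω) μ :=
    fun t ht => (hstate t ht).add (hcontrol t ht)
  calc cost P g μ N
    _ = (∫ ω, ∑ t ∈ Finset.range N, (state P g t ω ⬝ᵥ M.Q *ᵥ state P g t ω +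
          control P g t ω ⬝ᵥ M.R *ᵥ control P g t ω) ∂μ) + quadForm μ M.QT (state P g N) :=
      integral_add (integrable_finsetSum _ hrunning) (integrable_quadForm (hx N le_rfl) M.QT)
    _ = _ := by
      rw [integral_finsetSum _ hrunning]
      exact congrArg (· + _)
        (Finset.sum_congr rfl fun t ht => integral_add (hstate t ht) (hcontrol t ht))

namespace IsDecomposition

theorem vecMem_localDeviation (hd : IsDecomposition P g uc ul) (hp : IsFreeEstimate P μ N p)
    (i : Fin n) (t : ℕ) : VecMem (localSpace P i t) (localDeviation p N ul i t) :=
  (hd.local_mem i t).add (((vecMem_localDrift (hd.local_mem i) t).add (hp.mem i t)).mulVec _)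

variable [IsProbabilityMeasure μ]

theorem vecMem_control (hP : P.Admissible μ N S) (hd : IsDecomposition P g uc ul) {t : ℕ}
    (ht : t ≤ N) : VecMem (squareIntegrable μ) (control P g t) := by
  rw [funext (hd.control_eq t)]
  exact ((hd.common_mem t).mono (hP.commonSpace_le_squareIntegrable (by omega))).add
    (VecMem.minorStack fun i =>
      (hd.local_mem i t).mono (hP.localSpace_le_squareIntegrable i ht))

theorem quadForm_state (hP : P.Admissible μ N S) (hd : IsDecomposition P g uc ul) {t : ℕ}
    (ht : t ≤ N) (Q : Matrix M.StateIdx M.StateIdx ℝ) :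
    quadForm μ Q (state P g t) = quadForm μ Q (commonState P uc t) +
      ∑ i, quadForm μ (Q.submatrix (fun a => Sum.inr ⟨i, a⟩) fun a => Sum.inr ⟨i, a⟩)
        (localState P i (ul i) t) := by
  have hcommon := vecMem_commonState hd.common_mem t
  have hlocal := fun i => hd.vecMem_localState i ht
  rw [funext (hd.state_eq t)]
  exact quadForm_add_minorStack
    (hcommon.mono (hP.commonSpace_le_squareIntegrable (by omega)))
    (fun i => (hlocal i).mono (hP.primSpace_le_squareIntegrable _))
    (fun i => (hP.orthogonal_commonSpace_primSpace_localIdx (by omega) i).moment_eq_zero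
      hcommon (hlocal i))
    (fun i j hij => (hP.orthogonal_primSpace (disjoint_localIdx hij t t)).moment_eq_zero
      (hlocal i) (hlocal j)) Q

theorem quadForm_control (hP : P.Admissible μ N S) (hd : IsDecomposition P g uc ul) {t : ℕ}
    (ht : t ≤ N) :
    quadForm μ M.R (control P g t) =
      quadForm μ M.R (uc t) + ∑ i, quadForm μ (M.Rblock i) (ul i t) := by
  have hlocal := fun i => hd.vecMem_primSpace_local i ht
  rw [funext (hd.control_eq t)]
  exact quadForm_add_minorStack
    ((hd.common_mem t).mono (hP.commonSpace_le_squareIntegrable (by omega)))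
    (fun i => (hlocal i).mono (hP.primSpace_le_squareIntegrable _))
    (fun i => (hP.orthogonal_commonSpace_primSpace_localIdx (by omega) i).moment_eq_zero
      (hd.common_mem t) (hlocal i))
    (fun i j hij => (hP.orthogonal_primSpace (disjoint_localIdx hij t t)).moment_eq_zero
      (hlocal i) (hlocal j)) M.R

theorem cost_eq_commonCost_add_sum_localCost (hP : P.Admissible μ N S)
    (hd : IsDecomposition P g uc ul) :
    cost P g μ N = commonCost P N uc μ + ∑ i, localCost P N ul μ i := by
  have hrunning : ∀ t ∈ Finset.range N,
      quadForm μ M.Q (state P g t) + quadForm μ M.R (control P g t) =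
        (quadForm μ M.Q (commonState P uc t) + quadForm μ M.R (uc t)) +
          ∑ i, (quadForm μ (M.Qblock i) (localState P i (ul i) t) +
            quadForm μ (M.Rblock i) (ul i t)) := fun t ht => by
    have ht := (Finset.mem_range.1 ht).le
    rw [hd.quadForm_state hP ht, hd.quadForm_control hP ht, add_add_add_comm,
      ← Finset.sum_add_distrib]
    rfl
  simp only [commonCost, localCost]
  rw [cost_eq_sum_quadForm (fun t ht => hd.vecMem_state hP ht)
    (fun t ht => hd.vecMem_control hP ht.le), Finset.sum_congr rfl hrunning,
    hd.quadForm_state hP le_rfl, Finset.sum_add_distrib, Finset.sum_add_distrib (s := Finset.univ),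
    Finset.sum_comm, add_add_add_comm]
  rfl

theorem commonCost_eq (hP : P.Admissible μ N S) (hQ : M.Q.PosSemidef)
    (hQT : M.QT.PosSemidef) (hR : M.R.PosDef) (hd : IsDecomposition P g uc ul) :
    commonCost P N uc μ = minimalCommonCost P N μ +
      ∑ t ∈ Finset.range N, quadForm μ (commonWeight M N t) (commonDeviation P N uc t) := by
  have hw {t : ℕ} (ht : t < N) : VecMem (primSpace P N {.w₀ ⟨t, ht.trans N.lt_succ_self⟩})
      (fun ω => (Sum.elim (P.w₀ t ω) 0 : M.StateIdx → ℝ)) :=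
    VecMem.sumElim (vecMem_primSpace P (k := .w₀ ⟨t, ht.trans N.lt_succ_self⟩) rfl) VecMem.zero
  have horth {t : ℕ} (ht : t < N) :
      Orthogonal μ (commonSpace P t) (primSpace P N {.w₀ ⟨t, ht.trans N.lt_succ_self⟩}) :=
    hP.orthogonal_commonSpace_primSpace (by omega)
      (Set.disjoint_singleton_right.2 fun h => lt_irrefl t h)
  have hx := vecMem_commonState hd.common_mem
  exact sum_quadForm_eq hR (riccatiCom_posSemidef hQ hQT hR) (fun _ => rfl)
    (fun t ht => (hx t).mono (hP.commonSpace_le_squareIntegrable (by omega)))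
    (fun t ht => (hd.common_mem t).mono (hP.commonSpace_le_squareIntegrable (by omega)))
    (fun t ht => (hw ht).mono (hP.primSpace_le_squareIntegrable _)) (fun _ _ => rfl)
    (fun t ht => (horth ht).moment_eq_zero (hx t) (hw ht))
    (fun t ht => (horth ht).moment_eq_zero (hd.common_mem t) (hw ht))

theorem quadForm_add_gainLoc_mulVec_localState (hP : P.Admissible μ N S)
    (hd : IsDecomposition P g uc ul) (hp : IsFreeEstimate P μ N p) (i : Fin n) {t : ℕ} (ht : t ≤ N)
    (W : Matrix (Fin (M.du i)) (Fin (M.du i)) ℝ) :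
    quadForm μ W (fun ω => ul i t ω + M.gainLoc N i t *ᵥ localState P i (ul i) t ω) =
      quadForm μ W (fun ω => M.gainLoc N i t *ᵥ (freeState P i t ω - p i t ω)) +
        quadForm μ W (localDeviation p N ul i t) := by
  have herror := (hp.vecMem_error i ht).mono (hP.primSpace_le_squareIntegrable _)
  have hdev := hd.vecMem_localDeviation hp i t
  have hdev' := hdev.mono (hP.localSpace_le_squareIntegrable i ht)
  have horth : moment μ (fun ω => M.gainLoc N i t *ᵥ (freeState P i t ω - p i t ω))
      (localDeviation p N ul i t) = 0 := by
    rw [moment_mulVec_left herror hdev', (hp.isProjection i ht).moment_error_eq_zero hdev,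
      Matrix.mul_zero]
  rw [← quadForm_add (herror.mulVec _) hdev' horth]
  refine congrArg _ (funext fun ω => ?_)
  rw [localDeviation, localState, add_left_comm, ← mulVec_add, add_comm (_ - _),
    add_add_sub_cancel]

theorem localCost_eq (hP : P.Admissible μ N S) (hQ : M.Q.PosSemidef)
    (hQT : M.QT.PosSemidef) (hR : M.R.PosDef) (hd : IsDecomposition P g uc ul)
    (hp : IsFreeEstimate P μ N p) (i : Fin n) :
    localCost P N ul μ i = minimalLocalCost P p N μ i +
      ∑ t ∈ Finset.range N, quadForm μ (localWeight M N i t) (localDeviation p N ul i t) := by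
  have hx {t : ℕ} (ht : t < N) := hd.vecMem_localState i ht.le
  have hu {t : ℕ} (ht : t < N) := hd.vecMem_primSpace_local i ht.le
  have hw {t : ℕ} (ht : t < N) := vecMem_w (P := P) (i := i) ht.le
  have horth {t : ℕ} (ht : t < N) :=
    (hP.orthogonal_primSpace_singleton (w_notMem_localIdx (i := i) ht.le)).symm
  have hsquares := sum_quadForm_eq (Rblock_posDef hR i) (riccatiLoc_posSemidef hQ hQT hR i)
    (fun _ => rfl)
    (fun t ht => (hx ht).mono (hP.primSpace_le_squareIntegrable _))
    (fun t ht => (hu ht).mono (hP.primSpace_le_squareIntegrable _))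
    (fun t ht => (hw ht).mono (hP.primSpace_le_squareIntegrable _))
    (fun t _ => localState_succ P i (ul i) t)
    (fun t ht => (horth ht).moment_eq_zero (hx ht) (hw ht))
    (fun t ht => (horth ht).moment_eq_zero (hu ht) (hw ht))
  rw [minimalLocalCost, add_assoc (_ + _), ← Finset.sum_add_distrib, ← localState_zero P i (ul i)]
  refine hsquares.trans (congrArg₂ _ rfl (Finset.sum_congr rfl fun t ht => ?_))
  exact hd.quadForm_add_gainLoc_mulVec_localState hP hp i (Finset.mem_range.1 ht).le _

theorem cost_eq (hP : P.Admissible μ N S) (hQ : M.Q.PosSemidef)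
    (hQT : M.QT.PosSemidef) (hR : M.R.PosDef) (hd : IsDecomposition P g uc ul)
    (hp : IsFreeEstimate P μ N p) :
    cost P g μ N = (minimalCommonCost P N μ + ∑ i, minimalLocalCost P p N μ i) +
      costGap P p N uc ul μ := by
  rw [hd.cost_eq_commonCost_add_sum_localCost hP, hd.commonCost_eq hP hQ hQT hR,
    Finset.sum_congr rfl fun i _ => hd.localCost_eq hP hQ hQT hR hp i, Finset.sum_add_distrib,
    costGap, Finset.sum_add_distrib, Finset.sum_comm (s := Finset.range N), add_add_add_comm]

theorem costGap_eq_zero_iff (hP : P.Admissible μ N S) (hQ : M.Q.PosSemidef)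
    (hQT : M.QT.PosSemidef) (hR : M.R.PosDef) (hd : IsDecomposition P g uc ul)
    (hp : IsFreeEstimate P μ N p) :
    costGap P p N uc ul μ = 0 ↔ IsCertaintyEquivalent P p N uc ul μ := by
  have hcommon (t : ℕ) : 0 ≤ quadForm μ (commonWeight M N t) (commonDeviation P N uc t) :=
    quadForm_nonneg (commonWeight_posDef hQ hQT hR N t).posSemidef _
  have hlocal (t : ℕ) : ∀ i ∈ Finset.univ,
      0 ≤ quadForm μ (localWeight M N i t) (localDeviation p N ul i t) := fun i _ =>
    quadForm_nonneg (localWeight_posDef hQ hQT hR N i t).posSemidef _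
  rw [costGap, Finset.sum_eq_zero_iff_of_nonneg fun t _ =>
    add_nonneg (hcommon t) (Finset.sum_nonneg (hlocal t))]
  simp only [Finset.mem_range]
  refine forall₂_congr fun t ht => ?_
  rw [add_eq_zero_iff_of_nonneg (hcommon t) (Finset.sum_nonneg (hlocal t)),
    Finset.sum_eq_zero_iff_of_nonneg (hlocal t)]
  simp only [Finset.mem_univ, true_imp_iff]
  exact and_congr
    (quadForm_eq_zero_iff (commonWeight_posDef hQ hQT hR N t)
      ((hd.vecMem_commonDeviation N t).mono (hP.commonSpace_le_squareIntegrable (by omega))))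
    (forall_congr' fun i => quadForm_eq_zero_iff (localWeight_posDef hQ hQT hR N i t)
      ((hd.vecMem_localDeviation hp i t).mono (hP.localSpace_le_squareIntegrable i ht.le)))

end IsDecomposition

theorem costGap_nonneg (hQ : M.Q.PosSemidef) (hQT : M.QT.PosSemidef) (hR : M.R.PosDef) :
    0 ≤ costGap P p N uc ul μ :=
  Finset.sum_nonneg fun t _ =>
    add_nonneg (quadForm_nonneg (commonWeight_posDef hQ hQT hR N t).posSemidef _)
      (Finset.sum_nonneg fun i _ =>
        quadForm_nonneg (localWeight_posDef hQ hQT hR N i t).posSemidef _)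

end Cost

/-! ### Optimality of certainty equivalence -/

section CertaintyEquivalence

variable {n : ℕ} {M : Model n} {Ω : Type*} (P : Primitives M Ω) (N : ℕ)
  (p : ∀ i : Fin n, ℕ → Ω → Fin (M.dx i) → ℝ)

/-- The common part of the stacked state when the common part of the controls is certainty
equivalent. -/
def optimalCommonState : ℕ → Ω → M.StateIdx → ℝ
  | 0 => fun ω => Sum.elim (P.x₀ ω) 0
  | t + 1 => fun ω => M.A *ᵥ optimalCommonState t ω +
      M.B *ᵥ -(M.gainCom N t *ᵥ optimalCommonState t ω) + Sum.elim (P.w₀ t ω) 0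

/-- The certainty equivalent common part of the controls. -/
def optimalCommonControl (t : ℕ) (ω : Ω) : M.ControlIdx → ℝ :=
  -(M.gainCom N t *ᵥ optimalCommonState P N t ω)

/-- The local drift when the local part of the controls is certainty equivalent. -/
def optimalLocalDrift (i : Fin n) : ℕ → Ω → Fin (M.dx i) → ℝ
  | 0 => fun _ => 0
  | t + 1 => fun ω => M.A₁₁ i *ᵥ optimalLocalDrift i t ω +
      M.B₁₁ i *ᵥ -(M.gainLoc N i t *ᵥ (optimalLocalDrift i t ω + p i t ω))

/-- The certainty equivalent local part of the controls. -/
def optimalLocalControl (i : Fin n) (t : ℕ) (ω : Ω) : Fin (M.du i) → ℝ :=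
  -(M.gainLoc N i t *ᵥ (optimalLocalDrift N p i t ω + p i t ω))

theorem commonState_optimalCommonControl :
    commonState P (optimalCommonControl P N) = optimalCommonState P N := by
  funext t
  induction t with
  | zero => rfl
  | succ t ih => rw [commonState, ih]; rfl

theorem localDrift_optimalLocalControl (i : Fin n) :
    localDrift i (optimalLocalControl N p i) = optimalLocalDrift N p i := by
  funext t
  induction t with
  | zero => rfl
  | succ t ih => rw [localDrift, ih]; rfl

variable {P p}

theorem vecMem_optimalCommonState {W : Submodule ℝ (Ω → ℝ)} (hx : VecMem W P.x₀) {t : ℕ}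
    (hw : ∀ s < t, VecMem W (P.w₀ s)) : VecMem W (optimalCommonState P N t) := by
  induction t with
  | zero => exact hx.sumElim .zero
  | succ t ih =>
    have ih := ih fun s hs => hw s (hs.trans t.lt_succ_self)
    exact ((ih.mulVec _).add ((ih.mulVec _).neg.mulVec _)).add
      ((hw t t.lt_succ_self).sumElim .zero)

theorem vecMem_optimalLocalDrift {i : Fin n} (hp : ∀ t, VecMem (localSpace P i t) (p i t)) (t : ℕ) :
    VecMem (localSpace P i t) (optimalLocalDrift N p i t) := by
  induction t with
  | zero => exact .zero
  | succ t ih =>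
    exact ((ih.mulVec _).add ((ih.add (hp t)).mulVec _ |>.neg.mulVec _)).mono
      (localSpace_mono P i t.le_succ)

theorem exists_isDecomposition_optimal (hp : ∀ i t, VecMem (localSpace P i t) (p i t)) :
    ∃ g : M.AffineStrategy,
      IsDecomposition P g (optimalCommonControl P N) (optimalLocalControl N p) :=
  exists_strategy
    (fun t => ((vecMem_optimalCommonState N (vecMem_commonSpace_x₀ P t) fun _ hs =>
      vecMem_commonSpace_w₀ P hs).mulVec _).neg)
    fun i t => (((vecMem_optimalLocalDrift N (hp i) t).add (hp i t)).mulVec _).neg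

variable {N} [MeasurableSpace Ω] {μ : Measure Ω}

theorem isCertaintyEquivalent_optimal :
    IsCertaintyEquivalent P p N (optimalCommonControl P N) (optimalLocalControl N p) μ := by
  refine fun t _ => ⟨ae_of_all μ fun ω => ?_, fun i => ae_of_all μ fun ω => ?_⟩
  · rw [commonDeviation, commonState_optimalCommonControl]
    exact neg_add_cancel _
  · rw [localDeviation, localDrift_optimalLocalControl]
    exact neg_add_cancel _

variable {uc : ℕ → Ω → M.ControlIdx → ℝ} {ul : ∀ i : Fin n, ℕ → Ω → Fin (M.du i) → ℝ}

namespace IsCertaintyEquivalent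

theorem commonState_ae (h : IsCertaintyEquivalent P p N uc ul μ) {t : ℕ} (ht : t ≤ N) :
    ∀ᵐ ω ∂μ, commonState P uc t ω = optimalCommonState P N t ω := by
  induction t with
  | zero => exact ae_of_all μ fun _ => rfl
  | succ t ih =>
    filter_upwards [ih (by omega), (h t ht).1] with ω hx hu
    simp only [commonState, optimalCommonState, eq_neg_of_add_eq_zero_left hu, hx]

theorem common_ae (h : IsCertaintyEquivalent P p N uc ul μ) {t : ℕ} (ht : t < N) :
    ∀ᵐ ω ∂μ, uc t ω = optimalCommonControl P N t ω := by
  filter_upwards [h.commonState_ae ht.le, (h t ht).1] with ω hx hu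
  rw [optimalCommonControl, eq_neg_of_add_eq_zero_left hu, hx]

theorem localDrift_ae (h : IsCertaintyEquivalent P p N uc ul μ) (i : Fin n) {t : ℕ} (ht : t ≤ N) :
    ∀ᵐ ω ∂μ, localDrift i (ul i) t ω = optimalLocalDrift N p i t ω := by
  induction t with
  | zero => exact ae_of_all μ fun _ => rfl
  | succ t ih =>
    filter_upwards [ih (by omega), (h t ht).2 i] with ω hx hu
    simp only [localDrift, optimalLocalDrift, eq_neg_of_add_eq_zero_left hu, hx]

theorem local_ae (h : IsCertaintyEquivalent P p N uc ul μ) (i : Fin n) {t : ℕ} (ht : t < N) :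
    ∀ᵐ ω ∂μ, ul i t ω = optimalLocalControl N p i t ω := by
  filter_upwards [h.localDrift_ae i ht.le, (h t ht).2 i] with ω hx hu
  rw [optimalLocalControl, eq_neg_of_add_eq_zero_left hu, hx]

theorem control_ae {g : M.AffineStrategy} (h : IsCertaintyEquivalent P p N uc ul μ)
    (hd : IsDecomposition P g uc ul) {t : ℕ} (ht : t < N) :
    ∀ᵐ ω ∂μ, control P g t ω =
      optimalCommonControl P N t ω + minorStack fun i => optimalLocalControl N p i t ω := by
  filter_upwards [h.common_ae ht, ae_all_iff.2 fun i => h.local_ae i ht] with ω hc hl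
  simp only [hd.control_eq, hc, hl]

end IsCertaintyEquivalent

end CertaintyEquivalence

section Optimality

variable {n N : ℕ} {M : Model n} {Ω : Type*} [MeasurableSpace Ω] {μ : Measure Ω}
  [IsProbabilityMeasure μ] {P : Primitives M Ω} {S : M.Covariances}
  {p : ∀ i : Fin n, ℕ → Ω → Fin (M.dx i) → ℝ} {g g' : M.AffineStrategy}
  {uc : ℕ → Ω → M.ControlIdx → ℝ} {ul : ∀ i : Fin n, ℕ → Ω → Fin (M.du i) → ℝ}

namespace IsDecomposition

theorem u₀_ae_iff (hP : P.Admissible μ N S) (hd : IsDecomposition P g uc ul) {t : ℕ}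
    (ht : t ≤ N) :
    (∀ᵐ ω ∂μ, u₀ P g t ω = -(M.gainCom₀ N t *ᵥ xhatCom P g μ t ω)) ↔
      ∀ᵐ ω ∂μ, (fun a => commonDeviation P N uc t ω (Sum.inl a)) = 0 := by
  refine Filter.eventually_congr ?_
  filter_upwards [hd.xhatCom_ae hP ht] with ω hω
  rw [hω, hd.major, eq_neg_iff_add_eq_zero]
  rfl

theorem u_ae_iff (hP : P.Admissible μ N S) (hd : IsDecomposition P g uc ul)
    (hp : IsFreeEstimate P μ N p) (i : Fin n) {t : ℕ} (ht : t ≤ N) :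
    (∀ᵐ ω ∂μ, u P g i t ω = -(M.gainComMinor N i t *ᵥ xhatCom P g μ t ω)
      - M.gainLoc N i t *ᵥ (xhatLoc P g μ i t ω - xhatComMinor P g μ i t ω)) ↔
      ∀ᵐ ω ∂μ, minorPart i (commonDeviation P N uc t ω) + localDeviation p N ul i t ω = 0 := by
  refine Filter.eventually_congr ?_
  filter_upwards [hd.xhatCom_ae hP ht, hd.xhatLoc_ae hP hp i ht] with ω hcommon hlocal
  have hminor : xhatComMinor P g μ i t ω = minorPart i (commonState P uc t ω) := by
    rw [← hcommon]; rfl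
  have hdeviation : minorPart i (commonDeviation P N uc t ω) =
      minorPart i (uc t ω) + M.gainComMinor N i t *ᵥ commonState P uc t ω := rfl
  rw [hcommon, hlocal, hminor, hd.minor, add_sub_cancel_left, hdeviation, localDeviation,
    ← sub_eq_zero, sub_sub_eq_add_sub, sub_neg_eq_add]
  refine Eq.congr ?_ rfl
  abel

theorem deviation_ae_eq_zero_iff (hP : P.Admissible μ N S) (hd : IsDecomposition P g uc ul)
    (hp : IsFreeEstimate P μ N p) (i : Fin n) {t : ℕ} (ht : t ≤ N) :
    (∀ᵐ ω ∂μ, minorPart i (commonDeviation P N uc t ω) + localDeviation p N ul i t ω = 0) ↔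
      (∀ᵐ ω ∂μ, minorPart i (commonDeviation P N uc t ω) = 0) ∧
        ∀ᵐ ω ∂μ, localDeviation p N ul i t ω = 0 := by
  have hcommon := (hd.vecMem_commonDeviation N t).minorPart i
  have hlocal := hd.vecMem_localDeviation (N := N) hp i t
  exact add_ae_eq_zero_iff (hcommon.mono (hP.commonSpace_le_squareIntegrable (by omega)))
    (hlocal.mono (hP.localSpace_le_squareIntegrable i ht))
    ((hP.orthogonal_commonSpace_primSpace_localIdx (by omega) i).moment_eq_zero hcommon
      (hlocal.mono (localSpace_le_primSpace P i ht)))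

theorem hasOptimalForm_iff (hP : P.Admissible μ N S) (hd : IsDecomposition P g uc ul)
    (hp : IsFreeEstimate P μ N p) :
    HasOptimalForm P g μ N ↔ IsCertaintyEquivalent P p N uc ul μ :=
  forall₂_congr fun t ht => by
    rw [hd.u₀_ae_iff hP ht.le, forall_congr' fun i => (hd.u_ae_iff hP hp i ht.le).trans
      (hd.deviation_ae_eq_zero_iff hP hp i ht.le), forall_and, ← and_assoc,
      ← stacked_ae_eq_zero_iff]

theorem isOptimal_iff (hP : P.Admissible μ N S) (hQ : M.Q.PosSemidef) (hQT : M.QT.PosSemidef)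
    (hR : M.R.PosDef) (hd : IsDecomposition P g uc ul) (hp : IsFreeEstimate P μ N p) :
    IsOptimal P g μ N ↔ IsCertaintyEquivalent P p N uc ul μ := by
  rw [← hd.costGap_eq_zero_iff hP hQ hQT hR hp]
  constructor
  · intro hg
    obtain ⟨g', hd'⟩ := exists_isDecomposition_optimal N hp.mem
    have hle := hg g'
    rw [hd.cost_eq hP hQ hQT hR hp, hd'.cost_eq hP hQ hQT hR hp,
      (hd'.costGap_eq_zero_iff hP hQ hQT hR hp).2 isCertaintyEquivalent_optimal] at hle
    exact le_antisymm (le_of_add_le_add_left hle) (costGap_nonneg hQ hQT hR)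
  · intro hgap g'
    obtain ⟨uc', ul', hd'⟩ := exists_isDecomposition P g'
    rw [hd.cost_eq hP hQ hQT hR hp, hd'.cost_eq hP hQ hQT hR hp, hgap]
    exact add_le_add_right (costGap_nonneg hQ hQT hR) _

end IsDecomposition

namespace Primitives.Admissible

theorem isOptimal_iff_hasOptimalForm (hP : P.Admissible μ N S) (hQ : M.Q.PosSemidef)
    (hQT : M.QT.PosSemidef) (hR : M.R.PosDef) :
    IsOptimal P g μ N ↔ HasOptimalForm P g μ N := by
  obtain ⟨p, hp⟩ := hP.exists_isFreeEstimate
  obtain ⟨uc, ul, hd⟩ := exists_isDecomposition P g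
  rw [hd.hasOptimalForm_iff hP hp, hd.isOptimal_iff hP hQ hQT hR hp]

theorem exists_isOptimal (hP : P.Admissible μ N S) (hQ : M.Q.PosSemidef)
    (hQT : M.QT.PosSemidef) (hR : M.R.PosDef) : ∃ g : M.AffineStrategy, IsOptimal P g μ N := by
  obtain ⟨p, hp⟩ := hP.exists_isFreeEstimate
  obtain ⟨g, hd⟩ := exists_isDecomposition_optimal N hp.mem
  exact ⟨g, (hd.isOptimal_iff hP hQ hQT hR hp).2 isCertaintyEquivalent_optimal⟩

theorem control_ae_eq_of_isOptimal (hP : P.Admissible μ N S) (hQ : M.Q.PosSemidef)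
    (hQT : M.QT.PosSemidef) (hR : M.R.PosDef) (hg : IsOptimal P g μ N) (hg' : IsOptimal P g' μ N)
    {t : ℕ} (ht : t < N) : ∀ᵐ ω ∂μ, control P g t ω = control P g' t ω := by
  obtain ⟨p, hp⟩ := hP.exists_isFreeEstimate
  obtain ⟨uc, ul, hd⟩ := exists_isDecomposition P g
  obtain ⟨uc', ul', hd'⟩ := exists_isDecomposition P g'
  filter_upwards [((hd.isOptimal_iff hP hQ hQT hR hp).1 hg).control_ae hd ht,
    ((hd'.isOptimal_iff hP hQ hQT hR hp).1 hg').control_ae hd' ht] with ω h h'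
  rw [h, h']

end Primitives.Admissible

end Optimality

/-! ### Linearity of the estimates under an optimal strategy -/

section Data

variable {n : ℕ} {M : Model n} {Ω : Type*} {P : Primitives M Ω} {g : M.AffineStrategy}
  {W : Submodule ℝ (Ω → ℝ)} {t : ℕ}

theorem vecMem_info₀_of_state_control (hx : ∀ s ≤ t, VecMem W (state P g s))
    (hu : ∀ s < t, VecMem W (control P g s)) : VecMem W (info₀ P g t) :=
  .prodMk (.pi fun s => (hx s s.is_le).precomp Sum.inl)
    (.pi fun s => (hu s s.is_lt).precomp Sum.inl)

theorem vecMem_info_of_state_control {i : Fin n} (hx : ∀ s ≤ t, VecMem W (state P g s))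
    (hu : ∀ s < t, VecMem W (control P g s)) (hv : ∀ s ≤ t, VecMem W (P.v i s)) :
    VecMem W (info P g i t) :=
  .prodMk (.pi fun s => (hx s s.is_le).precomp Sum.inl)
    (.prodMk (.pi fun s => (((hx s s.is_le).minorPart i).mulVec (M.C i)).add (hv s s.is_le))
      (.prodMk (.pi fun s => (hu s s.is_lt).precomp Sum.inl)
        (.pi fun s => (hu s s.is_lt).minorPart i)))

end Data

section Linearity

variable {n N : ℕ} {M : Model n} {Ω : Type*} [MeasurableSpace Ω] {μ : Measure Ω}
  [IsProbabilityMeasure μ] {P : Primitives M Ω} {S : M.Covariances}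
  {p : ∀ i : Fin n, ℕ → Ω → Fin (M.dx i) → ℝ} {g : M.AffineStrategy}
  {uc : ℕ → Ω → M.ControlIdx → ℝ} {ul : ∀ i : Fin n, ℕ → Ω → Fin (M.du i) → ℝ}

theorem Primitives.Admissible.vecMem_centred_optimalCommonState (hP : P.Admissible μ N S) {t : ℕ}
    (ht : t ≤ N) : VecMem (centred μ) (optimalCommonState P N t) :=
  vecMem_optimalCommonState N (hP.vecMem_centred_var .x₀) fun s hs =>
    hP.vecMem_centred_var (.w₀ ⟨s, by omega⟩)

namespace IsDecomposition

theorem vecMem_centred_state (hP : P.Admissible μ N S) (hd : IsDecomposition P g uc ul)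
    (h : IsCertaintyEquivalent P p N uc ul μ) {t : ℕ} (ht : t ≤ N) :
    VecMem (centred μ) (state P g t) := by
  rw [funext (hd.state_eq t)]
  exact (((vecMem_commonState hd.common_mem t).mono (hP.commonSpace_le_squareIntegrable
      (by omega))).centred_congr (hP.vecMem_centred_optimalCommonState ht)
        (h.commonState_ae ht)).add
    (.minorStack fun i => (hd.vecMem_localState i ht).mono (hP.primSpace_le_centred _))

theorem vecMem_centred_control (hP : P.Admissible μ N S) (hd : IsDecomposition P g uc ul)
    (h : IsCertaintyEquivalent P p N uc ul μ) {t : ℕ} (ht : t < N) :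
    VecMem (centred μ) (control P g t) := by
  rw [funext (hd.control_eq t)]
  exact (((hd.common_mem t).mono (hP.commonSpace_le_squareIntegrable (by omega))).centred_congr
      ((hP.vecMem_centred_optimalCommonState ht.le).mulVec _).neg (h.common_ae ht)).add
    (.minorStack fun i => (hd.vecMem_primSpace_local i ht.le).mono (hP.primSpace_le_centred _))

theorem exists_linear_isLLMSEstimator_info₀ (hP : P.Admissible μ N S)
    (hd : IsDecomposition P g uc ul) (h : IsCertaintyEquivalent P p N uc ul μ) {t : ℕ}
    (ht : t ≤ N) : ∃ f : M.Info₀ t →ₗ[ℝ] (M.StateIdx → ℝ),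
      IsLLMSEstimator μ (info₀ P g t) (state P g t) f.toAffineMap :=
  (hd.isProjection_commonState hP ht).exists_linear_isLLMSEstimator
    (vecMem_info₀_of_state_control (fun _ hs => hd.vecMem_centred_state hP h (hs.trans ht))
      fun _ hs => hd.vecMem_centred_control hP h (hs.trans_le ht))
    (hd.vecMem_centred_state hP h ht)

theorem exists_linear_isLLMSEstimator_info (hP : P.Admissible μ N S)
    (hd : IsDecomposition P g uc ul) (hp : IsFreeEstimate P μ N p)
    (h : IsCertaintyEquivalent P p N uc ul μ) (i : Fin n) {t : ℕ} (ht : t ≤ N) :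
    ∃ f : M.Info i t →ₗ[ℝ] (M.StateIdx → ℝ),
      IsLLMSEstimator μ (info P g i t) (state P g t) f.toAffineMap :=
  (hd.isProjection_minorEstimate hP hp i ht).exists_linear_isLLMSEstimator
    (vecMem_info_of_state_control (fun _ hs => hd.vecMem_centred_state hP h (hs.trans ht))
      (fun _ hs => hd.vecMem_centred_control hP h (hs.trans_le ht))
      fun s hs => hP.vecMem_centred_var (.v i ⟨s, by omega⟩))
    (hd.vecMem_centred_state hP h ht)

end IsDecomposition

end Linearity

/-! ### The estimates under an arbitrary strategy -/

section Estimates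

variable {n N : ℕ} {M : Model n} {Ω : Type*} [MeasurableSpace Ω] {μ : Measure Ω}
  [IsProbabilityMeasure μ] {P : Primitives M Ω} {S : M.Covariances}
  {p : ∀ i : Fin n, ℕ → Ω → Fin (M.dx i) → ℝ} {g : M.AffineStrategy}
  {uc : ℕ → Ω → M.ControlIdx → ℝ} {ul : ∀ i : Fin n, ℕ → Ω → Fin (M.du i) → ℝ}

namespace IsDecomposition

theorem exists_isLLMSEstimator_info₀ (hP : P.Admissible μ N S) (hd : IsDecomposition P g uc ul)
    {t : ℕ} (ht : t ≤ N) : ∃ f, IsLLMSEstimator μ (info₀ P g t) (state P g t) f :=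
  (hd.isProjection_commonState hP ht).exists_isLLMSEstimator (hP.vecMem_info₀ ht)
    (hd.vecMem_state hP ht)

theorem exists_isLLMSEstimator_info (hP : P.Admissible μ N S) (hd : IsDecomposition P g uc ul)
    (hp : IsFreeEstimate P μ N p) (i : Fin n) {t : ℕ} (ht : t ≤ N) :
    ∃ f, IsLLMSEstimator μ (info P g i t) (state P g t) f :=
  (hd.isProjection_minorEstimate hP hp i ht).exists_isLLMSEstimator (hP.vecMem_info i ht)
    (hd.vecMem_state hP ht)

theorem xhatCom_ae_condExp (hP : P.Admissible μ N S) (hd : IsDecomposition P g uc ul) {t : ℕ}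
    (ht : t ≤ N) : xhatCom P g μ t =ᵐ[μ] μ[state P g t | commonSigma P g t] := by
  have hlocal : VecMem (primSpace P N (commonIdx n N t)ᶜ) fun ω =>
      (minorStack fun i => localState P i (ul i) t ω : M.StateIdx → ℝ) :=
    .minorStack fun i => (hd.vecMem_localState i ht).mono (primSpace_mono P
      (disjoint_commonIdx_localIdx i t t).symm.subset_compl_right)
  have hcondExp := hP.condExp_commonSigma_add g (ht.trans N.le_succ)
    (vecMem_commonState hd.common_mem t) disjoint_compl_right hlocal
  rw [← funext (hd.state_eq t)] at hcondExp
  exact Filter.EventuallyEq.trans (hd.xhatCom_ae hP ht) hcondExp.symm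

theorem controlCom_ae (hP : P.Admissible μ N S) (hd : IsDecomposition P g uc ul) {t : ℕ}
    (ht : t ≤ N) : ∀ᵐ ω ∂μ, controlCom P g μ t ω = uc t ω := by
  have hlocal : VecMem (primSpace P N (commonIdx n N t)ᶜ) fun ω =>
      (minorStack fun i => ul i t ω : M.ControlIdx → ℝ) :=
    .minorStack fun i => (hd.vecMem_primSpace_local i ht).mono (primSpace_mono P
      (disjoint_commonIdx_localIdx i t t).symm.subset_compl_right)
  have hcondExp := hP.condExp_commonSigma_add g (ht.trans N.le_succ) (hd.common_mem t)
    disjoint_compl_right hlocal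
  rwa [← funext (hd.control_eq t)] at hcondExp

theorem xhatCom_zero (hP : P.Admissible μ N S) (hd : IsDecomposition P g uc ul) :
    ∀ᵐ ω ∂μ, xhatCom P g μ 0 ω = Sum.elim (x₀ P g 0 ω) 0 := by
  filter_upwards [hd.xhatCom_ae hP N.zero_le] with ω hω
  rw [hω, x₀_zero]
  rfl

theorem xhatCom_succ (hP : P.Admissible μ N S) (hd : IsDecomposition P g uc ul)
    {t : ℕ} (ht : t < N) : ∀ᵐ ω ∂μ, xhatCom P g μ (t + 1) ω =
      M.A *ᵥ (Sum.elim (x₀ P g t ω) fun p => xhatComMinor P g μ p.1 t ω p.2)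
      + M.B *ᵥ (Sum.elim (u₀ P g t ω) fun p => controlCom P g μ t ω (Sum.inr p))
      + Sum.elim (x₀ P g (t + 1) ω - M.A₀₀ *ᵥ (x₀ P g t ω) - M.B₀₀ *ᵥ (u₀ P g t ω)) 0 := by
  filter_upwards [hd.xhatCom_ae hP ht, hd.xhatCom_ae hP ht.le, hd.controlCom_ae hP ht.le]
    with ω hnext hstate hcontrol
  have hx : (Sum.elim (x₀ P g t ω) fun p => xhatComMinor P g μ p.1 t ω p.2) =
      commonState P uc t ω := by
    refine stacked_ext (fun a => ?_) fun i => ?_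
    · rw [hd.x₀_eq]; rfl
    · funext a
      rw [← hstate]; rfl
  have hu : (Sum.elim (u₀ P g t ω) fun p => controlCom P g μ t ω (Sum.inr p)) = uc t ω := by
    refine stacked_ext (fun a => ?_) fun i => ?_
    · rw [hd.major]; rfl
    · rw [hcontrol]; rfl
  rw [hnext, hx, hu, x₀_succ, add_assoc (M.A₀₀ *ᵥ _), add_sub_cancel_left, add_sub_cancel_left]
  rfl

end IsDecomposition

namespace IsFreeEstimate

theorem xhatLoc_zero (hP : P.Admissible μ N S) (hp : IsFreeEstimate P μ N p)
    (g : M.AffineStrategy) {i : Fin n} (hu : IsUnit (Model.filterInnovationCov S i 0)) :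
    ∀ᵐ ω ∂μ, xhatLoc P g μ i 0 ω = Model.filterGain S i 0 *ᵥ (y P g i 0 ω) := by
  filter_upwards [hp.error_ae hP N.zero_le (i := i) fun s hs => by rwa [Nat.le_zero.1 hs],
    hp.xhatLoc_ae hP g i N.zero_le] with ω herror hxhat
  rw [hxhat, herror, innovation, predictionError_zero, y, x_zero, sub_sub_cancel]

theorem prediction_ae (hP : P.Admissible μ N S) (hp : IsFreeEstimate P μ N p)
    (g : M.AffineStrategy) (i : Fin n) {t : ℕ} (ht : t ≤ N) :
    ∀ᵐ ω ∂μ, prediction P g μ i t ω = x P g i (t + 1) ω - predictionError P p i (t + 1) ω := by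
  filter_upwards [hp.xhatLoc_ae hP g i ht] with ω hxhat
  simp only [prediction, hxhat, x_succ, predictionError_succ, mulVec_sub]
  abel

theorem xhatLoc_succ (hP : P.Admissible μ N S) (hp : IsFreeEstimate P μ N p)
    (g : M.AffineStrategy) {i : Fin n} {t : ℕ} (ht : t < N)
    (hu : ∀ s ≤ t + 1, IsUnit (Model.filterInnovationCov S i s)) :
    ∀ᵐ ω ∂μ, xhatLoc P g μ i (t + 1) ω = prediction P g μ i t ω
      + Model.filterGain S i (t + 1) *ᵥ
          (y P g i (t + 1) ω - (M.C i) *ᵥ (prediction P g μ i t ω)) := by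
  filter_upwards [hp.error_ae hP ht hu, hp.xhatLoc_ae hP g i ht, hp.prediction_ae hP g i ht.le]
    with ω herror hxhat hprediction
  have hinnovation : y P g i (t + 1) ω - M.C i *ᵥ prediction P g μ i t ω =
      innovation P p i (t + 1) ω := by
    rw [hprediction, innovation, y, mulVec_sub]
    abel
  rw [hinnovation, hxhat, herror, hprediction, sub_sub_eq_add_sub, add_sub_right_comm]

theorem covMatrix_error (hP : P.Admissible μ N S) (hp : IsFreeEstimate P μ N p)
    (g : M.AffineStrategy) {i : Fin n} {t : ℕ} (ht : t ≤ N)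
    (hu : ∀ s ≤ t, IsUnit (Model.filterInnovationCov S i s)) :
    covMatrix μ (fun ω => x P g i t ω - xhatLoc P g μ i t ω) = Model.errorCov S i t := by
  rw [← hp.moment_error hP ht hu, ← covMatrix_eq_moment
    ((hp.vecMem_error i ht).mono (hP.primSpace_le_centred _))]
  refine covMatrix_congr ?_
  filter_upwards [hp.xhatLoc_ae hP g i ht] with ω hω
  rw [hω, sub_sub_cancel]

end IsFreeEstimate

end Estimates

end MajorMinor

end

open MeasureTheory MajorMinor in
theorem mainTheorem2 {n : ℕ} (M : Model n) (N : ℕ)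
    (hQ : M.Q.PosSemidef) (hQT : M.QT.PosSemidef) (hR : M.R.PosDef)
    {Ω : Type*} [MeasurableSpace Ω] (μ : Measure Ω) [IsProbabilityMeasure μ]
    (P : Primitives M Ω) (S : M.Covariances) (hP : P.Admissible μ N S) :
    -- a best affine strategy exists
    (∃ g : M.AffineStrategy, IsOptimal P g μ N) ∧
    -- it is unique: any two best strategies produce the same controls almost surely
    (∀ g g' : M.AffineStrategy, IsOptimal P g μ N → IsOptimal P g' μ N → ∀ t < N,
      (∀ᵐ ω ∂μ, u₀ P g t ω = u₀ P g' t ω) ∧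
      ∀ i, ∀ᵐ ω ∂μ, u P g i t ω = u P g' i t ω) ∧
    -- it is characterized by its form
    (∀ g : M.AffineStrategy, IsOptimal P g μ N ↔ HasOptimalForm P g μ N) ∧
    -- under a best strategy the LLMS estimates are linear in the data, without constant terms
    (∀ g : M.AffineStrategy, IsOptimal P g μ N → ∀ t ≤ N,
      (∃ f : M.Info₀ t →ₗ[ℝ] (M.StateIdx → ℝ),
        IsLLMSEstimator μ (info₀ P g t) (state P g t) f.toAffineMap) ∧
      ∀ i, ∃ f : M.Info i t →ₗ[ℝ] (M.StateIdx → ℝ),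
        IsLLMSEstimator μ (info P g i t) (state P g t) f.toAffineMap) ∧
    -- the estimates, under an arbitrary affine strategy
    (∀ g : M.AffineStrategy,
      -- LLMS estimators exist
      (∀ t ≤ N,
        (∃ f, IsLLMSEstimator μ (info₀ P g t) (state P g t) f) ∧
        ∀ i, ∃ f, IsLLMSEstimator μ (info P g i t) (state P g t) f) ∧
      -- the major agent's LLMS estimate is its MMSE estimate
      (∀ t ≤ N, xhatCom P g μ t =ᵐ[μ] μ[state P g t | commonSigma P g t]) ∧
      -- and is updated recursively
      (∀ᵐ ω ∂μ, xhatCom P g μ 0 ω = Sum.elim (x₀ P g 0 ω) 0) ∧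
      (∀ t < N, ∀ᵐ ω ∂μ, xhatCom P g μ (t + 1) ω =
        M.A *ᵥ (Sum.elim (x₀ P g t ω) fun p => xhatComMinor P g μ p.1 t ω p.2)
        + M.B *ᵥ (Sum.elim (u₀ P g t ω) fun p => controlCom P g μ t ω (Sum.inr p))
        + Sum.elim (x₀ P g (t + 1) ω - M.A₀₀ *ᵥ (x₀ P g t ω) - M.B₀₀ *ᵥ (u₀ P g t ω)) 0) ∧
      -- the minor agents' LLMS estimates follow the recursive least squares filter
      (∀ i,
        (IsUnit (Model.filterInnovationCov S i 0) → ∀ᵐ ω ∂μ,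
          xhatLoc P g μ i 0 ω = Model.filterGain S i 0 *ᵥ (y P g i 0 ω)) ∧
        (∀ t < N, (∀ s ≤ t + 1, IsUnit (Model.filterInnovationCov S i s)) → ∀ᵐ ω ∂μ,
          xhatLoc P g μ i (t + 1) ω = prediction P g μ i t ω
            + Model.filterGain S i (t + 1) *ᵥ
                (y P g i (t + 1) ω - (M.C i) *ᵥ (prediction P g μ i t ω))) ∧
        (∀ t ≤ N, (∀ s ≤ t, IsUnit (Model.filterInnovationCov S i s)) →
          covMatrix μ (fun ω => x P g i t ω - xhatLoc P g μ i t ω) = Model.errorCov S i t))) := by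
  obtain ⟨p, hp⟩ := hP.exists_isFreeEstimate
  refine ⟨hP.exists_isOptimal hQ hQT hR, fun g g' hg hg' t ht => ?_,
    fun g => hP.isOptimal_iff_hasOptimalForm hQ hQT hR, fun g hg t ht => ?_, fun g => ?_⟩
  · have hcontrol := hP.control_ae_eq_of_isOptimal hQ hQT hR hg hg' ht
    exact ⟨hcontrol.mono fun ω h => funext fun a => congrFun h (Sum.inl a),
      fun i => hcontrol.mono fun ω h => funext fun a => congrFun h (Sum.inr ⟨i, a⟩)⟩
  · obtain ⟨uc, ul, hd⟩ := exists_isDecomposition P g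
    have hequiv := (hd.isOptimal_iff hP hQ hQT hR hp).1 hg
    exact ⟨hd.exists_linear_isLLMSEstimator_info₀ hP hequiv ht,
      fun i => hd.exists_linear_isLLMSEstimator_info hP hp hequiv i ht⟩
  · obtain ⟨uc, ul, hd⟩ := exists_isDecomposition P g
    exact ⟨fun t ht => ⟨hd.exists_isLLMSEstimator_info₀ hP ht,
        fun i => hd.exists_isLLMSEstimator_info hP hp i ht⟩,
      fun t ht => hd.xhatCom_ae_condExp hP ht, hd.xhatCom_zero hP,
      fun t ht => hd.xhatCom_succ hP ht,
      fun i => ⟨hp.xhatLoc_zero hP g, fun t ht hu => hp.xhatLoc_succ hP g ht hu,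
        fun t ht hu => hp.covMatrix_error hP g ht hu⟩⟩
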